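/- A graph $G$ on $n$ vertices is *even-degenerate* if its vertices can be ordered $v_1,\dots,v_n$ so that for every $1\le i\le n-2$ the vertex $v_i$ has an even number of neighbours in $\{v_{i+1},\dots,v_n\}$. For $0<\alpha<1/2$ and $p\in(0,1)$, a random graph $G=(V,E)$ on $n$ vertices is an *$\alpha$-partially revealed $p$-graph* if there is a fixed set $A\subseteq V$ with $|A|\le n^{1-2\alpha}$ such that $G$ has the law of $G(n,p)$ on $V$ conditioned on some feasible (positive-probability) value of the following information: the induced subgraph $G[A]$, the parities of $\deg_G(a)$ for all $a\in A$, and the parity of $|E|$. Let $f_\alpha(n)$ (which also depends on $p$) be the maximum, over all $\alpha$-partially revealed $p$-graphs $G$ on $n$ vertices, of the probability that $G$ is not even-degenerate. **Theorem.** Let $0<\alpha<1/2$ and $p\in(0,1)$ be constants. There exist a positive integer $N_0$, a constant $c>0$ and a function $g:\mathbb N\to\mathbb R$ with $g(n)=o(n)$, all depending only on $p$ and $\alpha$, such that for every $n\ge N_0$ the interval $[n/4-g(n),\,n/4+g(n)]$ contains a nonnegative integer and $$1-f_\alpha(n)\;\ge\;\bigl(1-e^{-c\,n^{1/2-\alpha}}\bigr)\Bigl(1-\max_{n'\in[n/4-g(n),\,n/4+g(n)]}f_\alpha(n')^2\Bigr),$$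 where $n'$ ranges over the nonnegative integers in that interval. -/

import Mathlib

open scoped ProbabilityTheory

namespace EvenDegeneracy

/-- `G` is even-degenerate: its vertices can be ordered `v 0, …, v (n - 1)` (`n` the number of
vertices) so that every vertex except the last two has an even number of neighbours among the
vertices that come after it. -/
def EvenDegenerate {V : Type*} [Fintype V] (G : SimpleGraph V) : Prop :=
  ∃ v : Fin (Fintype.card V) ≃ V, ∀ i : Fin (Fintype.card V),
    (i : ℕ) + 2 < Fintype.card V → Even (G.neighborSet (v i) ∩ v '' Set.Ioi i).ncard

/-- The event that the information revealed about a graph `G` on `V` with revealed part `A` is: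
the subgraph induced on `A` is `H`, the degree of each `a ∈ A` in `G` has parity `s a`, and the
total number of edges of `G` has parity `t`. -/
def revealEvent {V : Type*} (A : Set V) (H : SimpleGraph A) (s : A → ZMod 2) (t : ZMod 2) :
    Set (SimpleGraph V) :=
  {G | G.induce A = H ∧ (∀ a : A, ((G.neighborSet a).ncard : ZMod 2) = s a) ∧
    (G.edgeSet.ncard : ZMod 2) = t}

/-- `μ` is the law of an `α`-partially revealed `p`-graph on the finite vertex set `V`: for some
`A ⊆ V` with `|A| ≤ |V| ^ (1 - 2α)`, it is the law `G(V, p)` conditioned on some feasible value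
(one of positive probability) of the induced subgraph on `A`, the degree parities of the vertices
in `A` and the parity of the number of edges. -/
def IsPartiallyRevealed {V : Type*} [Fintype V] (α : ℝ) (p : unitInterval)
    (μ : MeasureTheory.Measure (SimpleGraph V)) : Prop :=
  ∃ (A : Set V) (H : SimpleGraph A) (s : A → ZMod 2) (t : ZMod 2),
    (A.ncard : ℝ) ≤ (Fintype.card V : ℝ) ^ (1 - 2 * α) ∧
    SimpleGraph.binomialRandom V p (revealEvent A H s t) ≠ 0 ∧
    μ = ProbabilityTheory.cond (SimpleGraph.binomialRandom V p) (revealEvent A H s t)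

/-- The set of all values of the probability of not being even-degenerate, over all
`α`-partially revealed `p`-graphs on `n` vertices. -/
def failureProbs (α : ℝ) (p : unitInterval) (n : ℕ) : Set ℝ :=
  {x | ∃ μ : MeasureTheory.Measure (SimpleGraph (Fin n)),
    IsPartiallyRevealed α p μ ∧ x = μ.real {G | ¬ EvenDegenerate G}}

/-- `f_α(n)`: the maximum probability of not being even-degenerate, over all `α`-partially
revealed `p`-graphs on `n` vertices. -/
noncomputable def worstFailureProb (α : ℝ) (p : unitInterval) (n : ℕ) : ℝ :=
  sSup (failureProbs α p n)

/-- The supremum defining `worstFailureProb` is an attained maximum. -/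
theorem isGreatest_worstFailureProb (α : ℝ) (p : unitInterval) (hp1 : p < 1)
    (n : ℕ) : IsGreatest (failureProbs α p n) (worstFailureProb α p n) := by
  have hfin : (failureProbs α p n).Finite := by
    have : (failureProbs α p n) ⊆ Set.range
        (fun q : (Σ A : Set (Fin n), SimpleGraph A × (A → ZMod 2) × ZMod 2) =>
          (ProbabilityTheory.cond (SimpleGraph.binomialRandom (Fin n) p)
            (revealEvent q.1 q.2.1 q.2.2.1 q.2.2.2)).real {G | ¬ EvenDegenerate G}) := by
      rintro x ⟨μ, ⟨A, H, s, t, _, _, rfl⟩, rfl⟩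
      exact ⟨⟨A, H, s, t⟩, rfl⟩
    refine Set.Finite.subset ?_ this
    have : ∀ A : Set (Fin n), Finite (A → ZMod 2) := fun A => Pi.finite
    exact Set.finite_range _
  have hne : (failureProbs α p n).Nonempty := by
    refine ⟨_, _, ⟨∅, ⊥, fun _ => 0, 0, ?_, ?_, rfl⟩, rfl⟩
    · simp only [Set.ncard_empty, Nat.cast_zero]
      positivity
    · intro h
      have hmem : (⊥ : SimpleGraph (Fin n)) ∈
          revealEvent (∅ : Set (Fin n)) ⊥ (fun _ => 0) 0 := by
        refine ⟨by ext a; exact a.2.elim, fun a => a.2.elim, by simp⟩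
      have h0 := MeasureTheory.measure_mono_null (Set.singleton_subset_iff.2 hmem) h
      rw [SimpleGraph.binomialRandom_singleton] at h0
      have : unitInterval.toNNReal (unitInterval.symm p) ≠ 0 := by
        intro h1
        have h2 := congrArg NNReal.toReal h1
        have h3 : (p : ℝ) < 1 := hp1
        simp at h2
        linarith
      simp [this] at h0
  exact hne.csSup_mem hfin |> fun h => ⟨h, fun x hx => le_csSup hfin.bddAbove hx⟩

end EvenDegeneracy

/-!
# The recursive bound for the probability of failing to be even-degenerate

Let `A` be the revealed part of a partially revealed graph on `n` vertices. The other vertices are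
split into two blocks `q false`, `q true` of the same size `m`, about `n / 4`, and two blocks
`h false`, `h true` of helpers, each with at least `|A| + m + 2 * K` vertices, where `K` is of order
`n ^ (1 / 2 - α)`. For each `i` there is an attempt to delete everything except `q i` and `K`
helpers from `h i`, one vertex of even degree at a time. If an attempt succeeds, the graph is
even-degenerate as soon as the leftover graph on `m + K` vertices is. So the theorem follows from
three facts: both attempts succeed except with probability exponentially small in `K`; a leftover
graph is again a partially revealed graph, whose revealed part is the set of the `K` helpers kept;
and the two leftover graphs are conditionally independent, so that both fail with probability at
most `f_α(m + K) ^ 2`.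

*An attempt* (`Win`, `expect_not_win_le`). The targets are deleted in a fixed order. A target of
even degree is deleted at once; a target of odd degree becomes even when an adjacent helper of even
degree is deleted. The edges between a target and the helpers are fresh when it is its turn. Its
deletion adds these edges to the degree parities of the helpers and so mixes them: with
`π = min p (1 - p)`, the product over the helpers `u` of `1 - π` (for `u` of even degree) or `1`
(for `u` of odd degree), which bounds the probability that the next target has no helper available,
has expectation at most `(1 - π ^ 2) ^ |U|` after the round, `U` being the set of helpers left.
Since `K` helpers remain at the end, every round costs at most two terms `(1 - π ^ 2) ^ K`. The same
process without targets reduces the helpers of the other attempt.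

*Fair pairs.* A bit of probability `p` is sampled together with a flag such that, given that the
flag is raised, the bit is a fair coin (`letterWeight`, `expect_flip`). Adding to a configuration a
vector that depends on the flags and is supported on flagged pairs does not change the law. This is
used twice. First, if every vertex outside the `q`-blocks has a flagged pair with a vertex of a
suitable `q`-block, the degree parities of these vertices are independent fair coins
(`expect_masked`), which provides the uniform initial state of the process even after the edges
inside `A`, the degree parities on `A` and, by a flagged pair between the `q`-blocks, the parity of
the number of edges are conditioned on (`expect_attempt_fails_le`, `expect_not_good_le`). The flags
themselves may misbehave with probability of order `n * (1 - π ^ 2) ^ m`; conditioning costs a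
factor `2 ^ (|A| + 1)`, which is harmless since `|A| = o(n)`.

*Independence.* An attempt to keep `q i` only looks at `info`: the edges meeting `A`, those among
helpers, those between helpers and the `q`-block opposite to theirs, the degree parity of each
helper into its own `q`-block, and, because the other `q`-block is deleted in increasing order with
all of `q i` still present, for each vertex of a `q`-block the parity of the number of its
neighbours in the opposite `q`-block or later in its own (`Reach.of_info_eq`); the parities of the
numbers of edges inside the `q`-blocks and the flags between them are included as well. As deletions
of even degree preserve the parity of the number of edges, `info` also determines the event on which
the graph is conditioned (`Good.mem_revealEvent`). Given `info`, the edges inside `q i` and between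
`q i` and its helpers are subject to the degree parities of the helpers and the parity of the number
of edges, which is a revelation as in the definition of `f_α`, and to the combined parities at the
vertices of `q i`. The latter impose nothing: when the flags link the two `q`-blocks (`Linked`), any
change of the combined parities with sum zero is the boundary of a vector on flagged pairs between
the `q`-blocks, so that these pairs absorb it (`expect_sameCross_eq`). Hence the conditional law of
the two leftover graphs is a product (`expect_info_eq_mul`, `expect_info_le`), and `expect_good_le`
sums over the values of `info`.

The bound for fixed block sizes is `le_one_sub_cond`; `eventually_bounds` chooses `K` and `m`.
-/

namespace EvenDegeneracy

/-! ### Finite product weights -/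

section Expect

variable {ι β : Type*} [Fintype ι] [DecidableEq ι] [Fintype β]

/-- The expectation of `F` when the coordinates of `x : ι → β` are independent, each with
law `w` on the finite type `β`. -/
noncomputable def expect (w : β → ℝ) (F : (ι → β) → ℝ) : ℝ :=
  ∑ x, (∏ i, w (x i)) * F x

open scoped Classical in
/-- The indicator function of a proposition, with real values. -/
noncomputable def ind (P : Prop) : ℝ := if P then 1 else 0

/-- `w` is a probability vector on the finite type `β`. -/
structure IsProbVec (w : β → ℝ) : Prop where
  nonneg : ∀ b, 0 ≤ w b
  sum_eq_one : ∑ b, w b = 1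

lemma ind_nonneg (P : Prop) : 0 ≤ ind P := by unfold ind; split_ifs <;> simp
lemma ind_le_one (P : Prop) : ind P ≤ 1 := by unfold ind; split_ifs <;> simp
lemma ind_of_true {P : Prop} (h : P) : ind P = 1 := by simp [ind, h]
lemma ind_of_false {P : Prop} (h : ¬P) : ind P = 0 := by simp [ind, h]
lemma ind_mono {P Q : Prop} (h : P → Q) : ind P ≤ ind Q := by
  by_cases hP : P
  · simp [ind, hP, h hP]
  · rw [ind_of_false hP]; exact ind_nonneg _
lemma ind_and (P Q : Prop) : ind (P ∧ Q) = ind P * ind Q := by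
  by_cases hP : P <;> by_cases hQ : Q <;> simp [ind, hP, hQ]
lemma ind_or_le (P Q : Prop) : ind (P ∨ Q) ≤ ind P + ind Q := by
  by_cases hP : P <;> by_cases hQ : Q <;> simp [ind, hP, hQ]
lemma ind_not (P : Prop) : ind (¬P) = 1 - ind P := by
  by_cases hP : P <;> simp [ind, hP]

omit [DecidableEq ι] in
lemma prodWeight_nonneg {w : β → ℝ} (hw : IsProbVec w) (x : ι → β) : 0 ≤ ∏ i, w (x i) :=
  Finset.prod_nonneg fun _ _ => hw.nonneg _

lemma expect_mono {w : β → ℝ} (hw : IsProbVec w) {F G : (ι → β) → ℝ} (h : ∀ x, F x ≤ G x) :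
    expect w F ≤ expect w G :=
  Finset.sum_le_sum fun x _ => mul_le_mul_of_nonneg_left (h x) (prodWeight_nonneg hw x)

lemma expect_nonneg {w : β → ℝ} (hw : IsProbVec w) {F : (ι → β) → ℝ} (h : ∀ x, 0 ≤ F x) :
    0 ≤ expect w F :=
  Finset.sum_nonneg fun x _ => mul_nonneg (prodWeight_nonneg hw x) (h x)

lemma expect_add (w : β → ℝ) (F G : (ι → β) → ℝ) :
    expect w (fun x => F x + G x) = expect w F + expect w G := by
  simp [expect, mul_add, Finset.sum_add_distrib]

lemma expect_const_mul (w : β → ℝ) (c : ℝ) (F : (ι → β) → ℝ) :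
    expect w (fun x => c * F x) = c * expect w F := by
  simp only [expect, Finset.mul_sum]
  exact Finset.sum_congr rfl fun x _ => by ring

lemma expect_sum {κ : Type*} (w : β → ℝ) (s : Finset κ) (F : κ → (ι → β) → ℝ) :
    expect w (fun x => ∑ k ∈ s, F k x) = ∑ k ∈ s, expect w (F k) := by
  simp only [expect, Finset.mul_sum]
  exact Finset.sum_comm

lemma expect_prod_coord (w : β → ℝ) (f : ι → β → ℝ) :
    expect w (fun x => ∏ i, f i (x i)) = ∏ i, ∑ b, w b * f i b := by
  rw [Finset.prod_univ_sum, Fintype.piFinset_univ]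
  simp [expect, Finset.prod_mul_distrib]

lemma expect_const {w : β → ℝ} (hw : IsProbVec w) (c : ℝ) :
    expect w (fun _ : ι → β => c) = c := by
  have h := expect_prod_coord (ι := ι) w (fun _ _ => 1)
  simp only [Finset.prod_const_one, mul_one, hw.sum_eq_one] at h
  have h2 := expect_const_mul (ι := ι) w c (fun _ => 1)
  simpa [h] using h2

lemma expect_le_const {w : β → ℝ} (hw : IsProbVec w) {F : (ι → β) → ℝ} {c : ℝ}
    (h : ∀ x, F x ≤ c) : expect w F ≤ c :=
  (expect_mono hw h).trans_eq (expect_const hw c)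

lemma expect_coord {w : β → ℝ} (hw : IsProbVec w) (i : ι) (f : β → ℝ) :
    expect w (fun x => f (x i)) = ∑ b, w b * f b := by
  have h := expect_prod_coord (ι := ι) w (fun j => if j = i then f else fun _ => 1)
  rw [Finset.prod_eq_single i] at h
  · simp only [if_true] at h
    rw [← h]
    congr 1
    ext x
    rw [Finset.prod_eq_single i] <;> simp +contextual
  · intro j _ hj
    simp [hj, hw.sum_eq_one]
  · simp

lemma expect_comp_equiv {w : β → ℝ} (e : (ι → β) ≃ (ι → β))
    (he : ∀ x, ∏ i, w (e x i) = ∏ i, w (x i)) (F : (ι → β) → ℝ) :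
    expect w (fun x => F (e x)) = expect w F := by
  unfold expect
  rw [← Equiv.sum_comp e (fun x => (∏ i, w (x i)) * F x)]
  simp [he]

lemma expect_comm {ι' β' : Type*} [Fintype ι'] [DecidableEq ι'] [Fintype β']
    (w : β → ℝ) (w' : β' → ℝ) (F : (ι → β) → (ι' → β') → ℝ) :
    expect w (fun x => expect w' (fun y => F x y)) =
      expect w' (fun y => expect w (fun x => F x y)) := by
  simp only [expect, Finset.mul_sum]
  rw [Finset.sum_comm]
  exact Finset.sum_congr rfl fun y _ => Finset.sum_congr rfl fun x _ => by ring

open scoped Classical in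
/-- Resampling the coordinates in `S` does not change expectations. -/
lemma expect_resample {w : β → ℝ} (hw : IsProbVec w) (S : Set ι) (F : (ι → β) → ℝ) :
    expect w (fun x => expect w (fun y => F (S.piecewise y x))) = expect w F := by
  have h1 : expect w (fun x => expect w (fun y => F (S.piecewise y x))) =
      ∑ z : (ι → β) × (ι → β), (∏ i, w (z.1 i)) * (∏ i, w (z.2 i)) * F (S.piecewise z.2 z.1) := by
    simp only [expect, Finset.mul_sum, Fintype.sum_prod_type]
    exact Finset.sum_congr rfl fun y _ => Finset.sum_congr rfl fun x _ => by ring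
  -- Exchanging the `S`-parts of two independent samples is a weight-preserving involution.
  let e : (ι → β) × (ι → β) ≃ (ι → β) × (ι → β) :=
    Function.Involutive.toPerm (fun z => (S.piecewise z.2 z.1, S.piecewise z.1 z.2)) (by
      intro z
      ext i
      · by_cases hi : i ∈ S <;> simp [hi]
      · by_cases hi : i ∈ S <;> simp [hi])
  have h2 : ∑ z : (ι → β) × (ι → β),
      (∏ i, w (z.1 i)) * (∏ i, w (z.2 i)) * F (S.piecewise z.2 z.1) =
      ∑ z : (ι → β) × (ι → β), (∏ i, w (z.1 i)) * (∏ i, w (z.2 i)) * F z.1 := by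
    rw [← Equiv.sum_comp e (fun z => (∏ i, w (z.1 i)) * (∏ i, w (z.2 i)) * F z.1)]
    refine Finset.sum_congr rfl fun z _ => ?_
    have : (∏ i, w ((e z).1 i)) * (∏ i, w ((e z).2 i)) =
        (∏ i, w (z.1 i)) * (∏ i, w (z.2 i)) := by
      rw [← Finset.prod_mul_distrib, ← Finset.prod_mul_distrib]
      refine Finset.prod_congr rfl fun i _ => ?_
      change w (S.piecewise z.2 z.1 i) * w (S.piecewise z.1 z.2 i) = _
      by_cases hi : i ∈ S
      · simp [hi, mul_comm]
      · simp [hi]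
    rw [this]
    rfl
  rw [h1, h2, Fintype.sum_prod_type]
  have h3 := expect_const (ι := ι) hw 1
  simp only [expect, mul_one] at h3
  unfold expect
  refine Finset.sum_congr rfl fun x _ => ?_
  dsimp only
  rw [← Finset.sum_mul, ← Finset.mul_sum, h3, mul_one]

/-- `f` depends only on the coordinates in `S`. -/
def DependsOnlyOn {γ : Type*} (S : Set ι) (f : (ι → β) → γ) : Prop :=
  ∀ x y, (∀ i ∈ S, x i = y i) → f x = f y

omit [Fintype ι] [DecidableEq ι] [Fintype β] in
lemma DependsOnlyOn.mono {γ : Type*} {S T : Set ι} {f : (ι → β) → γ} (h : DependsOnlyOn S f)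
    (hST : S ⊆ T) : DependsOnlyOn T f := fun x y hxy => h x y fun i hi => hxy i (hST hi)

/-- If `g` uses its first argument only off `S` and its second only on `S`, the two arguments
may be decoupled. -/
lemma expect_decouple {w : β → ℝ} (hw : IsProbVec w) (S : Set ι) (g : (ι → β) → (ι → β) → ℝ)
    (h1 : ∀ y, DependsOnlyOn Sᶜ fun x => g x y) (h2 : ∀ x, DependsOnlyOn S (g x)) :
    expect w (fun x => g x x) = expect w (fun y => expect w (fun x => g x y)) := by
  classical
  rw [← expect_resample hw S, expect_comm]
  congr 1; ext y; congr 1; ext x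
  refine (h1 (S.piecewise y x) (S.piecewise y x) x fun i hi => by simp_all).trans ?_
  exact h2 x _ _ fun i hi => by simp [hi]

lemma expect_mul_indep {w : β → ℝ} (hw : IsProbVec w) (S : Set ι) {f g : (ι → β) → ℝ}
    (hf : DependsOnlyOn S f) (hg : DependsOnlyOn Sᶜ g) :
    expect w (fun x => f x * g x) = expect w f * expect w g := by
  rw [expect_decouple hw S (fun x y => f y * g x)
    (fun y a b hab => by simp only [hg a b hab]) (fun x a b hab => by simp only [hf a b hab])]
  simp only [expect_const_mul]
  simp only [mul_comm _ (expect w g), expect_const_mul]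

/-- Functions of pairwise disjoint sets of coordinates are independent. -/
lemma expect_prod_indep {κ : Type*} {w : β → ℝ} (hw : IsProbVec w) (J : Finset κ)
    (S : κ → Set ι) (f : κ → (ι → β) → ℝ) (hf : ∀ j ∈ J, DependsOnlyOn (S j) (f j))
    (hS : ∀ j ∈ J, ∀ k ∈ J, j ≠ k → Disjoint (S j) (S k)) :
    expect w (fun x => ∏ j ∈ J, f j x) = ∏ j ∈ J, expect w (f j) := by
  classical
  induction J using Finset.induction_on with
  | empty => simp [expect_const hw]
  | insert a J ha ih =>
    simp only [Finset.prod_insert ha]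
    rw [expect_mul_indep hw (S a) (hf a (by simp)), ih]
    · exact fun j hj => hf j (by simp [hj])
    · exact fun j hj k hk => hS j (by simp [hj]) k (by simp [hk])
    · intro x y hxy
      refine Finset.prod_congr rfl fun j hj => hf j (by simp [hj]) x y fun i hi => hxy i ?_
      intro hia
      have hja : a ≠ j := by rintro rfl; exact ha hj
      exact Set.disjoint_left.1 (hS a (by simp) j (by simp [hj]) hja) hia hi

end Expect

/-! ### Edge configurations with fairness flags -/

/-- The law of a single letter `(flag, bit)`: the bit is `1` with probability `p`, and, given that
the flag is raised, the bit is a fair coin. The flag is raised with probability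
`2 * min p (1 - p)`. -/
noncomputable def letterWeight (p : ℝ) : Bool × ZMod 2 → ℝ := fun b =>
  if b.1 then min p (1 - p) else (if b.2 = 1 then p else 1 - p) - min p (1 - p)

lemma zmod_two_cases (x : ZMod 2) : x = 0 ∨ x = 1 := by
  revert x; decide

lemma sum_letters (f : Bool × ZMod 2 → ℝ) :
    ∑ b, f b = f (true, 0) + f (true, 1) + (f (false, 0) + f (false, 1)) := by
  rw [Fintype.sum_prod_type, Fintype.sum_bool]
  simp [Fin.sum_univ_two, ZMod]
  rfl

lemma isProbVec_letterWeight {p : ℝ} : IsProbVec (letterWeight p) ↔ 0 ≤ p ∧ p ≤ 1 := by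
  constructor
  · intro h
    have h1 := h.nonneg (true, 0)
    simp only [letterWeight, if_true, le_min_iff] at h1
    constructor <;> linarith
  · rintro ⟨h0, h1⟩
    constructor
    · rintro ⟨f, b⟩
      rcases zmod_two_cases b with rfl | rfl <;> cases f <;> simp [letterWeight, h0, h1]
    · rw [sum_letters]
      simp [letterWeight]
      ring

lemma sum_letterWeight_bit (p : ℝ) (f : ZMod 2 → ℝ) :
    ∑ b, letterWeight p b * f b.2 = p * f 1 + (1 - p) * f 0 := by
  rw [sum_letters]
  simp [letterWeight]
  ring

lemma sum_letterWeight_flag (p : ℝ) (f : Bool → ℝ) :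
    ∑ b, letterWeight p b * f b.1 =
      2 * min p (1 - p) * f true + (1 - 2 * min p (1 - p)) * f false := by
  rw [sum_letters]
  simp [letterWeight]
  ring

/-- A configuration attaches a flag and a bit to each unordered pair of vertices; the bits of
the off-diagonal pairs are the edge indicators of a graph. -/
abbrev Config (V : Type*) := Sym2 V → Bool × ZMod 2

section Config

variable {V : Type*} [Fintype V] [DecidableEq V]

/-- The edge indicator of the pair `u, v`; it is `0` on the diagonal. -/
def bit (ω : Config V) (u v : V) : ZMod 2 := if u = v then 0 else (ω s(u, v)).2

/-- The graph of a configuration, whose edge indicators are `bit ω u v`. -/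
def toGraph (ω : Config V) : SimpleGraph V where
  Adj u v := bit ω u v = 1
  symm := ⟨fun u v h => by
    unfold bit at *
    rwa [Sym2.eq_swap, if_congr (eq_comm (a := v) (b := u)) rfl rfl]⟩
  loopless := ⟨fun u h => by simp [bit] at h⟩

omit [Fintype V] in
lemma bit_comm (ω : Config V) (u v : V) : bit ω u v = bit ω v u := by
  unfold bit
  rw [Sym2.eq_swap, if_congr (eq_comm (a := v) (b := u)) rfl rfl]

omit [Fintype V] in
@[simp] lemma bit_self (ω : Config V) (u : V) : bit ω u u = 0 := by simp [bit]

omit [Fintype V] in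
lemma bit_of_ne (ω : Config V) {u v : V} (h : u ≠ v) : bit ω u v = (ω s(u, v)).2 := by
  simp [bit, h]

/-- The number of neighbours of `v` in `S`, modulo `2`. -/
def degIn (a : V → V → ZMod 2) (S : Finset V) (v : V) : ZMod 2 := ∑ u ∈ S, a v u

/-- Add the bits `x` to those of `ω`, keeping the flags. -/
def flip (x : Sym2 V → ZMod 2) (ω : Config V) : Config V := fun e => ((ω e).1, (ω e).2 + x e)

/-- Given the flags, adding a vector supported on the fair pairs preserves the law. -/
lemma expect_flip (p : ℝ) (X : Config V → Sym2 V → ZMod 2)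
    (hX : ∀ ω ω', (∀ e, (ω e).1 = (ω' e).1) → X ω = X ω')
    (hfair : ∀ ω e, X ω e ≠ 0 → (ω e).1 = true) (F : Config V → ℝ) :
    expect (letterWeight p) (fun ω => F (flip (X ω) ω)) = expect (letterWeight p) F := by
  have hinv : Function.Involutive fun ω : Config V => flip (X ω) ω := by
    intro ω
    have h : X (flip (X ω) ω) = X ω := hX _ _ fun e => rfl
    ext e
    · rfl
    · change (ω e).2 + X ω e + X (flip (X ω) ω) e = (ω e).2
      rw [h, add_assoc, CharTwo.add_self_eq_zero, add_zero]
  refine expect_comp_equiv hinv.toPerm (fun ω => Finset.prod_congr rfl fun e _ => ?_) F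
  change letterWeight p ((ω e).1, (ω e).2 + X ω e) = letterWeight p (ω e)
  by_cases h : X ω e = 0
  · rw [h, add_zero]
  · simp [letterWeight, hfair ω e h]

end Config

/-! ### Elimination sequences -/

section Reach

variable {V : Type*} [DecidableEq V]

/-- `Reach P a S S'`: the vertex set `S` can be reduced to `S'` by repeatedly deleting a vertex
having an even number of neighbours in the current set; the deletion of `v` from `S` must moreover
be permitted by `P S v`. Here `a` is the adjacency matrix modulo `2`. -/
inductive Reach (P : Finset V → V → Prop) (a : V → V → ZMod 2) : Finset V → Finset V → Prop
  | refl (S : Finset V) : Reach P a S S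
  | step {S S' : Finset V} {v : V} (hv : v ∈ S) (hP : P S v) (h0 : degIn a S v = 0)
      (h : Reach P a (S.erase v) S') : Reach P a S S'

variable {P : Finset V → V → Prop} {a : V → V → ZMod 2} {S S' S'' : Finset V}

lemma Reach.trans (h : Reach P a S S') (h' : Reach P a S' S'') : Reach P a S S'' := by
  induction h with
  | refl => exact h'
  | step hv hP h0 _ ih => exact .step hv hP h0 (ih h')

lemma Reach.mono {Q : Finset V → V → Prop} (hPQ : ∀ S v, P S v → Q S v) (h : Reach P a S S') :
    Reach Q a S S' := by
  induction h with
  | refl => exact .refl _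
  | step hv hP h0 _ ih => exact .step hv (hPQ _ _ hP) h0 ih

/-- A list of vertices in which every entry with at least two successors has an even number of
neighbours among its successors. -/
def EvenList (a : V → V → ZMod 2) : List V → Prop
  | [] => True
  | v :: l => (2 ≤ l.length → degIn a l.toFinset v = 0) ∧ EvenList a l

lemma evenList_of_length_le_two : ∀ l : List V, l.length ≤ 2 → EvenList a l
  | [], _ => trivial
  | _ :: l, h => by
    simp only [List.length_cons] at h
    exact ⟨fun h' => by omega, evenList_of_length_le_two l (by omega)⟩

lemma degIn_erase_self (ha : ∀ v, a v v = 0) (S : Finset V) (v : V) :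
    degIn a (S.erase v) v = degIn a S v := by
  unfold degIn
  rw [Finset.sum_erase]
  exact ha v

lemma Reach.exists_evenList (ha : ∀ v, a v v = 0) (h : Reach P a S S') (hS' : S'.card ≤ 2) :
    ∃ l : List V, l.Nodup ∧ l.toFinset = S ∧ EvenList a l := by
  induction h with
  | refl S =>
    refine ⟨S.toList, S.nodup_toList, by simp, evenList_of_length_le_two _ ?_⟩
    simpa using hS'
  | @step S S' v hv hP h0 _ ih =>
    obtain ⟨l, hl, hlS, hle⟩ := ih hS'
    refine ⟨v :: l, ?_, ?_, ?_, hle⟩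
    · refine List.nodup_cons.2 ⟨fun hvl => ?_, hl⟩
      have := List.mem_toFinset.2 hvl
      rw [hlS] at this
      simp at this
    · rw [List.toFinset_cons, hlS, Finset.insert_erase hv]
    · intro _
      rw [hlS, degIn_erase_self ha, h0]

lemma EvenList.drop {l : List V} (h : EvenList a l) (i : ℕ) (hi : i + 2 < l.length) :
    degIn a (l.drop (i + 1)).toFinset (l[i]'(by omega)) = 0 := by
  induction l generalizing i with
  | nil => simp at hi
  | cons v l ih =>
    cases i with
    | zero => simpa using h.1 (by simp at hi; omega)
    | succ i => simpa using ih h.2 i (by simp at hi; omega)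

/-- The adjacency matrix modulo `2` of a graph, as a function of two vertices. -/
def IsAdjMatrix {V : Type*} (G : SimpleGraph V) (a : V → V → ZMod 2) : Prop :=
  ∀ u v, a u v = 1 ↔ G.Adj u v

omit [DecidableEq V] in
lemma IsAdjMatrix.self {G : SimpleGraph V} (h : IsAdjMatrix G a) (v : V) : a v v = 0 := by
  rcases zmod_two_cases (a v v) with h0 | h1
  · exact h0
  · exact absurd ((h v v).1 h1) (G.loopless.irrefl v)

omit [DecidableEq V] in
lemma IsAdjMatrix.degIn_eq {G : SimpleGraph V} (h : IsAdjMatrix G a) (S : Finset V) (v : V) :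
    degIn a S v = ((G.neighborSet v ∩ S).ncard : ZMod 2) := by
  classical
  have h1 : G.neighborSet v ∩ S = ((S.filter fun u => a v u = 1 : Finset V) : Set V) := by
    ext u
    simp [h v u, and_comm]
  rw [h1, Set.ncard_coe_finset, Finset.card_filter, degIn]
  push_cast
  refine Finset.sum_congr rfl fun u _ => ?_
  rcases zmod_two_cases (a v u) with h0 | h0 <;> simp [h0]

lemma evenDegenerate_of_reach [Fintype V] {G : SimpleGraph V} (h : IsAdjMatrix G a)
    (hr : Reach P a Finset.univ S') (hS' : S'.card ≤ 2) : EvenDegenerate G := by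
  obtain ⟨l, hl, hlu, hle⟩ := hr.exists_evenList h.self hS'
  have hmem : ∀ v, v ∈ l := fun v => by
    have : v ∈ l.toFinset := by rw [hlu]; exact Finset.mem_univ v
    simpa using this
  have hlen : l.length = Fintype.card V := by
    rw [← Finset.card_univ, ← hlu, List.toFinset_card_of_nodup hl]
  let e := hl.getEquivOfForallMemList l hmem
  refine ⟨(finCongr hlen.symm).trans e, fun i hi => ?_⟩
  have hd := hle.drop i (by omega)
  rw [h.degIn_eq, ZMod.natCast_eq_zero_iff_even] at hd
  convert hd using 3
  · rfl
  ext u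
  simp only [Set.mem_image, Set.mem_Ioi, Finset.mem_coe, List.mem_toFinset,
    List.mem_drop_iff_getElem]
  constructor
  · rintro ⟨j, hj, rfl⟩
    refine ⟨j - (i + 1), ?_, ?_⟩
    · have := j.2; have : i < j := hj; omega
    · change l[_] = l.get _
      rw [List.get_eq_getElem]
      congr 1
      have : (i : ℕ) < j := hj
      simp; omega
  · rintro ⟨j, hj, rfl⟩
    refine ⟨⟨i + 1 + j, by omega⟩, ?_, ?_⟩
    · change (i : ℕ) < i + 1 + j
      omega
    · change l.get _ = l[_]
      rw [List.get_eq_getElem]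
      congr 1

/-- An even-degenerate graph whose adjacency matrix is pulled back along `φ` yields an elimination
sequence inside the range of `φ`. -/
lemma EvenDegenerate.exists_reach {W : Type*} [Fintype W] [DecidableEq W] {G : SimpleGraph W}
    (hG : EvenDegenerate G) (φ : W ↪ V)
    (h : IsAdjMatrix G fun u v => a (φ u) (φ v)) :
    ∃ S', S'.card ≤ 2 ∧ Reach (fun _ _ => True) a (Finset.univ.map φ) S' := by
  unfold EvenDegenerate at hG
  obtain ⟨n, hn⟩ : ∃ n, n = Fintype.card W := ⟨_, rfl⟩
  rw [← hn] at hG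
  obtain ⟨v, hv⟩ := hG
  let T : ℕ → Finset W := fun i => (Finset.univ.filter fun j : Fin n => i ≤ j).map v.toEmbedding
  have hcard : ∀ i, i ≤ n → (T i).card = n - i := by
    intro i hi
    rw [Finset.card_map]
    have : (Finset.univ.filter fun j : Fin n => i ≤ j).map Fin.valEmbedding = Finset.Ico i n := by
      ext x
      simp only [Finset.mem_map, Finset.mem_filter, Finset.mem_univ, true_and,
        Fin.valEmbedding_apply, Finset.mem_Ico]
      exact ⟨by rintro ⟨j, hj, rfl⟩; exact ⟨hj, j.2⟩, fun hx => ⟨⟨x, hx.2⟩, hx.1, rfl⟩⟩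
    rw [← Finset.card_map Fin.valEmbedding, this, Nat.card_Ico]
  have hT0 : T 0 = Finset.univ := by
    ext x
    simp [T]
  have hstep : ∀ i, i ≤ n - 2 → Reach (fun _ _ => True) a (Finset.univ.map φ) ((T i).map φ) := by
    intro i
    induction i with
    | zero => intro _; rw [hT0]; exact .refl _
    | succ i ih =>
      intro hi
      refine (ih (by omega)).trans ?_
      have hin : i < n := by omega
      have hm : v ⟨i, hin⟩ ∈ T i := by simp [T]
      have hsucc : (T i).erase (v ⟨i, hin⟩) = T (i + 1) := by
        ext x
        simp only [T, Finset.mem_erase, Finset.mem_map, Finset.mem_filter, Finset.mem_univ,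
          true_and, Equiv.coe_toEmbedding]
        constructor
        · rintro ⟨hx, j, hj, rfl⟩
          refine ⟨j, ?_, rfl⟩
          have : j ≠ ⟨i, hin⟩ := fun h => hx (by rw [h])
          have : (j : ℕ) ≠ i := fun h => this (Fin.ext h)
          omega
        · rintro ⟨j, hj, rfl⟩
          refine ⟨fun hx => ?_, j, by omega, rfl⟩
          have := congrArg Fin.val (v.injective hx)
          simp at this
          omega
      refine .step (v := φ (v ⟨i, hin⟩)) (Finset.mem_map_of_mem _ hm) trivial ?_ ?_
      · have h1 := hv ⟨i, hin⟩ (by simp; omega)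
        rw [← ZMod.natCast_eq_zero_iff_even] at h1
        have h2 : degIn a ((T i).map φ) (φ (v ⟨i, hin⟩)) =
            degIn (fun u v => a (φ u) (φ v)) (T i) (v ⟨i, hin⟩) := by
          simp [degIn, Finset.sum_map]
        rw [h2, ← degIn_erase_self h.self, hsucc, h.degIn_eq]
        convert h1 using 4
        ext x
        simp only [T, Finset.coe_map, Set.mem_image, Finset.mem_coe, Finset.mem_filter,
          Finset.mem_univ, true_and, Equiv.coe_toEmbedding, Set.mem_Ioi]
        rfl
      · rw [← Finset.map_erase, hsucc]
        exact .refl _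
  refine ⟨(T (n - 2)).map φ, ?_, hstep _ le_rfl⟩
  rw [Finset.card_map, hcard _ (by omega)]
  omega

lemma isAdjMatrix_toGraph (ω : Config V) : IsAdjMatrix (toGraph ω) (bit ω) := fun _ _ => Iff.rfl

end Reach

/-! ### The elimination process with helpers -/

section Win

variable {V : Type*} [DecidableEq V]

/-- The part of the row of `t` that lies in the columns `U₀`. -/
def rowOn (a : V → V → ZMod 2) (U₀ : Finset V) (t : V) : V → ZMod 2 :=
  fun u => if u ∈ U₀ then a t u else 0

/-- `Win F par U₀ a U c T`: with helpers `U ⊆ U₀` whose current degree parities are `c`, all the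
targets in the list `T` can be deleted in their order, after which the helpers can be reduced to
a set satisfying `F`. A target of even degree is deleted at once; a target of odd degree is deleted
after an adjacent helper of even degree. The degree parity of the first target of a list is an
arbitrary function `par` of the list, of the helpers left and of the adjacency of this target
to `U₀`. -/
inductive Win (F : Finset V → Prop) (par : List V → Finset V → (V → ZMod 2) → ZMod 2)
    (U₀ : Finset V)
    (a : V → V → ZMod 2) : Finset V → (V → ZMod 2) → List V → Prop
  | done {U : Finset V} {c : V → ZMod 2} (h : F U) : Win F par U₀ a U c []
  | self {U : Finset V} {c : V → ZMod 2} {v : V} (hv : v ∈ U) (hc : c v = 0)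
      (h : Win F par U₀ a (U.erase v) (fun u => c u + a v u) []) : Win F par U₀ a U c []
  | even {U : Finset V} {c : V → ZMod 2} {t : V} {T : List V}
      (hp : par (t :: T) U (rowOn a U₀ t) = 0)
      (h : Win F par U₀ a U (fun u => c u + a t u) T) : Win F par U₀ a U c (t :: T)
  | odd {U : Finset V} {c : V → ZMod 2} {t : V} {T : List V} {v : V}
      (hp : par (t :: T) U (rowOn a U₀ t) ≠ 0) (hv : v ∈ U) (hc : c v = 0) (hav : a t v = 1)
      (h : Win F par U₀ a (U.erase v) (fun u => c u + a v u + a t u) T) :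
      Win F par U₀ a U c (t :: T)

variable {F : Finset V → Prop} {par : List V → Finset V → (V → ZMod 2) → ZMod 2} {U₀ : Finset V}
  {a a' : V → V → ZMod 2} {U : Finset V} {c c' : V → ZMod 2} {T : List V}

lemma Win.congr (h : Win F par U₀ a U c T) (hU : U ⊆ U₀)
    (hc : ∀ u ∈ U, c u = c' u) (haU : ∀ u ∈ U, ∀ v ∈ U, u ≠ v → a u v = a' u v)
    (haT : ∀ t ∈ T, ∀ u ∈ U₀, a t u = a' t u) : Win F par U₀ a' U c' T := by
  have hrow : ∀ t ∈ T, rowOn a U₀ t = rowOn a' U₀ t := fun t ht => by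
    ext u
    unfold rowOn
    split_ifs with hu
    · exact haT t ht u hu
    · rfl
  induction h generalizing c' with
  | done h => exact .done h
  | @self U c v hv hcv _ ih =>
    refine .self hv (by rw [← hc v hv, hcv]) (ih ((Finset.erase_subset _ _).trans hU) ?_ ?_ haT
      hrow)
    · intro u hu
      dsimp only
      rw [hc u (Finset.mem_of_mem_erase hu), haU v hv u (Finset.mem_of_mem_erase hu)
        (Finset.ne_of_mem_erase hu).symm]
    · exact fun u hu w hw => haU u (Finset.mem_of_mem_erase hu) w (Finset.mem_of_mem_erase hw)
  | @even U c t T hp _ ih =>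
    refine .even (by rwa [← hrow t (by simp)]) (ih hU ?_ haU (fun t' ht' => haT t' (by simp [ht']))
      (fun t' ht' => hrow t' (by simp [ht'])))
    intro u hu
    dsimp only
    rw [hc u hu, haT t (by simp) u (hU hu)]
  | @odd U c t T v hp hv hcv hav _ ih =>
    refine .odd (by rwa [← hrow t (by simp)]) hv (by rw [← hc v hv, hcv])
      (by rw [← haT t (by simp) v (hU hv), hav])
      (ih ((Finset.erase_subset _ _).trans hU) ?_ ?_ (fun t' ht' => haT t' (by simp [ht']))
      (fun t' ht' => hrow t' (by simp [ht'])))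
    · intro u hu
      have hu' := Finset.mem_of_mem_erase hu
      dsimp only
      rw [hc u hu', haT t (by simp) u (hU hu'), haU v hv u hu' (Finset.ne_of_mem_erase hu).symm]
    · exact fun u hu w hw => haU u (Finset.mem_of_mem_erase hu) w (Finset.mem_of_mem_erase hw)

lemma degIn_erase {S : Finset V} {v : V} (hv : v ∈ S) (u : V) :
    degIn a (S.erase v) u = degIn a S u + a u v := by
  unfold degIn
  rw [← Finset.sum_erase_add S _ hv, add_assoc, CharTwo.add_self_eq_zero, add_zero]

/-- A won process is realised by an elimination sequence, provided that the recorded parities are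
the true ones and that every deletion is permitted. -/
lemma Win.exists_reach {P : Finset V → V → Prop} {D : Finset V} (h : Win F par U₀ a U c T)
    (hsymm : ∀ u v, a u v = a v u)
    (hTn : T.Nodup) (hUT : ∀ t ∈ T, t ∉ U) (hUD : Disjoint U D) (hTD : ∀ t ∈ T, t ∉ D)
    (hc : ∀ u ∈ U, c u = degIn a (U ∪ T.toFinset ∪ D) u)
    (hpar : ∀ U' ⊆ U, ∀ t T', (t :: T') <:+ T →
      par (t :: T') U' (rowOn a U₀ t) = degIn a (U' ∪ (t :: T').toFinset ∪ D) t)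
    (hPU : ∀ U' ⊆ U, ∀ L, L <:+ T → ∀ v ∈ U', P (U' ∪ L.toFinset ∪ D) v)
    (hPT : ∀ U' ⊆ U, ∀ t T', (t :: T') <:+ T → P (U' ∪ (t :: T').toFinset ∪ D) t) :
    ∃ U' ⊆ U, F U' ∧ Reach P a (U ∪ T.toFinset ∪ D) (U' ∪ D) := by
  induction h with
  | @done U c h => exact ⟨U, subset_rfl, h, by simpa using .refl _⟩
  | @self U c v hv hcv _ ih =>
    have hvD : v ∉ D := Finset.disjoint_left.1 hUD hv
    have hset : (U.erase v ∪ ([] : List V).toFinset ∪ D) =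
        (U ∪ ([] : List V).toFinset ∪ D).erase v := by
      ext x; simp only [List.toFinset_nil, Finset.union_empty, Finset.mem_union, Finset.mem_erase]
      constructor
      · rintro (⟨h1, h2⟩ | h)
        · exact ⟨h1, Or.inl h2⟩
        · exact ⟨fun hx => hvD (hx ▸ h), Or.inr h⟩
      · rintro ⟨h1, h | h⟩
        · exact Or.inl ⟨h1, h⟩
        · exact Or.inr h
    have hsub := Finset.erase_subset v U
    obtain ⟨U', hU', hcard, hr⟩ := ih hTn (by simp) (hUD.mono_left hsub) (by simp) (by
      intro u hu
      rw [hset, degIn_erase (by simp [hv]), ← hc u (hsub hu), hsymm u v])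
      (fun U' hU' => hpar U' (hU'.trans hsub)) (fun U' hU' => hPU U' (hU'.trans hsub))
      (fun U' hU' => hPT U' (hU'.trans hsub))
    refine ⟨U', hU'.trans hsub, hcard, .step (v := v) (by simp [hv])
      (hPU U subset_rfl [] (List.nil_suffix) v hv) (by rw [← hc v hv, hcv]) ?_⟩
    rwa [← hset]
  | @even U c t T hp _ ih =>
    have htU := hUT t (by simp)
    have htD := hTD t (by simp)
    have htT : t ∉ T := (List.nodup_cons.1 hTn).1
    have hset : U ∪ T.toFinset ∪ D = (U ∪ (t :: T).toFinset ∪ D).erase t := by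
      ext x
      simp only [List.toFinset_cons, Finset.mem_union, Finset.mem_erase, Finset.mem_insert,
        List.mem_toFinset]
      constructor
      · intro h
        refine ⟨?_, by tauto⟩
        rintro rfl
        tauto
      · tauto
    have hts : t ∈ U ∪ (t :: T).toFinset ∪ D := by simp
    obtain ⟨U', hU', hcard, hr⟩ := ih (List.nodup_cons.1 hTn).2
      (fun t' ht' => hUT t' (by simp [ht'])) hUD (fun t' ht' => hTD t' (by simp [ht'])) (by
      intro u hu
      rw [hset, degIn_erase hts, ← hc u hu, hsymm u t])
      (fun U' hU' t' T' hs => hpar U' hU' t' T' (hs.trans (List.suffix_cons t T)))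
      (fun U' hU' L hs => hPU U' hU' L (hs.trans (List.suffix_cons t T)))
      (fun U' hU' t' T' hs => hPT U' hU' t' T' (hs.trans (List.suffix_cons t T)))
    refine ⟨U', hU', hcard, .step (v := t) hts (hPT U subset_rfl t T List.suffix_rfl)
      (by rw [← hpar U subset_rfl t T List.suffix_rfl, hp]) ?_⟩
    rwa [← hset]
  | @odd U c t T v hp hv hcv hav _ ih =>
    have htU := hUT t (by simp)
    have htD := hTD t (by simp)
    have htT : t ∉ T := (List.nodup_cons.1 hTn).1
    have hvD : v ∉ D := Finset.disjoint_left.1 hUD hv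
    have hvT : v ∉ t :: T := fun h => hUT v h hv
    have hsub := Finset.erase_subset v U
    have hset1 : U.erase v ∪ (t :: T).toFinset ∪ D = (U ∪ (t :: T).toFinset ∪ D).erase v := by
      ext x
      simp only [Finset.mem_union, Finset.mem_erase, List.mem_toFinset]
      constructor
      · rintro ((⟨h1, h2⟩ | h) | h)
        · tauto
        · exact ⟨fun hx => hvT (hx ▸ h), by tauto⟩
        · exact ⟨fun hx => hvD (hx ▸ h), by tauto⟩
      · tauto
    have hset : U.erase v ∪ T.toFinset ∪ D = (U.erase v ∪ (t :: T).toFinset ∪ D).erase t := by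
      ext x
      simp only [List.toFinset_cons, Finset.mem_union, Finset.mem_erase, Finset.mem_insert,
        List.mem_toFinset]
      constructor
      · intro h
        refine ⟨?_, by tauto⟩
        rintro rfl
        tauto
      · tauto
    have hts : t ∈ U.erase v ∪ (t :: T).toFinset ∪ D := by simp
    have hvs : v ∈ U ∪ (t :: T).toFinset ∪ D := by simp [hv]
    have hp1 : par (t :: T) U (rowOn a U₀ t) = 1 := (zmod_two_cases _).resolve_left hp
    obtain ⟨U', hU', hcard, hr⟩ := ih (List.nodup_cons.1 hTn).2
      (fun t' ht' h => hUT t' (by simp [ht']) (hsub h)) (hUD.mono_left hsub)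
      (fun t' ht' => hTD t' (by simp [ht'])) (by
      intro u hu
      rw [hset, degIn_erase hts, hset1, degIn_erase hvs, ← hc u (hsub hu), hsymm u t, hsymm u v])
      (fun U' hU' t' T' hs => hpar U' (hU'.trans hsub) t' T' (hs.trans (List.suffix_cons t T)))
      (fun U' hU' L hs => hPU U' (hU'.trans hsub) L (hs.trans (List.suffix_cons t T)))
      (fun U' hU' t' T' hs => hPT U' (hU'.trans hsub) t' T' (hs.trans (List.suffix_cons t T)))
    refine ⟨U', hU'.trans hsub, hcard, .step (v := v) hvs
      (hPU U subset_rfl _ List.suffix_rfl v hv) (by rw [← hc v hv, hcv]) ?_⟩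
    rw [← hset1]
    refine .step (v := t) hts (hPT _ hsub t T List.suffix_rfl) ?_ ?_
    · rw [hset1, degIn_erase hvs, ← hpar U subset_rfl t T List.suffix_rfl, hp1, hav]
      decide
    · rwa [← hset]

/-- A won process is won with a definite final set of helpers. -/
lemma Win.exists_eq (h : Win F par U₀ a U c T) :
    ∃ U' ⊆ U, F U' ∧ Win (· = U') par U₀ a U c T := by
  induction h with
  | @done U c h => exact ⟨U, subset_rfl, h, .done rfl⟩
  | self hv hc _ ih =>
    obtain ⟨U', hU', hF, hw⟩ := ih
    exact ⟨U', hU'.trans (Finset.erase_subset _ _), hF, .self hv hc hw⟩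
  | even hp _ ih =>
    obtain ⟨U', hU', hF, hw⟩ := ih
    exact ⟨U', hU', hF, .even hp hw⟩
  | odd hp hv hc hav _ ih =>
    obtain ⟨U', hU', hF, hw⟩ := ih
    exact ⟨U', hU'.trans (Finset.erase_subset _ _), hF, .odd hp hv hc hav hw⟩

end Win

/-! ### The failure probability of the process -/

section Elim

variable {V : Type*} [Fintype V] [DecidableEq V]

/-- The potential of a state: the product over the helpers of even degree of `1 - π`, an upper bound
for the probability that a fresh target is adjacent to none of them. -/
noncomputable def potential (π : ℝ) (U : Finset V) (c : V → ZMod 2) : ℝ :=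
  ∏ u ∈ U, if c u = 0 then 1 - π else 1

omit [Fintype V] in
lemma dependsOnlyOn_bit (u v : V) : DependsOnlyOn {s(u, v)} fun ω : Config V => bit ω u v := by
  intro x y h
  simp only [bit, h s(u, v) rfl]

lemma expect_bit {p : ℝ} (h0 : 0 ≤ p) (h1 : p ≤ 1) {u v : V} (huv : u ≠ v) (f : ZMod 2 → ℝ) :
    expect (letterWeight p) (fun ω : Config V => f (bit ω u v)) = p * f 1 + (1 - p) * f 0 := by
  simp only [bit_of_ne _ huv]
  rw [expect_coord (isProbVec_letterWeight.2 ⟨h0, h1⟩) s(u, v) (fun b => f b.2),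
    sum_letterWeight_bit]

/-- Expectations of products over the entries of one row factorise. -/
lemma expect_row_prod {p : ℝ} (h0 : 0 ≤ p) (h1 : p ≤ 1) {U : Finset V} {v : V} (hv : v ∉ U)
    (f : V → ZMod 2 → ℝ) :
    expect (letterWeight p) (fun ω : Config V => ∏ u ∈ U, f u (bit ω v u)) =
      ∏ u ∈ U, (p * f u 1 + (1 - p) * f u 0) := by
  rw [expect_prod_indep (isProbVec_letterWeight.2 ⟨h0, h1⟩) U (fun u => {s(v, u)})]
  · refine Finset.prod_congr rfl fun u hu => expect_bit h0 h1 ?_ _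
    rintro rfl
    exact hv hu
  · intro u _ x y h
    simp only [dependsOnlyOn_bit v u x y h]
  · intro u _ w _ huw
    simp [huw]
    rintro rfl rfl
    exact huw rfl

lemma expect_potential_le {p : ℝ} (h0 : 0 ≤ p) (h1 : p ≤ 1) {U : Finset V} {v : V} (hv : v ∉ U)
    (c : V → ZMod 2) :
    expect (letterWeight p) (fun ω : Config V =>
      potential (min p (1 - p)) U fun u => c u + bit ω v u) ≤
      (1 - min p (1 - p) ^ 2) ^ U.card := by
  unfold potential
  rw [expect_row_prod h0 h1 hv fun u b => if c u + b = 0 then 1 - min p (1 - p) else 1,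
    ← Finset.prod_const]
  have hm0 : 0 ≤ min p (1 - p) := le_min h0 (by linarith)
  have hmp : min p (1 - p) ≤ p := min_le_left _ _
  have hmq : min p (1 - p) ≤ 1 - p := min_le_right _ _
  generalize min p (1 - p) = q at *
  refine Finset.prod_le_prod (fun u _ => ?_) fun u _ => ?_
  · have : 0 ≤ 1 - q := by linarith
    refine add_nonneg (mul_nonneg h0 ?_) (mul_nonneg (by linarith) ?_) <;> split_ifs <;> linarith
  · rcases zmod_two_cases (c u) with h | h
    · have e1 : (0 : ZMod 2) + 1 ≠ 0 := by decide
      simp only [h, e1, if_false, add_zero, if_true]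
      nlinarith
    · have e1 : (1 : ZMod 2) + 1 = 0 := by decide
      have e2 : (1 : ZMod 2) ≠ 0 := by decide
      simp only [h, e1, add_zero, if_true, e2, if_false]
      nlinarith

lemma expect_no_helper_le {p : ℝ} (h0 : 0 ≤ p) (h1 : p ≤ 1) {U : Finset V} {v : V} (hv : v ∉ U)
    (c : V → ZMod 2) :
    expect (letterWeight p) (fun ω : Config V =>
      ind (¬∃ u ∈ U, c u = 0 ∧ bit ω v u = 1)) ≤ potential (min p (1 - p)) U c := by
  have hprod : ∀ ω : Config V, ind (¬∃ u ∈ U, c u = 0 ∧ bit ω v u = 1) ≤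
      ∏ u ∈ U, if c u = 0 ∧ bit ω v u = 1 then (0 : ℝ) else 1 := by
    intro ω
    by_cases h : ∃ u ∈ U, c u = 0 ∧ bit ω v u = 1
    · rw [ind_of_false (by simpa using h)]
      exact Finset.prod_nonneg fun u _ => by split_ifs <;> norm_num
    · rw [Finset.prod_eq_one]
      · exact ind_le_one _
      · intro u hu
        rw [if_neg fun h' => h ⟨u, hu, h'⟩]
  refine (expect_mono (isProbVec_letterWeight.2 ⟨h0, h1⟩) hprod).trans ?_
  rw [expect_row_prod h0 h1 hv fun u b => if c u = 0 ∧ b = 1 then (0 : ℝ) else 1]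
  refine Finset.prod_le_prod (fun u _ => ?_) fun u _ => ?_
  · refine add_nonneg (mul_nonneg h0 ?_) (mul_nonneg (by linarith) ?_) <;> split_ifs <;> norm_num
  · have hmp : min p (1 - p) ≤ p := min_le_left _ _
    by_cases h : c u = 0
    · simp only [h, true_and, if_true, zero_ne_one, if_false]
      linarith
    · simp [h]

/-- The elimination process fails with small probability: as long as the number of targets and the
final number `K` of helpers do not exceed the number of helpers, every round costs at most
two terms `(1 - π ^ 2) ^ K`. -/
theorem expect_not_win_le {p : ℝ} (h0 : 0 ≤ p) (h1 : p ≤ 1) (K : ℕ)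
    (par : List V → Finset V → (V → ZMod 2) → ZMod 2) (U₀ : Finset V) (T : List V)
    (U : Finset V) (c : V → ZMod 2) (hT : T.Nodup) (hTU : ∀ t ∈ T, t ∉ U₀) (hU : U ⊆ U₀)
    (hcard : K + T.length ≤ U.card) :
    expect (letterWeight p) (fun ω : Config V => ind (¬Win (·.card = K) par U₀ (bit ω) U c T)) ≤
      potential (min p (1 - p)) U c +
        (2 * T.length + U.card) * (1 - min p (1 - p) ^ 2) ^ K := by
  have hw := isProbVec_letterWeight.2 ⟨h0, h1⟩
  have hm0 : 0 ≤ min p (1 - p) := le_min h0 (by linarith)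
  have hm1 : min p (1 - p) ≤ 1 := (min_le_left _ _).trans h1
  set r := 1 - min p (1 - p) ^ 2 with hr
  have hr0 : 0 ≤ r := by rw [hr]; nlinarith
  have hr1 : r ≤ 1 := by rw [hr]; nlinarith
  have hrK : ∀ k, K ≤ k → r ^ k ≤ r ^ K := fun k hk => pow_le_pow_of_le_one hr0 hr1 hk
  have hpot : ∀ (U : Finset V) c, 0 ≤ potential (min p (1 - p)) U c := fun U c =>
    Finset.prod_nonneg fun u _ => by split_ifs <;> linarith
  -- The row of a deleted helper `v` is fresh, whatever is added to the parities.
  have hself : ∀ (U : Finset V) (c : V → ZMod 2) (T : List V) (v : V), v ∈ U → U ⊆ U₀ →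
      (∀ t ∈ T, t ∉ U₀) → K + 1 ≤ U.card → (∀ c' : V → ZMod 2,
      expect (letterWeight p) (fun ω : Config V =>
        ind (¬Win (·.card = K) par U₀ (bit ω) (U.erase v) c' T)) ≤
      potential (min p (1 - p)) (U.erase v) c' +
        (2 * T.length + (U.erase v).card) * r ^ K) →
      expect (letterWeight p) (fun ω : Config V =>
        ind (¬Win (·.card = K) par U₀ (bit ω) (U.erase v) (fun u => c u + bit ω v u) T)) ≤
        (2 * T.length + U.card) * r ^ K := by
    intro U c T v hv hU hTU hcard ih
    let S : Set (Sym2 V) := {e | ∃ u ∈ U.erase v, e = s(v, u)}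
    rw [expect_decouple hw S (fun x y =>
      ind (¬Win (·.card = K) par U₀ (bit x) (U.erase v) (fun u => c u + bit y v u) T))]
    · have hstep : ∀ y : Config V, expect (letterWeight p) (fun x : Config V =>
          ind (¬Win (·.card = K) par U₀ (bit x) (U.erase v) (fun u => c u + bit y v u) T)) ≤
          potential (min p (1 - p)) (U.erase v) (fun u => c u + bit y v u) +
          (2 * T.length + (U.erase v).card) * r ^ K := fun y => ih _
      refine (expect_mono hw hstep).trans ?_
      rw [expect_add, expect_const hw]
      have h2 := expect_potential_le h0 h1 (Finset.notMem_erase v U) c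
      have h3 := hrK (U.erase v).card (by rw [Finset.card_erase_of_mem hv]; omega)
      have h4 : (((U.erase v).card : ℕ) : ℝ) + 1 = U.card := by
        rw [← Finset.card_erase_add_one hv]; push_cast; rfl
      rw [← h4]
      linarith
    · intro y x x' hx
      have key : ∀ x x' : Config V, (∀ i ∈ Sᶜ, x i = x' i) →
          Win (·.card = K) par U₀ (bit x) (U.erase v) (fun u => c u + bit y v u) T →
          Win (·.card = K) par U₀ (bit x') (U.erase v) (fun u => c u + bit y v u) T := by
        intro x x' hx h
        refine h.congr ((Finset.erase_subset _ _).trans hU) (fun _ _ => rfl) ?_ ?_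
        · intro u hu w hw' huw
          rw [bit_of_ne _ huw, bit_of_ne _ huw, hx]
          rintro ⟨z, hz, he⟩
          rcases Sym2.eq_iff.1 he with ⟨rfl, rfl⟩ | ⟨rfl, rfl⟩
          · simp at hu
          · simp at hw'
        · intro t ht u hu
          have htu : t ≠ u := fun h => hTU t ht (h ▸ hu)
          rw [bit_of_ne _ htu, bit_of_ne _ htu, hx]
          rintro ⟨z, hz, he⟩
          rcases Sym2.eq_iff.1 he with ⟨rfl, rfl⟩ | ⟨rfl, rfl⟩
          · exact hTU t ht (hU hv)
          · exact hTU t ht (hU (Finset.mem_of_mem_erase hz))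
      simp only
      congr 2
      exact propext ⟨key x x' hx, key x' x fun i hi => (hx i hi).symm⟩
    · intro x y y' hy
      have key : ∀ y y' : Config V, (∀ i ∈ S, y i = y' i) →
          Win (·.card = K) par U₀ (bit x) (U.erase v) (fun u => c u + bit y v u) T →
          Win (·.card = K) par U₀ (bit x) (U.erase v) (fun u => c u + bit y' v u) T := by
        intro y y' hy h
        refine h.congr ((Finset.erase_subset _ _).trans hU) ?_ (fun _ _ _ _ _ => rfl)
          (fun _ _ _ _ => rfl)
        intro u hu
        simp only [bit, hy s(v, u) ⟨u, hu, rfl⟩]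
      exact congrArg (fun Q => ind (¬Q))
        (propext ⟨key y y' hy, key y' y fun i hi => (hy i hi).symm⟩)
  induction T generalizing U c with
  | nil =>
    induction hn : U.card using Nat.strong_induction_on generalizing U c with
    | _ n ih =>
    subst hn
    simp only [List.length_nil, add_zero] at hcard
    rcases hcard.eq_or_lt with hK | hK
    · have : ∀ ω : Config V, ind (¬Win (·.card = K) par U₀ (bit ω) U c []) = 0 := fun ω =>
        ind_of_false (not_not.2 (.done hK.symm))
      simp only [this, expect_const hw]
      have := hpot U c
      positivity
    · by_cases hev : ∃ v ∈ U, c v = 0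
      · obtain ⟨v, hv, hcv⟩ := hev
        have hlt : (U.erase v).card < U.card := Finset.card_erase_lt_of_mem hv
        have hcd := Finset.card_erase_add_one hv
        have h2 := hself U c [] v hv hU (by simp) hK fun c' =>
          ih _ hlt (U.erase v) c' ((Finset.erase_subset _ _).trans hU) (by simp; omega) rfl
        refine le_trans (expect_mono hw fun ω => ind_mono ?_) (h2.trans ?_)
        · exact fun hn hwin => hn (.self hv hcv hwin)
        · have := hpot U c
          linarith
      · have : potential (min p (1 - p)) U c = 1 := by
          refine Finset.prod_eq_one fun u hu => if_neg fun hu0 => hev ⟨u, hu, hu0⟩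
        rw [this]
        refine (expect_le_const hw fun ω => ind_le_one _).trans ?_
        have : 0 ≤ (2 * (([] : List V).length : ℝ) + U.card) * r ^ K := by positivity
        linarith
  | cons t T ih =>
    have htT := (List.nodup_cons.1 hT).1
    have hTn := (List.nodup_cons.1 hT).2
    have htU₀ := hTU t (by simp)
    have htU : t ∉ U := fun h => htU₀ (hU h)
    have hTU' : ∀ t' ∈ T, t' ∉ U₀ := fun t' ht' => hTU t' (by simp [ht'])
    simp only [List.length_cons] at hcard
    classical
    -- Failure after the row `k` of the first target has been revealed.
    let fail : Config V → (V → ZMod 2) → ℝ := fun x k =>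
      if par (t :: T) U k = 0 then ind (¬Win (·.card = K) par U₀ (bit x) U (fun u => c u + k u) T)
      else if h : ∃ v ∈ U, c v = 0 ∧ k v = 1 then
        ind (¬Win (·.card = K) par U₀ (bit x) (U.erase h.choose)
          (fun u => (c u + k u) + bit x h.choose u) T)
      else 1
    let S : Set (Sym2 V) := {e | ∃ u ∈ U₀, e = s(t, u)}
    have hfail : ∀ ω : Config V, ind (¬Win (·.card = K) par U₀ (bit ω) U c (t :: T)) ≤
        fail ω (rowOn (bit ω) U₀ t) := by
      intro ω
      have hrow : ∀ u ∈ U, rowOn (bit ω) U₀ t u = bit ω t u := fun u hu => if_pos (hU hu)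
      simp only [fail]
      split_ifs with hp h
      · refine ind_mono fun hn hwin => hn (.even hp (hwin.congr hU ?_ (fun _ _ _ _ _ => rfl)
          (fun _ _ _ _ => rfl)))
        intro u hu
        rw [hrow u hu]
      · refine ind_mono fun hn hwin => ?_
        obtain ⟨hvU, hcv, hkv⟩ := h.choose_spec
        rw [hrow _ hvU] at hkv
        refine hn (.odd hp hvU hcv hkv (hwin.congr ((Finset.erase_subset _ _).trans hU) ?_
          (fun _ _ _ _ _ => rfl) (fun _ _ _ _ => rfl)))
        intro u hu
        rw [hrow u (Finset.mem_of_mem_erase hu)]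
        ring
      · exact ind_le_one _
    refine (expect_mono hw hfail).trans ?_
    rw [expect_decouple hw S (fun x y => fail x (rowOn (bit y) U₀ t))]
    · have hbound : ∀ y : Config V, expect (letterWeight p)
          (fun x : Config V => fail x (rowOn (bit y) U₀ t)) ≤
          potential (min p (1 - p)) U (fun u => c u + bit y t u) +
          (ind (¬∃ u ∈ U, c u = 0 ∧ bit y t u = 1) +
            (r ^ K + (2 * T.length + U.card) * r ^ K)) := by
        intro y
        have hrow : ∀ u ∈ U, rowOn (bit y) U₀ t u = bit y t u := fun u hu => if_pos (hU hu)
        have hB : 0 ≤ (2 * (T.length : ℝ) + U.card) * r ^ K := by positivity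
        have hi := ind_nonneg (¬∃ u ∈ U, c u = 0 ∧ bit y t u = 1)
        have hp0 := hpot U (fun u => c u + bit y t u)
        have hrK0 : 0 ≤ r ^ K := by positivity
        by_cases hp : par (t :: T) U (rowOn (bit y) U₀ t) = 0
        · simp only [fail, hp, if_true]
          have h2 := ih U (fun u => c u + rowOn (bit y) U₀ t u) hTn hTU' hU (by omega)
          have h3 : potential (min p (1 - p)) U (fun u => c u + rowOn (bit y) U₀ t u) =
              potential (min p (1 - p)) U (fun u => c u + bit y t u) :=
            Finset.prod_congr rfl fun u hu => by simp only [hrow u hu]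
          rw [h3] at h2
          linarith
        · by_cases h : ∃ v ∈ U, c v = 0 ∧ rowOn (bit y) U₀ t v = 1
          · simp only [fail, hp, if_false, dif_pos h]
            obtain ⟨hvU, -, -⟩ := h.choose_spec
            have hcd := Finset.card_erase_add_one hvU
            have h2 := hself U (fun u => c u + rowOn (bit y) U₀ t u) T h.choose hvU hU hTU'
              (by omega) fun c' => ih _ c' hTn hTU' ((Finset.erase_subset _ _).trans hU) (by omega)
            linarith
          · simp only [fail, hp, if_false, dif_neg h, expect_const hw]
            have h2 : ¬∃ u ∈ U, c u = 0 ∧ bit y t u = 1 := by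
              rintro ⟨u, hu, hcu, hb⟩
              exact h ⟨u, hu, hcu, by rw [hrow u hu, hb]⟩
            rw [ind_of_true h2]
            linarith
      refine (expect_mono hw hbound).trans ?_
      rw [expect_add, expect_add, expect_const hw]
      have h2 := expect_potential_le h0 h1 htU c
      have h3 := hrK U.card (by omega)
      have h4 := expect_no_helper_le h0 h1 htU c
      rw [List.length_cons]
      push_cast
      linarith
    · intro y x x' hx
      have key : ∀ (U' : Finset V) (c₁ c₂ : V → ZMod 2) (x x' : Config V), U' ⊆ U →
          (∀ i ∈ Sᶜ, x i = x' i) → (∀ u ∈ U', c₁ u = c₂ u) →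
          Win (·.card = K) par U₀ (bit x) U' c₁ T → Win (·.card = K) par U₀ (bit x') U' c₂ T := by
        intro U' c₁ c₂ x x' hU' hx hc h
        refine h.congr (hU'.trans hU) hc ?_ ?_
        · intro u hu w hw' huw
          rw [bit_of_ne _ huw, bit_of_ne _ huw, hx]
          rintro ⟨z, hz, he⟩
          rcases Sym2.eq_iff.1 he with ⟨rfl, rfl⟩ | ⟨rfl, rfl⟩
          · exact htU (hU' hu)
          · exact htU (hU' hw')
        · intro t' ht' u hu
          have htu : t' ≠ u := fun h => hTU' t' ht' (h ▸ hu)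
          rw [bit_of_ne _ htu, bit_of_ne _ htu, hx]
          rintro ⟨z, hz, he⟩
          rcases Sym2.eq_iff.1 he with ⟨rfl, rfl⟩ | ⟨rfl, rfl⟩
          · exact htT ht'
          · exact hTU' t' ht' hz
      have hxs : ∀ i ∈ Sᶜ, x' i = x i := fun i hi => (hx i hi).symm
      simp only [fail]
      split_ifs with hp h
      · congr 2
        exact propext ⟨key U _ _ x x' subset_rfl hx fun _ _ => rfl,
          key U _ _ x' x subset_rfl hxs fun _ _ => rfl⟩
      · have hb : ∀ u ∈ U.erase h.choose, bit x h.choose u = bit x' h.choose u := by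
          intro u hu
          have hne : h.choose ≠ u := (Finset.ne_of_mem_erase hu).symm
          rw [bit_of_ne _ hne, bit_of_ne _ hne, hx]
          rintro ⟨z, hz, he⟩
          rcases Sym2.eq_iff.1 he with ⟨h1, -⟩ | ⟨-, h1⟩
          · exact htU (h1 ▸ h.choose_spec.1)
          · exact htU (h1 ▸ Finset.mem_of_mem_erase hu)
        congr 2
        exact propext ⟨key _ _ _ x x' (Finset.erase_subset _ _) hx fun u hu => by rw [hb u hu],
          key _ _ _ x' x (Finset.erase_subset _ _) hxs fun u hu => by rw [hb u hu]⟩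
      · rfl
    · intro x y y' hy
      have : rowOn (bit y) U₀ t = rowOn (bit y') U₀ t := by
        ext u
        unfold rowOn
        split_ifs with hu
        · simp only [bit, hy s(t, u) ⟨u, hu, rfl⟩]
        · rfl
      simp only [this]

end Elim

/-! ### Parities of edge counts -/

section EdgesIn

variable {V : Type*} [DecidableEq V]

/-- The bit of an unordered pair, replaced by `0` on the diagonal. -/
def edgeBit (ω : Config V) (e : Sym2 V) : ZMod 2 := if e.IsDiag then 0 else (ω e).2

lemma edgeBit_mk (ω : Config V) (u v : V) : edgeBit ω s(u, v) = bit ω u v := by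
  simp [edgeBit, bit]

/-- The number of edges inside `S`, modulo `2`. -/
def edgesIn (ω : Config V) (S : Finset V) : ZMod 2 := ∑ e ∈ S.sym2, edgeBit ω e

lemma edgesIn_insert (ω : Config V) {S : Finset V} {v : V} (hv : v ∉ S) :
    edgesIn ω (insert v S) = edgesIn ω S + degIn (bit ω) S v := by
  rw [← Finset.cons_eq_insert v S hv]
  unfold edgesIn degIn
  rw [Finset.sym2_cons, Finset.sum_disjUnion, add_comm, Finset.sum_map, Finset.sum_cons]
  change ∑ e ∈ S.sym2, edgeBit ω e + (edgeBit ω s(v, v) + ∑ x ∈ S, edgeBit ω s(v, x)) = _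
  simp [edgeBit_mk]

lemma edgesIn_erase (ω : Config V) {S : Finset V} {v : V} (hv : v ∈ S) :
    edgesIn ω S = edgesIn ω (S.erase v) + degIn (bit ω) S v := by
  conv_lhs => rw [← Finset.insert_erase hv]
  rw [edgesIn_insert ω (Finset.notMem_erase v S), degIn_erase_self (bit_self ω)]

/-- Deleting vertices of even degree preserves the parity of the number of edges. -/
lemma Reach.edgesIn_eq {P : Finset V → V → Prop} {ω : Config V} {S S' : Finset V}
    (h : Reach P (bit ω) S S') : edgesIn ω S = edgesIn ω S' := by
  induction h with
  | refl => rfl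
  | step hv hP h0 _ ih => rw [edgesIn_erase ω hv, h0, add_zero, ih]

lemma degIn_union (a : V → V → ZMod 2) {S T : Finset V} (h : Disjoint S T) (v : V) :
    degIn a (S ∪ T) v = degIn a S v + degIn a T v := Finset.sum_union h

lemma edgesIn_union (ω : Config V) {S T : Finset V} (h : Disjoint S T) :
    edgesIn ω (S ∪ T) = edgesIn ω S + edgesIn ω T + ∑ v ∈ T, degIn (bit ω) S v := by
  induction T using Finset.induction_on with
  | empty => simp [edgesIn]
  | insert v T hv ih =>
    rw [Finset.disjoint_insert_right] at h
    rw [Finset.union_insert, edgesIn_insert ω (by simp [hv, h.1]), ih h.2, edgesIn_insert ω hv,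
      degIn_union _ h.2, Finset.sum_insert hv]
    ring

lemma sum_forward_eq {V : Type*} [LinearOrder V] (ω : Config V) (S : Finset V) :
    ∑ v ∈ S, degIn (bit ω) (S.filter (v < ·)) v = edgesIn ω S := by
  induction S using Finset.induction_on_max with
  | empty => simp [edgesIn]
  | insert a S ha ih =>
    have haS : a ∉ S := fun h => lt_irrefl _ (ha a h)
    rw [edgesIn_insert ω haS, Finset.sum_insert haS, ← ih]
    have h1 : (insert a S).filter (a < ·) = ∅ := by
      ext x
      simp only [Finset.mem_filter, Finset.mem_insert, Finset.notMem_empty, iff_false, not_and,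
        not_lt]
      rintro (rfl | hx)
      · exact le_rfl
      · exact (ha x hx).le
    have h2 : ∀ v ∈ S, degIn (bit ω) ((insert a S).filter (v < ·)) v =
        degIn (bit ω) (S.filter (v < ·)) v + bit ω a v := by
      intro v hv
      rw [Finset.filter_insert, if_pos (ha v hv)]
      unfold degIn
      rw [Finset.sum_insert (by simp [haS]), add_comm, bit_comm]
    rw [h1, Finset.sum_congr rfl h2, Finset.sum_add_distrib]
    simp [degIn]

lemma ncard_edgeSet_toGraph [Fintype V] (ω : Config V) :
    ((toGraph ω).edgeSet.ncard : ZMod 2) = edgesIn ω Finset.univ := by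
  classical
  have h1 : (toGraph ω).edgeSet =
      ((Finset.univ.filter fun e => edgeBit ω e = 1 : Finset (Sym2 V)) : Set (Sym2 V)) := by
    ext e
    induction e with
    | _ u v => simp [edgeBit_mk, toGraph]
  rw [h1, Set.ncard_coe_finset, Finset.card_filter, edgesIn, Finset.sym2_univ]
  push_cast
  refine Finset.sum_congr rfl fun e _ => ?_
  rcases zmod_two_cases (edgeBit ω e) with h0 | h0 <;> simp [h0]

end EdgesIn

/-! ### Blocks of vertices and the revealed information -/

/-- The labels of the parts of the vertex set: the revealed part `a`, two helper parts `h i`, and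
two parts `q i`, of which one is kept and the other eliminated. -/
inductive Block
  | a
  | h (i : Bool)
  | q (i : Bool)
  deriving DecidableEq

/-- Whether the edges between two blocks are revealed. -/
def known : Block → Block → Bool
  | .a, _ => true
  | .h _, .a => true
  | .h _, .h _ => true
  | .h i, .q j => i != j
  | .q _, .a => true
  | .q i, .h j => i != j
  | .q _, .q _ => false

section Blocks

variable {V : Type*} [Fintype V] [LinearOrder V] (k : V → Block)

/-- The set of vertices with label `b`. -/
def block (b : Block) : Finset V := Finset.univ.filter (k · = b)

omit [LinearOrder V] in
variable {k} in
@[simp] lemma mem_block {b : Block} {v : V} : v ∈ block k b ↔ k v = b := by simp [block]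

omit [LinearOrder V] in
lemma disjoint_block {b b' : Block} (h : b ≠ b') : Disjoint (block k b) (block k b') := by
  rw [Finset.disjoint_left]
  intro v hv hv'
  rw [mem_block] at hv hv'
  exact h (hv.symm.trans hv')

/-- The number of later neighbours of `v` in its block `q i`, modulo `2`. -/
def forward (ω : Config V) (i : Bool) (v : V) : ZMod 2 :=
  degIn (bit ω) ((block k (.q i)).filter (v < ·)) v

/-- The information revealed about a configuration: the edges between known pairs of blocks; the
parity of the degree of each `v ∈ h i` into `q i`; for each `v ∈ q i`, the parity of the number of
neighbours that lie in the other `q`-block or come later in `q i`; the parities of the numbers of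
edges inside `q i`; and the flags of the pairs between the two `q`-blocks. -/
def info (ω : Config V) : (V → V → ZMod 2) × (Bool → V → ZMod 2) × (Bool → V → ZMod 2) ×
    (Bool → ZMod 2) × (V → V → Bool) :=
  (fun u v => if known (k u) (k v) then bit ω u v else 0,
   fun i v => if k v = .h i then degIn (bit ω) (block k (.q i)) v else 0,
   fun i v => if k v = .q i then degIn (bit ω) (block k (.q !i)) v + forward k ω i v else 0,
   fun i => edgesIn ω (block k (.q i)),
   fun u v => if k u = .q true ∧ k v = .q false then (ω s(u, v)).1 else false)

variable {k}

lemma info_eq_iff {ω ω' : Config V} : info k ω = info k ω' ↔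
    (∀ u v, known (k u) (k v) → bit ω u v = bit ω' u v) ∧
    (∀ i v, k v = .h i →
      degIn (bit ω) (block k (.q i)) v = degIn (bit ω') (block k (.q i)) v) ∧
    (∀ i v, k v = .q i → degIn (bit ω) (block k (.q !i)) v + forward k ω i v =
      degIn (bit ω') (block k (.q !i)) v + forward k ω' i v) ∧
    (∀ i, edgesIn ω (block k (.q i)) = edgesIn ω' (block k (.q i))) ∧
    ∀ u v, k u = .q true → k v = .q false → (ω s(u, v)).1 = (ω' s(u, v)).1 := by
  simp only [info, Prod.mk.injEq, funext_iff]
  refine and_congr ?_ (and_congr ?_ (and_congr ?_ (and_congr Iff.rfl ?_)))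
  · refine forall_congr' fun u => forall_congr' fun v => ?_
    by_cases h : known (k u) (k v) <;> simp [h]
  · refine forall_congr' fun i => forall_congr' fun v => ?_
    by_cases h : k v = .h i <;> simp [h]
  · refine forall_congr' fun i => forall_congr' fun v => ?_
    by_cases h : k v = .q i <;> simp [h]
  · refine forall_congr' fun u => forall_congr' fun v => ?_
    by_cases h : k u = .q true <;> by_cases h' : k v = .q false <;> simp [h, h']

variable (k)

/-- The deletions permitted when `q i` is to be kept. The degrees involved are functions of the
revealed information: all of `q i` is still present; the other helper block goes before the first
vertex of the other `q`-block; and the latter is deleted in increasing order. -/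
def Allowed (i : Bool) (S : Finset V) (v : V) : Prop :=
  block k (.q i) ⊆ S ∧ k v ≠ .q i ∧ (k v = .h !i → block k (.q !i) ⊆ S) ∧
    (k v = .q !i → (∀ u ∈ S, k u ≠ .h !i) ∧ ∀ u, k u = .q !i → (u ∈ S ↔ v ≤ u))

variable {k}

omit [Fintype V] in
lemma degIn_congr_of_known {ω ω' : Config V}
    (h : ∀ u v, known (k u) (k v) → bit ω u v = bit ω' u v) {S : Finset V} {v : V}
    (hS : ∀ u ∈ S, known (k v) (k u)) : degIn (bit ω) S v = degIn (bit ω') S v :=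
  Finset.sum_congr rfl fun u hu => h v u (hS u hu)

lemma degIn_eq_of_info_eq {ω ω' : Config V} (h : info k ω = info k ω') {i : Bool}
    {S : Finset V} {v : V} (hv : v ∈ S) (hP : Allowed k i S v) :
    degIn (bit ω) S v = degIn (bit ω') S v := by
  obtain ⟨h1, h2, h3, -, -⟩ := info_eq_iff.1 h
  obtain ⟨hQ, hvq, hh, hq⟩ := hP
  have key : ∀ T ⊆ S, degIn (bit ω) T v = degIn (bit ω') T v →
      (∀ u ∈ S \ T, known (k v) (k u)) → degIn (bit ω) S v = degIn (bit ω') S v := by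
    intro T hT hTd hST
    have hS : S = (S \ T) ∪ T := (Finset.sdiff_union_of_subset hT).symm
    rw [hS, degIn_union _ Finset.sdiff_disjoint, degIn_union _ Finset.sdiff_disjoint, hTd,
      degIn_congr_of_known h1 hST]
  cases hkv : k v with
  | a => exact degIn_congr_of_known h1 fun u _ => by rw [hkv]; rfl
  | h j =>
    by_cases hj : j = i
    · subst hj
      refine key _ hQ (h2 j v hkv) fun u hu => ?_
      rw [Finset.mem_sdiff, mem_block] at hu
      rw [hkv]
      cases hku : k u with
      | a => rfl
      | h => rfl
      | q l =>
        rw [hku] at hu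
        have : l ≠ j := fun h => hu.2 (by rw [h])
        simp [known, this.symm]
    · obtain rfl : j = !i := by cases i <;> cases j <;> simp_all
      refine key _ (hh hkv) (h2 _ v hkv) fun u hu => ?_
      rw [Finset.mem_sdiff, mem_block] at hu
      rw [hkv]
      cases hku : k u with
      | a => rfl
      | h => rfl
      | q l =>
        rw [hku] at hu
        have : l ≠ !i := fun h => hu.2 (by rw [h])
        revert this
        cases i <;> cases l <;> decide
  | q j =>
    by_cases hj : j = i
    · subst hj; exact absurd hkv hvq
    · obtain rfl : j = !i := by cases i <;> cases j <;> simp_all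
      obtain ⟨hq1, hq2⟩ := hq hkv
      have hdisj : Disjoint (block k (.q i)) ((block k (.q !i)).filter (v < ·)) :=
        (disjoint_block k (by simp)).mono_right (Finset.filter_subset _ _)
      have hself : ∀ ω : Config V, degIn (bit ω) (insert v (block k (.q i) ∪
          (block k (.q !i)).filter (v < ·))) v =
          degIn (bit ω) (block k (.q i)) v + forward k ω (!i) v := by
        intro ω
        unfold degIn
        rw [Finset.sum_insert (by simp [hkv]), bit_self, zero_add, Finset.sum_union hdisj]
        rfl
      refine key (insert v (block k (.q i) ∪ (block k (.q !i)).filter (v < ·))) ?_ ?_ ?_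
      · intro u hu
        rw [Finset.mem_insert, Finset.mem_union, Finset.mem_filter, mem_block] at hu
        rcases hu with rfl | hu | ⟨hu, hvu⟩
        · exact hv
        · exact hQ (mem_block.2 hu)
        · exact (hq2 u (mem_block.1 hu)).2 hvu.le
      · rw [hself, hself]
        have := h3 (!i) v hkv
        rwa [Bool.not_not] at this
      · intro u hu
        rw [Finset.mem_sdiff, Finset.mem_insert, Finset.mem_union, Finset.mem_filter, mem_block,
          mem_block] at hu
        rw [hkv]
        cases hku : k u with
        | a => rfl
        | h l =>
          have : l ≠ !i := fun h => hq1 u hu.1 (by rw [hku, h])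
          revert this
          cases i <;> cases l <;> decide
        | q l =>
          exfalso
          refine hu.2 ?_
          by_cases hl : l = i
          · subst hl; exact Or.inr (Or.inl hku)
          · obtain rfl : l = !i := by cases i <;> cases l <;> simp_all
            rcases ((hq2 u hku).1 hu.1).eq_or_lt with h | h
            · exact Or.inl h.symm
            · exact Or.inr (Or.inr ⟨hku, h⟩)

/-- The permitted elimination sequences are determined by the revealed information. -/
lemma Reach.of_info_eq {ω ω' : Config V} (h : info k ω = info k ω') {i : Bool}
    {S S' : Finset V} (hr : Reach (Allowed k i) (bit ω) S S') :
    Reach (Allowed k i) (bit ω') S S' := by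
  induction hr with
  | refl => exact .refl _
  | step hv hP h0 _ ih => exact .step hv hP (by rw [← degIn_eq_of_info_eq h hv hP, h0]) ih

end Blocks

/-! ### Conditional independence of the two leftover graphs -/

section Class

variable {V : Type*} [Fintype V] [LinearOrder V] (k : V → Block)

/-- The raised flags between the two `q`-blocks form a connected graph, in the following strong
form: some vertex of `q false` has a common neighbour with every other vertex of `q false`, and
every vertex of `q true` has a neighbour. -/
def Linked (ω : Config V) : Prop :=
  ∃ i₀, k i₀ = .q false ∧
    (∀ v, k v = .q false → v ≠ i₀ →
      ∃ j, k j = .q true ∧ (ω s(j, i₀)).1 = true ∧ (ω s(j, v)).1 = true) ∧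
    ∀ j, k j = .q true → ∃ v, k v = .q false ∧ (ω s(j, v)).1 = true

/-- The pairs between the two `q`-blocks. -/
def crossPairs : Set (Sym2 V) := {e | ∃ u v, k u = .q true ∧ k v = .q false ∧ e = s(u, v)}

/-- The vertices of the `q`-block opposite to that of `v`. -/
def opposite (v : V) : Finset V := Finset.univ.filter fun u =>
  (k v = .q true ∧ k u = .q false) ∨ (k v = .q false ∧ k u = .q true)

/-- The boundary of a vector on the pairs between the two `q`-blocks. -/
def boundary (x : Sym2 V → ZMod 2) (v : V) : ZMod 2 := ∑ u ∈ opposite k v, x s(v, u)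

variable {k}

omit [LinearOrder V] in
lemma opposite_eq {i : Bool} {v : V} (hv : k v = .q i) : opposite k v = block k (.q !i) := by
  ext u
  cases i <;> simp [opposite, hv]

lemma boundary_single {u w : V} (hu : k u = .q true) (hw : k w = .q false) (v : V) :
    boundary k (Pi.single s(u, w) 1) v =
      (if v = u then 1 else 0) + (if v = w then 1 else 0) := by
  have huw : u ≠ w := by rintro rfl; simp [hu] at hw
  unfold boundary
  by_cases hvu : v = u
  · subst hvu
    rw [Finset.sum_eq_single w]
    · simp [huw]
    · intro z _ hz
      rw [Pi.single_eq_of_ne]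
      intro h
      rcases Sym2.eq_iff.1 h with ⟨-, h⟩ | ⟨h, -⟩
      · exact hz h
      · exact huw h
    · intro h; simp [opposite, hu, hw] at h
  · by_cases hvw : v = w
    · subst hvw
      rw [Finset.sum_eq_single u]
      · simp [hvu, Sym2.eq_swap (a := v)]
      · intro z _ hz
        rw [Pi.single_eq_of_ne]
        intro h
        rcases Sym2.eq_iff.1 h with ⟨h, -⟩ | ⟨-, h⟩
        · exact hvu h
        · exact hz h
      · intro h; simp [opposite, hu, hw] at h
    · simp only [hvu, hvw, if_false, add_zero]
      refine Finset.sum_eq_zero fun z _ => ?_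
      rw [Pi.single_eq_of_ne]
      intro h
      rcases Sym2.eq_iff.1 h with ⟨h, -⟩ | ⟨h, -⟩
      · exact hvu h
      · exact hvw h

omit [LinearOrder V] in
lemma boundary_add (x y : Sym2 V → ZMod 2) (v : V) :
    boundary k (x + y) v = boundary k x v + boundary k y v := by
  simp [boundary, Finset.sum_add_distrib]

/-- In a linked configuration, every vector on the `q`-blocks with sum zero is the boundary of a
vector supported on fair pairs. -/
lemma Linked.exists_boundary {ω : Config V} (h : Linked k ω) (d : V → ZMod 2)
    (hd : ∑ v ∈ block k (.q true) ∪ block k (.q false), d v = 0) :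
    ∃ x : Sym2 V → ZMod 2, (∀ e, x e ≠ 0 → (ω e).1 = true ∧ e ∈ crossPairs k) ∧
      ∀ v ∈ block k (.q true) ∪ block k (.q false), boundary k x v = d v := by
  obtain ⟨i₀, hi₀, h1, h2⟩ := h
  let good : (Sym2 V → ZMod 2) → Prop := fun x => ∀ e, x e ≠ 0 → (ω e).1 = true ∧ e ∈ crossPairs k
  have hadd : ∀ x y, good x → good y → good (x + y) := by
    intro x y hx hy e he
    by_cases hxe : x e = 0
    · refine hy e ?_
      simpa [hxe] using he
    · exact hx e hxe
  have hsingle : ∀ u w, k u = .q true → k w = .q false → (ω s(u, w)).1 = true →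
      good (Pi.single s(u, w) 1) := by
    intro u w hu hw hf e he
    by_cases hes : e = s(u, w)
    · subst hes
      exact ⟨hf, u, w, hu, hw, rfl⟩
    · rw [Pi.single_eq_of_ne hes] at he
      exact absurd rfl he
  -- `e_v + e_{i₀}` is a boundary, first for `v ∈ q false`, then for `v ∈ q true`.
  have hpathF : ∀ v, k v = .q false → ∃ x, good x ∧ ∀ u, boundary k x u =
      (if u = v then 1 else 0) + (if u = i₀ then 1 else 0) := by
    intro v hv
    by_cases hvi : v = i₀
    · refine ⟨0, fun e he => absurd rfl he, fun u => ?_⟩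
      rw [hvi, CharTwo.add_self_eq_zero]
      simp [boundary]
    · obtain ⟨j, hj, hf1, hf2⟩ := h1 v hv hvi
      refine ⟨_, hadd _ _ (hsingle j i₀ hj hi₀ hf1) (hsingle j v hj hv hf2), fun u => ?_⟩
      rw [boundary_add, boundary_single hj hi₀, boundary_single hj hv]
      linear_combination CharTwo.add_self_eq_zero (if u = j then (1 : ZMod 2) else 0)
  have hpath : ∀ v ∈ block k (.q true) ∪ block k (.q false), ∃ x, good x ∧ ∀ u, boundary k x u =
      (if u = v then 1 else 0) + (if u = i₀ then 1 else 0) := by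
    intro v hv
    rw [Finset.mem_union, mem_block, mem_block] at hv
    rcases hv with hv | hv
    · obtain ⟨w, hw, hf⟩ := h2 v hv
      obtain ⟨x, hx, hbx⟩ := hpathF w hw
      refine ⟨_, hadd _ _ hx (hsingle v w hv hw hf), fun u => ?_⟩
      rw [boundary_add, boundary_single hv hw, hbx]
      linear_combination CharTwo.add_self_eq_zero (if u = w then (1 : ZMod 2) else 0)
    · exact hpathF v hv
  choose! X hX hbX using hpath
  refine ⟨fun e => ∑ v ∈ block k (.q true) ∪ block k (.q false), d v * X v e, ?_, ?_⟩
  · intro e he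
    obtain ⟨v, hv, hve⟩ := Finset.exists_ne_zero_of_sum_ne_zero he
    exact hX v hv e (right_ne_zero_of_mul hve)
  · intro u hu
    have : boundary k (fun e => ∑ v ∈ block k (.q true) ∪ block k (.q false), d v * X v e) u =
        ∑ v ∈ block k (.q true) ∪ block k (.q false), d v * boundary k (X v) u := by
      simp only [boundary, Finset.mul_sum]
      exact Finset.sum_comm
    rw [this, Finset.sum_congr rfl fun v hv => by rw [hbX v hv u]]
    simp only [mul_add, Finset.sum_add_distrib, mul_ite, mul_one, mul_zero]
    rw [Finset.sum_ite_eq, if_pos hu]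
    by_cases hui : u = i₀
    · simp [hui, hd]
    · simp [hui]

/-- The pairs inside a set of vertices. -/
def pairsIn (S : Finset V) : Set (Sym2 V) := {e | e ∈ S.sym2}

variable (k) in
/-- The two configurations have the same partial information on the leftover `q i ∪ A'`: the same
edges inside `A'`, degree parities on `A'` and parity of the number of edges. -/
def SameReveal (i : Bool) (A' : Finset V) (ω₀ ω : Config V) : Prop :=
  (∀ u ∈ A', ∀ v ∈ A', bit ω u v = bit ω₀ u v) ∧
  (∀ v ∈ A', degIn (bit ω) (block k (.q i) ∪ A') v = degIn (bit ω₀) (block k (.q i) ∪ A') v) ∧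
  edgesIn ω (block k (.q i) ∪ A') = edgesIn ω₀ (block k (.q i) ∪ A')

omit [Fintype V] in
lemma degIn_congr_of_pairsIn {S : Finset V} {ω ω' : Config V} (h : ∀ e ∈ pairsIn S, ω e = ω' e)
    {T : Finset V} (hT : T ⊆ S) {v : V} (hv : v ∈ S) : degIn (bit ω) T v = degIn (bit ω') T v :=
  Finset.sum_congr rfl fun u hu => by
    unfold bit
    rw [h s(v, u) (Finset.mk_mem_sym2_iff.2 ⟨hv, hT hu⟩)]

lemma dependsOnlyOn_sameReveal (i : Bool) (A' : Finset V) (ω₀ : Config V) :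
    DependsOnlyOn (pairsIn (block k (.q i) ∪ A')) (SameReveal k i A' ω₀) := by
  intro x y h
  have h1 : ∀ u ∈ A', ∀ v ∈ A', bit x u v = bit y u v := fun u hu v hv => by
    unfold bit
    rw [h s(u, v) (Finset.mk_mem_sym2_iff.2 ⟨Finset.mem_union_right _ hu,
      Finset.mem_union_right _ hv⟩)]
  have h2 : ∀ v ∈ A', degIn (bit x) (block k (.q i) ∪ A') v =
      degIn (bit y) (block k (.q i) ∪ A') v := fun v hv =>
    degIn_congr_of_pairsIn h subset_rfl (Finset.mem_union_right _ hv)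
  have h3 : edgesIn x (block k (.q i) ∪ A') = edgesIn y (block k (.q i) ∪ A') :=
    Finset.sum_congr rfl fun e he => by
      unfold edgeBit
      rw [h e he]
  unfold SameReveal
  rw [h3]
  refine propext (and_congr ?_ (and_congr ?_ Iff.rfl))
  · exact forall₂_congr fun u hu => forall₂_congr fun v hv => by rw [h1 u hu v hv]
  · exact forall₂_congr fun v hv => by rw [h2 v hv]

variable (k) in
/-- The part of the revealed information that concerns neither the leftover sets `q i ∪ A' i` nor
the pairs between the two `q`-blocks. -/
def SameRest (A' : Bool → Finset V) (ω₀ ω : Config V) : Prop :=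
  (∀ u v, known (k u) (k v) → (¬∃ i, u ∈ A' i ∧ v ∈ A' i) → bit ω u v = bit ω₀ u v) ∧
  ∀ i v, k v = .h i → v ∉ A' i →
    degIn (bit ω) (block k (.q i)) v = degIn (bit ω₀) (block k (.q i)) v

variable (k) in
/-- The part of the revealed information that involves the pairs between the two `q`-blocks. -/
def SameCross (ω₀ ω : Config V) : Prop :=
  (∀ i v, k v = .q i → degIn (bit ω) (block k (.q !i)) v + forward k ω i v =
      degIn (bit ω₀) (block k (.q !i)) v + forward k ω₀ i v) ∧
  ∀ u v, k u = .q true → k v = .q false → (ω s(u, v)).1 = (ω₀ s(u, v)).1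

lemma SameReveal.degIn_eq {i : Bool} {A' : Finset V} (hA' : A' ⊆ block k (.h i))
    {ω₀ ω : Config V} (h : SameReveal k i A' ω₀ ω) {v : V} (hv : v ∈ A') :
    degIn (bit ω) (block k (.q i)) v = degIn (bit ω₀) (block k (.q i)) v := by
  have hdisj : Disjoint (block k (.q i)) A' := (disjoint_block k (by simp)).mono_right hA'
  have h1 := h.2.1 v hv
  rw [degIn_union _ hdisj, degIn_union _ hdisj] at h1
  have hd : degIn (bit ω) A' v = degIn (bit ω₀) A' v :=
    Finset.sum_congr rfl fun u hu => h.1 v hv u hu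
  rw [hd] at h1
  exact add_right_cancel h1

omit [Fintype V] in
lemma edgesIn_congr {S : Finset V} {ω ω' : Config V}
    (h : ∀ u ∈ S, ∀ v ∈ S, bit ω u v = bit ω' u v) : edgesIn ω S = edgesIn ω' S := by
  refine Finset.sum_congr rfl fun e he => ?_
  induction e with
  | _ u v =>
    rw [Finset.mk_mem_sym2_iff] at he
    rw [edgeBit_mk, edgeBit_mk, h u he.1 v he.2]

lemma SameReveal.edgesIn_eq {i : Bool} {A' : Finset V} (hA' : A' ⊆ block k (.h i))
    {ω₀ ω : Config V} (h : SameReveal k i A' ω₀ ω) :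
    edgesIn ω (block k (.q i)) = edgesIn ω₀ (block k (.q i)) := by
  have hdisj : Disjoint (block k (.q i)) A' := (disjoint_block k (by simp)).mono_right hA'
  have h1 := h.2.2
  rw [edgesIn_union _ hdisj, edgesIn_union _ hdisj, edgesIn_congr h.1,
    Finset.sum_congr rfl fun v hv => h.degIn_eq hA' hv] at h1
  exact add_right_cancel (add_right_cancel h1)

lemma info_eq_iff_same {A' : Bool → Finset V} (hA' : ∀ i, A' i ⊆ block k (.h i))
    {ω₀ ω : Config V} : info k ω = info k ω₀ ↔
    (SameRest k A' ω₀ ω ∧ SameReveal k true (A' true) ω₀ ω ∧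
      SameReveal k false (A' false) ω₀ ω) ∧ SameCross k ω₀ ω := by
  have hk : ∀ i, ∀ v ∈ A' i, k v = .h i := fun i v hv => mem_block.1 (hA' i hv)
  have hdisj : ∀ i, Disjoint (block k (.q i)) (A' i) := fun i =>
    (disjoint_block k (by simp)).mono_right (hA' i)
  have hknown : ∀ i, ∀ u ∈ A' i, ∀ v ∈ A' i, known (k u) (k v) := fun i u hu v hv => by
    rw [hk i u hu, hk i v hv]; rfl
  rw [info_eq_iff]
  constructor
  · rintro ⟨h1, h2, h3, h4, h5⟩
    have hrev : ∀ i, SameReveal k i (A' i) ω₀ ω := by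
      intro i
      have hb : ∀ u ∈ A' i, ∀ v ∈ A' i, bit ω u v = bit ω₀ u v := fun u hu v hv =>
        h1 u v (hknown i u hu v hv)
      refine ⟨hb, fun v hv => ?_, ?_⟩
      · rw [degIn_union _ (hdisj i), degIn_union _ (hdisj i), h2 i v (hk i v hv)]
        congr 1
        exact Finset.sum_congr rfl fun u hu => hb v hv u hu
      · rw [edgesIn_union _ (hdisj i), edgesIn_union _ (hdisj i), h4 i, edgesIn_congr hb,
          Finset.sum_congr rfl fun v hv => h2 i v (hk i v hv)]
    exact ⟨⟨⟨fun u v h _ => h1 u v h, fun i v h _ => h2 i v h⟩, hrev true, hrev false⟩, h3, h5⟩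
  · rintro ⟨⟨⟨h1, h2⟩, hT, hF⟩, h3, h5⟩
    have hrev : ∀ i, SameReveal k i (A' i) ω₀ ω := fun i => by cases i <;> assumption
    have hrho : ∀ i v, k v = .h i →
        degIn (bit ω) (block k (.q i)) v = degIn (bit ω₀) (block k (.q i)) v := by
      intro i v hv
      by_cases hvA : v ∈ A' i
      · exact (hrev i).degIn_eq (hA' i) hvA
      · exact h2 i v hv hvA
    refine ⟨fun u v h => ?_, hrho, h3, fun i => ?_, h5⟩
    · by_cases hex : ∃ i, u ∈ A' i ∧ v ∈ A' i
      · obtain ⟨i, hu, hv⟩ := hex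
        exact (hrev i).1 u hu v hv
      · exact h1 u v h hex
    · exact (hrev i).edgesIn_eq (hA' i)

lemma disjoint_crossPairs {i : Bool} {A' : Finset V} (hA' : A' ⊆ block k (.h i)) :
    pairsIn (block k (.q i) ∪ A') ⊆ (crossPairs k)ᶜ := by
  rintro e he ⟨u, v, hu, hv, rfl⟩
  have hA'' : ∀ v ∈ A', k v = .h i := fun v hv => mem_block.1 (hA' hv)
  obtain ⟨h1, h2⟩ := Finset.mk_mem_sym2_iff.1 he
  rw [Finset.mem_union, mem_block] at h1 h2
  rcases h1 with h1 | h1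
  · rcases h2 with h2 | h2
    · rw [hu] at h1; rw [hv, ← h1] at h2; simp at h2
    · have := hA'' v h2; rw [hv] at this; simp at this
  · have := hA'' u h1; rw [hu] at this; simp at this

lemma disjoint_pairsIn {A' : Bool → Finset V} (hA' : ∀ i, A' i ⊆ block k (.h i)) :
    pairsIn (block k (.q false) ∪ A' false) ⊆ (pairsIn (block k (.q true) ∪ A' true))ᶜ := by
  intro e he he'
  induction e with
  | _ u v =>
    have h1 := (Finset.mk_mem_sym2_iff.1 he).1
    have h2 := (Finset.mk_mem_sym2_iff.1 he').1
    rw [Finset.mem_union, mem_block] at h1 h2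
    rcases h1 with h1 | h1 <;> rcases h2 with h2 | h2
    · rw [h1] at h2; simp at h2
    · have := mem_block.1 (hA' _ h2); rw [h1] at this; simp at this
    · have := mem_block.1 (hA' _ h1); rw [h2] at this; simp at this
    · have h3 := mem_block.1 (hA' _ h1)
      have h4 := mem_block.1 (hA' _ h2)
      rw [h3] at h4; simp at h4

omit [Fintype V] in
lemma bit_congr {ω ω' : Config V} {u v : V} (h : ω s(u, v) = ω' s(u, v)) :
    bit ω u v = bit ω' u v := by
  unfold bit; rw [h]

lemma dependsOnlyOn_sameRest {A' : Bool → Finset V} (hA' : ∀ i, A' i ⊆ block k (.h i))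
    (ω₀ : Config V) : DependsOnlyOn (crossPairs k ∪ (pairsIn (block k (.q true) ∪ A' true) ∪
      pairsIn (block k (.q false) ∪ A' false)))ᶜ (SameRest k A' ω₀) := by
  intro x y h
  have hk : ∀ i, ∀ v ∈ A' i, k v = .h i := fun i v hv => mem_block.1 (hA' i hv)
  have hpair : ∀ u v, (∀ i, ¬(u ∈ block k (.q i) ∪ A' i ∧ v ∈ block k (.q i) ∪ A' i)) →
      (∀ i, ¬(k u = .q i ∧ k v = .q !i)) → bit x u v = bit y u v := by
    intro u v h1 h2
    refine bit_congr (h _ ?_)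
    rintro (⟨u', v', hu', hv', he⟩ | he | he)
    · rcases Sym2.eq_iff.1 he with ⟨rfl, rfl⟩ | ⟨rfl, rfl⟩
      · exact h2 true ⟨hu', hv'⟩
      · exact h2 false ⟨hv', hu'⟩
    · exact h1 true (Finset.mk_mem_sym2_iff.1 he)
    · exact h1 false (Finset.mk_mem_sym2_iff.1 he)
  have hb : ∀ u v, known (k u) (k v) → (¬∃ i, u ∈ A' i ∧ v ∈ A' i) → bit x u v = bit y u v := by
    intro u v huv hno
    refine hpair u v (fun i hi => ?_) (fun i hi => ?_)
    · obtain ⟨h1, h2⟩ := hi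
      rw [Finset.mem_union, mem_block] at h1 h2
      rcases h1 with h1 | h1
      · rcases h2 with h2 | h2
        · rw [h1, h2] at huv; simp [known] at huv
        · rw [h1, hk i v h2] at huv; simp [known] at huv
      · rcases h2 with h2 | h2
        · rw [h2, hk i u h1] at huv; simp [known] at huv
        · exact hno ⟨i, h1, h2⟩
    · rw [hi.1, hi.2] at huv; simp [known] at huv
  have hd : ∀ i v, k v = .h i → v ∉ A' i →
      degIn (bit x) (block k (.q i)) v = degIn (bit y) (block k (.q i)) v := by
    intro i v hv hvA
    refine Finset.sum_congr rfl fun u hu => hpair v u (fun j hj => ?_) (fun j hj => ?_)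
    · obtain ⟨h1, h2⟩ := hj
      rw [Finset.mem_union, mem_block] at h1 h2
      rw [mem_block] at hu
      rcases h1 with h1 | h1
      · rw [hv] at h1; simp at h1
      · have h3 := hk j v h1
        rw [hv] at h3
        obtain rfl : i = j := by simpa using h3
        exact hvA h1
    · rw [hv] at hj; simp at hj
  unfold SameRest
  refine propext (and_congr ?_ ?_)
  · refine forall₂_congr fun u v => forall_congr' fun h1 => forall_congr' fun h2 => ?_
    rw [hb u v h1 h2]
  · refine forall₂_congr fun i v => forall_congr' fun h1 => forall_congr' fun h2 => ?_
    rw [hd i v h1 h2]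

lemma ind_congr {P Q : Prop} (h : P ↔ Q) : ind P = ind Q := by rw [propext h]

open scoped Classical in
/-- Given the other edges, the information on the pairs between the `q`-blocks is equally likely
whatever the edges inside the `q`-blocks, as long as the parities of their numbers agree. -/
lemma expect_sameCross_eq {p : ℝ} {ω₀ ω : Config V} (hL : Linked k ω₀)
    (h : ∀ i, edgesIn ω (block k (.q i)) = edgesIn ω₀ (block k (.q i))) :
    expect (letterWeight p) (fun y => ind (SameCross k ω₀ ((crossPairs k).piecewise y ω))) =
      expect (letterWeight p) (fun y => ind (SameCross k ω₀ ((crossPairs k).piecewise y ω₀))) := by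
  -- The change of the forward degrees is compensated by a boundary.
  let d : V → ZMod 2 := fun v => forward k ω true v + forward k ω₀ true v
  let d' : V → ZMod 2 := fun v => forward k ω false v + forward k ω₀ false v
  have hsum : ∀ i, ∑ v ∈ block k (.q i), (forward k ω i v + forward k ω₀ i v) = 0 := by
    intro i
    rw [Finset.sum_add_distrib]
    unfold forward
    rw [sum_forward_eq, sum_forward_eq, h i, CharTwo.add_self_eq_zero]
  obtain ⟨x, hx, hbx⟩ := hL.exists_boundary (fun v => if k v = .q true then d v else d' v) (by
    rw [Finset.sum_union (disjoint_block k (by simp)), ← add_zero (0 : ZMod 2)]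
    congr 1
    · rw [← hsum true]
      exact Finset.sum_congr rfl fun v hv => if_pos (mem_block.1 hv)
    · rw [← hsum false]
      refine Finset.sum_congr rfl fun v hv => if_neg ?_
      rw [mem_block.1 hv]; simp)
  have hbx' : ∀ i v, k v = .q i →
      ∑ u ∈ block k (.q !i), x s(v, u) = forward k ω i v + forward k ω₀ i v := by
    intro i v hv
    have h1 := hbx v (by cases i <;> simp [hv])
    rw [boundary, opposite_eq hv] at h1
    rw [h1]
    cases i <;> simp [hv, d, d']
  -- Only the configurations with the flags of `ω₀` matter; shift these by `x`.
  let X : Config V → Sym2 V → ZMod 2 := fun y =>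
    if ∀ e ∈ crossPairs k, (y e).1 = (ω₀ e).1 then x else 0
  rw [← expect_flip p X (fun y y' hy => by simp only [X, hy]) (fun y e he => by
    simp only [X] at he
    split_ifs at he with hf
    · rw [hf e (hx e he).2]; exact (hx e he).1
    · exact absurd rfl he)
    (fun y => ind (SameCross k ω₀ ((crossPairs k).piecewise y ω₀)))]
  congr 1
  ext y
  refine ind_congr ?_
  have hflag : ∀ y ω : Config V, (∀ u v, k u = .q true → k v = .q false →
      ((crossPairs k).piecewise y ω s(u, v)).1 = (ω₀ s(u, v)).1) ↔
      ∀ e ∈ crossPairs k, (y e).1 = (ω₀ e).1 := by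
    intro y ω
    constructor
    · rintro h e ⟨u, v, hu, hv, rfl⟩
      have := h u v hu hv
      rwa [Set.piecewise_eq_of_mem _ _ _ (show s(u, v) ∈ crossPairs k from ⟨u, v, hu, hv, rfl⟩)]
        at this
    · intro h u v hu hv
      rw [Set.piecewise_eq_of_mem _ _ _ (show s(u, v) ∈ crossPairs k from ⟨u, v, hu, hv, rfl⟩)]
      exact h _ ⟨u, v, hu, hv, rfl⟩
  have hmem : ∀ i v u, k v = .q i → k u = .q !i → s(v, u) ∈ crossPairs k := by
    intro i v u hv hu
    cases i
    · exact ⟨u, v, hu, hv, Sym2.eq_swap⟩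
    · exact ⟨v, u, hv, hu, rfl⟩
  have hdeg : ∀ (y ω : Config V) i v, k v = .q i →
      degIn (bit ((crossPairs k).piecewise y ω)) (block k (.q !i)) v =
      ∑ u ∈ block k (.q !i), (y s(v, u)).2 := by
    intro y ω i v hv
    refine Finset.sum_congr rfl fun u hu => ?_
    rw [mem_block] at hu
    have hvu : v ≠ u := by rintro rfl; rw [hv] at hu; simp at hu
    rw [bit_of_ne _ hvu, Set.piecewise_eq_of_mem _ _ _ (hmem i v u hv hu)]
  have hfwd : ∀ (y ω : Config V) i v, k v = .q i →
      forward k ((crossPairs k).piecewise y ω) i v = forward k ω i v := by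
    intro y ω i v hv
    refine Finset.sum_congr rfl fun u hu => bit_congr ?_
    rw [Finset.mem_filter, mem_block] at hu
    refine Set.piecewise_eq_of_notMem _ _ _ ?_
    rintro ⟨u', v', hu', hv', he⟩
    rcases Sym2.eq_iff.1 he with ⟨rfl, rfl⟩ | ⟨rfl, rfl⟩
    · rw [hu'] at hv; rw [hv', ← hv] at hu; simp at hu
    · rw [hv'] at hv; rw [hu', ← hv] at hu; simp at hu
  unfold SameCross
  rw [hflag, hflag]
  by_cases hf : ∀ e ∈ crossPairs k, (y e).1 = (ω₀ e).1
  · have hX : X y = x := if_pos hf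
    refine and_congr (forall₂_congr fun i v => forall_congr' fun hv => ?_) Iff.rfl
    rw [hdeg _ _ i v hv, hfwd _ _ i v hv, hdeg _ _ i v hv, hfwd _ _ i v hv]
    have : ∑ u ∈ block k (.q !i), (flip (X y) y s(v, u)).2 =
        ∑ u ∈ block k (.q !i), (y s(v, u)).2 + (forward k ω i v + forward k ω₀ i v) := by
      rw [← hbx' i v hv, ← Finset.sum_add_distrib, hX]
      rfl
    rw [this, add_assoc, add_assoc, CharTwo.add_self_eq_zero, add_zero]
  · exact iff_of_false (fun h => hf h.2) fun h => hf h.2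

/-- On a class of configurations with the same information, the contributions of the two leftover
graphs factorise. -/
lemma expect_info_eq_mul {p : ℝ} (h0 : 0 ≤ p) (h1 : p ≤ 1) {A' : Bool → Finset V}
    (hA' : ∀ i, A' i ⊆ block k (.h i)) {ω₀ : Config V} (hL : Linked k ω₀)
    (F : Bool → Config V → ℝ)
    (hF : ∀ i, DependsOnlyOn (pairsIn (block k (.q i) ∪ A' i)) (F i)) :
    expect (letterWeight p) (fun ω => ind (info k ω = info k ω₀) * (F true ω * F false ω)) =
      open scoped Classical in
      expect (letterWeight p)
        (fun y => ind (SameCross k ω₀ ((crossPairs k).piecewise y ω₀))) *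
      (expect (letterWeight p) (fun ω => ind (SameRest k A' ω₀ ω)) *
      (expect (letterWeight p) (fun ω => ind (SameReveal k true (A' true) ω₀ ω) * F true ω) *
      expect (letterWeight p)
        (fun ω => ind (SameReveal k false (A' false) ω₀ ω) * F false ω))) := by
  classical
  have hw := isProbVec_letterWeight.2 ⟨h0, h1⟩
  let R : Bool → Config V → ℝ := fun i ω => ind (SameReveal k i (A' i) ω₀ ω) * F i ω
  let M : Config V → ℝ := fun ω => ind (SameRest k A' ω₀ ω) * (R true ω * R false ω)
  have hR : ∀ i, DependsOnlyOn (pairsIn (block k (.q i) ∪ A' i)) (R i) := fun i x y h => by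
    simp only [R, dependsOnlyOn_sameReveal i (A' i) ω₀ x y h, hF i x y h]
  have hrest : ∀ S : Set (Sym2 V), S ⊆ crossPairs k ∪ (pairsIn (block k (.q true) ∪ A' true) ∪
      pairsIn (block k (.q false) ∪ A' false)) →
      DependsOnlyOn Sᶜ fun ω => ind (SameRest k A' ω₀ ω) := fun S hS x y h => by
    simp only [(dependsOnlyOn_sameRest hA' ω₀).mono (Set.compl_subset_compl.2 hS) x y h]
  have hM : DependsOnlyOn (crossPairs k)ᶜ M := fun x y h => by
    simp only [M, hrest _ Set.subset_union_left x y h,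
      (hR true).mono (disjoint_crossPairs (hA' true)) x y h,
      (hR false).mono (disjoint_crossPairs (hA' false)) x y h]
  have hsplit : ∀ ω, ind (info k ω = info k ω₀) * (F true ω * F false ω) =
      M ω * ind (SameCross k ω₀ ω) := by
    intro ω
    rw [ind_congr (info_eq_iff_same hA'), ind_and, ind_and, ind_and]
    simp only [M, R]
    ring
  have hfac : expect (letterWeight p) M =
      expect (letterWeight p) (fun ω => ind (SameRest k A' ω₀ ω)) *
      (expect (letterWeight p) (R true) * expect (letterWeight p) (R false)) := by
    have e1 : M = fun ω => R true ω * (ind (SameRest k A' ω₀ ω) * R false ω) := by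
      ext ω; simp only [M]; ring
    have e2 : (fun ω => ind (SameRest k A' ω₀ ω) * R false ω) =
        fun ω => R false ω * ind (SameRest k A' ω₀ ω) := by
      ext ω; ring
    rw [e1, expect_mul_indep hw _ (hR true), e2, expect_mul_indep hw _ (hR false)]
    · ring
    · exact hrest _ (Set.subset_union_right.trans Set.subset_union_right)
    · intro x y h
      simp only [hrest _ (Set.subset_union_left.trans Set.subset_union_right) x y h,
        (hR false).mono (disjoint_pairsIn hA') x y h]
  rw [funext hsplit, ← expect_resample hw (crossPairs k), ← hfac, ← expect_const_mul]
  congr 1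
  ext x
  have h2 : ∀ y, M ((crossPairs k).piecewise y x) = M x := fun y => hM _ _ fun i hi =>
    Set.piecewise_eq_of_notMem _ _ _ hi
  simp only [h2]
  rw [expect_const_mul, mul_comm]
  by_cases hx : ∀ i, SameReveal k i (A' i) ω₀ x
  · rw [expect_sameCross_eq hL fun i => (hx i).edgesIn_eq (hA' i)]
  · have h3 : M x = 0 := by
      rw [Bool.forall_bool, not_and_or] at hx
      rcases hx with hx | hx <;> simp [M, R, ind_of_false hx]
    rw [h3, mul_zero, mul_zero]

/-- On a class of configurations with the same information, the probability that both leftover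
graphs are bad is at most the product of their conditional probabilities of being bad. -/
theorem expect_info_le {p : ℝ} (h0 : 0 ≤ p) (h1 : p ≤ 1) {A' : Bool → Finset V}
    (hA' : ∀ i, A' i ⊆ block k (.h i)) {ω₀ : Config V} (hL : Linked k ω₀)
    (B : Bool → Config V → Prop)
    (hB : ∀ i, DependsOnlyOn (pairsIn (block k (.q i) ∪ A' i)) (B i)) {f : ℝ}
    (hf : ∀ i, expect (letterWeight p) (fun ω => ind (SameReveal k i (A' i) ω₀ ω ∧ B i ω)) ≤
      f * expect (letterWeight p) (fun ω => ind (SameReveal k i (A' i) ω₀ ω))) :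
    expect (letterWeight p) (fun ω => ind (info k ω = info k ω₀ ∧ B true ω ∧ B false ω)) ≤
      f ^ 2 * expect (letterWeight p) (fun ω => ind (info k ω = info k ω₀)) := by
  have hw := isProbVec_letterWeight.2 ⟨h0, h1⟩
  have e1 := expect_info_eq_mul h0 h1 hA' hL (fun i ω => ind (B i ω))
    (fun i x y h => by simp only [hB i x y h])
  have e2 := expect_info_eq_mul h0 h1 hA' hL (fun _ _ => 1) (fun _ _ _ _ => rfl)
  simp only [mul_one] at e2
  simp only [← ind_and] at e1
  rw [e1, e2]
  have hn : ∀ Q : Config V → Prop, 0 ≤ expect (letterWeight p) fun ω => ind (Q ω) := fun Q =>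
    expect_nonneg hw fun ω => ind_nonneg _
  have h2 := mul_le_mul (hf true) (hf false) (hn _) ((hn _).trans (hf true))
  refine (mul_le_mul_of_nonneg_left (mul_le_mul_of_nonneg_left h2 (hn _)) (hn _)).trans_eq ?_
  ring

end Class

/-! ### Comparison with the binomial random graph -/

section Law

open MeasureTheory

variable {V W : Type*} [DecidableEq V] [DecidableEq W]

/-- The configuration induced on the vertex set `W` by an embedding `φ : W ↪ V`. -/
def pull (φ : W ↪ V) (ω : Config V) : Config W := fun e => ω (e.map φ)

lemma bit_pull (φ : W ↪ V) (ω : Config V) (u v : W) :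
    bit (pull φ ω) u v = bit ω (φ u) (φ v) := by
  simp [bit, pull, φ.injective.eq_iff]

lemma edgesIn_pull (φ : W ↪ V) (ω : Config V) (S : Finset W) :
    edgesIn (pull φ ω) S = edgesIn ω (S.map φ) := by
  unfold edgesIn
  rw [Finset.sym2_map, Finset.sum_map]
  refine Finset.sum_congr rfl fun e _ => ?_
  induction e with
  | _ u v => exact (edgeBit_mk _ u v).trans ((bit_pull φ ω u v).trans (edgeBit_mk ω _ _).symm)

lemma degIn_pull (φ : W ↪ V) (ω : Config V) (S : Finset W) (v : W) :
    degIn (bit (pull φ ω)) S v = degIn (bit ω) (S.map φ) (φ v) := by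
  unfold degIn
  rw [Finset.sum_map]
  exact Finset.sum_congr rfl fun u _ => bit_pull φ ω v u

instance [Finite V] : MeasurableSingletonClass (SimpleGraph V) where
  measurableSet_singleton G := by
    have h : ({G} : Set (SimpleGraph V)) = SimpleGraph.edgeSet ⁻¹' {G.edgeSet} := by
      ext H
      simp
    rw [h]
    exact SimpleGraph.measurable_edgeSet (measurableSet_singleton _)

variable [Fintype V] [Fintype W]

/-- The graph induced by `φ` on `W` takes a given value with the probability given by `G(W, p)`. -/
lemma expect_toGraph_pull_eq (φ : W ↪ V) (p : unitInterval) (G : SimpleGraph W) :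
    expect (letterWeight p) (fun ω : Config V => ind (toGraph (pull φ ω) = G)) =
      (SimpleGraph.binomialRandom W p).real {G} := by
  classical
  have hw := isProbVec_letterWeight.2 ⟨p.2.1, p.2.2⟩
  let f : Sym2 W → ZMod 2 → ℝ := fun e b =>
    if e.IsDiag then 1 else if (b = 1 ↔ e ∈ G.edgeSet) then 1 else 0
  have h1 : ∀ ω : Config V, ind (toGraph (pull φ ω) = G) =
      ∏ e ∈ Finset.univ, f e (ω (e.map φ)).2 := by
    intro ω
    have hiff : toGraph (pull φ ω) = G ↔
        ∀ e : Sym2 W, ¬e.IsDiag → ((ω (e.map φ)).2 = 1 ↔ e ∈ G.edgeSet) := by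
      constructor
      · rintro rfl e he
        induction e with
        | _ u v =>
          have huv : u ≠ v := by simpa using he
          rw [SimpleGraph.mem_edgeSet]
          change _ ↔ bit (pull φ ω) u v = 1
          rw [bit_of_ne _ huv]
          rfl
      · intro h
        ext u v
        change bit (pull φ ω) u v = 1 ↔ _
        by_cases huv : u = v
        · subst huv; simp
        · rw [bit_of_ne _ huv]
          exact h s(u, v) (by simpa using huv)
    by_cases hG : toGraph (pull φ ω) = G
    · rw [ind_of_true hG, Finset.prod_eq_one]
      intro e _
      by_cases he : e.IsDiag
      · simp [f, he]
      · simp only [f, he, if_false]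
        exact if_pos (hiff.1 hG e he)
    · rw [ind_of_false hG]
      rw [hiff] at hG
      push Not at hG
      obtain ⟨e, he, hne⟩ := hG
      refine (Finset.prod_eq_zero (Finset.mem_univ e) ?_).symm
      simp only [f, he, if_false]
      refine if_neg fun h => ?_
      rcases hne with h' | h' <;> tauto
  rw [funext h1, expect_prod_indep hw Finset.univ (fun e => {e.map φ})
    (fun e ω => f e (ω (e.map φ)).2)]
  · have h2 : ∀ e : Sym2 W, expect (letterWeight p)
        (fun ω : Config V => f e (ω (e.map φ)).2) =
        if e.IsDiag then 1 else if e ∈ G.edgeSet then (p : ℝ) else 1 - p := by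
      intro e
      rw [expect_coord hw (e.map φ) (fun b => f e b.2), sum_letterWeight_bit]
      by_cases he : e.IsDiag
      · simp [f, he]
      · by_cases heG : e ∈ G.edgeSet <;> simp [f, he, heG]
    rw [Finset.prod_congr rfl fun e _ => h2 e]
    have h3 : (SimpleGraph.binomialRandom W p).real {G} =
        (p : ℝ) ^ G.edgeSet.ncard * (1 - p : ℝ) ^ ((Nat.card W).choose 2 - G.edgeSet.ncard) := by
      rw [measureReal_def, SimpleGraph.binomialRandom_singleton]
      simp
    rw [h3, Finset.prod_ite, Finset.prod_const_one, one_mul, Finset.prod_ite, Finset.prod_const,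
      Finset.prod_const]
    have h4 : ((Finset.univ.filter fun e : Sym2 W => ¬e.IsDiag).filter
        fun e => e ∈ G.edgeSet).card = G.edgeSet.ncard := by
      rw [← Set.ncard_coe_finset]
      congr 1
      ext e
      simp only [Finset.coe_filter, Finset.mem_filter, Finset.mem_univ, true_and,
        Set.mem_ofPred_eq]
      exact ⟨fun h => h.2, fun h => ⟨G.not_isDiag_of_mem_edgeSet h, h⟩⟩
    have h5 := Finset.card_filter_add_card_filter_not
      (s := Finset.univ.filter fun e : Sym2 W => ¬e.IsDiag) (fun e => e ∈ G.edgeSet)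
    have h6 : (Finset.univ.filter fun e : Sym2 W => ¬e.IsDiag).card = (Nat.card W).choose 2 := by
      rw [← Fintype.card_subtype, Sym2.card_subtype_not_diag, Nat.card_eq_fintype_card]
    rw [h4] at h5 ⊢
    congr 2
    omega
  · intro e _ x y h
    simp only [h (e.map φ) rfl]
  · intro e _ e' _ hne
    rw [Set.disjoint_singleton]
    exact fun h => hne (Sym2.map.injective φ.injective h)

/-- The graph induced by `φ` on `W` has law `G(W, p)`. -/
lemma expect_toGraph_pull_mem (φ : W ↪ V) (p : unitInterval) (S : Set (SimpleGraph W)) :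
    expect (letterWeight p) (fun ω : Config V => ind (toGraph (pull φ ω) ∈ S)) =
      (SimpleGraph.binomialRandom W p).real S := by
  classical
  have h1 : ∀ ω : Config V, ind (toGraph (pull φ ω) ∈ S) =
      ∑ G ∈ S.toFinset, ind (toGraph (pull φ ω) = G) := by
    intro ω
    simp only [ind]
    rw [Finset.sum_ite_eq]
    simp
  rw [funext h1, expect_sum, Finset.sum_congr rfl fun G _ => expect_toGraph_pull_eq φ p G,
    sum_measureReal_singleton, Set.coe_toFinset]

end Law

section Bound

open MeasureTheory

/-- Conditioned on any partial information, a partially revealed graph on `n` vertices fails to be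
even-degenerate with probability at most `f_α(n)`. -/
lemma real_inter_le_worstFailureProb (α : ℝ) (p : unitInterval) (hp1 : p < 1) {n : ℕ}
    (A : Set (Fin n)) (H : SimpleGraph A) (s : A → ZMod 2) (t : ZMod 2)
    (hA : (A.ncard : ℝ) ≤ (n : ℝ) ^ (1 - 2 * α)) :
    (SimpleGraph.binomialRandom (Fin n) p).real
        (revealEvent A H s t ∩ {G | ¬EvenDegenerate G}) ≤
      worstFailureProb α p n *
        (SimpleGraph.binomialRandom (Fin n) p).real (revealEvent A H s t) := by
  set μ := SimpleGraph.binomialRandom (Fin n) p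
  set E := revealEvent A H s t
  by_cases h0 : μ E = 0
  · have h1 : μ.real (E ∩ {G | ¬EvenDegenerate G}) = 0 := by
      rw [measureReal_def, measure_mono_null Set.inter_subset_left h0, ENNReal.toReal_zero]
    have h2 : μ.real E = 0 := by rw [measureReal_def, h0, ENNReal.toReal_zero]
    rw [h1, h2, mul_zero]
  · have hmem : (ProbabilityTheory.cond μ E).real {G | ¬EvenDegenerate G} ∈
        failureProbs α p n := ⟨_, ⟨A, H, s, t, by simpa using hA, h0, rfl⟩, rfl⟩
    have hle := (isGreatest_worstFailureProb α p hp1 n).2 hmem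
    have hE : MeasurableSet E := (Set.toFinite E).measurableSet
    rw [measureReal_def, ProbabilityTheory.cond_apply hE, ENNReal.toReal_mul,
      ENNReal.toReal_inv] at hle
    have hpos : 0 < (μ E).toReal := ENNReal.toReal_pos h0 (measure_ne_top _ _)
    rw [inv_mul_le_iff₀ hpos, mul_comm] at hle
    exact hle

variable {V : Type*} [Fintype V] [LinearOrder V] {k : V → Block}

lemma toGraph_mem_revealEvent_iff {W : Type*} [Fintype W] [DecidableEq W] (ω ω₀ : Config W)
    (A : Finset W) :
    toGraph ω ∈ revealEvent (A : Set W) ((toGraph ω₀).induce (A : Set W))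
      (fun a => (((toGraph ω₀).neighborSet a).ncard : ZMod 2))
      ((toGraph ω₀).edgeSet.ncard : ZMod 2) ↔
    (∀ u ∈ A, ∀ v ∈ A, bit ω u v = bit ω₀ u v) ∧
    (∀ v ∈ A, degIn (bit ω) Finset.univ v = degIn (bit ω₀) Finset.univ v) ∧
    edgesIn ω Finset.univ = edgesIn ω₀ Finset.univ := by
  have hdeg : ∀ (ω : Config W) v,
      (((toGraph ω).neighborSet v).ncard : ZMod 2) = degIn (bit ω) Finset.univ v := by
    intro ω v
    rw [(isAdjMatrix_toGraph ω).degIn_eq]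
    simp
  unfold revealEvent
  rw [Set.mem_ofPred_eq]
  refine and_congr ?_ (and_congr ?_ ?_)
  · constructor
    · intro h u hu v hv
      have h1 : bit ω u v = 1 ↔ bit ω₀ u v = 1 := by
        have := congrArg (fun G => G.Adj ⟨u, hu⟩ ⟨v, hv⟩) h
        exact Iff.of_eq this
      rcases zmod_two_cases (bit ω u v) with h2 | h2 <;>
        rcases zmod_two_cases (bit ω₀ u v) with h3 | h3 <;> simp_all
    · intro h
      ext u v
      change bit ω u v = 1 ↔ bit ω₀ u v = 1
      rw [h u u.2 v v.2]
  · simp only [hdeg, Subtype.forall, Finset.mem_coe]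
  · rw [ncard_edgeSet_toGraph, ncard_edgeSet_toGraph]

/-- The hypothesis of `expect_info_le` for the leftover set `q i ∪ A'`. -/
lemma expect_sameReveal_le (α : ℝ) (p : unitInterval) (hp1 : p < 1) (i : Bool) (A' : Finset V)
    {n : ℕ} (φ : Fin n ↪ V) (hφ : Finset.univ.map φ = block k (.q i) ∪ A') (ω₀ : Config V)
    (hA : (A'.card : ℝ) ≤ (n : ℝ) ^ (1 - 2 * α)) :
    expect (letterWeight p) (fun ω => ind (SameReveal k i A' ω₀ ω ∧
        ¬EvenDegenerate (toGraph (pull φ ω)))) ≤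
      worstFailureProb α p n *
        expect (letterWeight p) (fun ω => ind (SameReveal k i A' ω₀ ω)) := by
  classical
  let A : Finset (Fin n) := Finset.univ.filter fun v => φ v ∈ A'
  have hAmap : A.map φ = A' := by
    ext x
    simp only [A, Finset.mem_map, Finset.mem_filter, Finset.mem_univ, true_and]
    constructor
    · rintro ⟨v, hv, rfl⟩; exact hv
    · intro hx
      have : x ∈ Finset.univ.map φ := by rw [hφ]; exact Finset.mem_union_right _ hx
      obtain ⟨v, -, rfl⟩ := Finset.mem_map.1 this
      exact ⟨v, hx, rfl⟩
  have hiff : ∀ ω, SameReveal k i A' ω₀ ω ↔ toGraph (pull φ ω) ∈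
      revealEvent (A : Set (Fin n)) ((toGraph (pull φ ω₀)).induce (A : Set (Fin n)))
      (fun a => (((toGraph (pull φ ω₀)).neighborSet a).ncard : ZMod 2))
      ((toGraph (pull φ ω₀)).edgeSet.ncard : ZMod 2) := by
    intro ω
    rw [toGraph_mem_revealEvent_iff, edgesIn_pull, edgesIn_pull, hφ]
    simp only [degIn_pull, bit_pull, hφ]
    unfold SameReveal
    refine and_congr ?_ (and_congr ?_ Iff.rfl)
    · conv_lhs => rw [← hAmap]
      simp only [Finset.forall_mem_map]
    · rw [show (∀ v ∈ A', _) ↔ ∀ v ∈ A.map φ, _ by rw [hAmap]]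
      simp only [Finset.forall_mem_map]
  have h1 := real_inter_le_worstFailureProb α p hp1 (A : Set (Fin n))
    ((toGraph (pull φ ω₀)).induce (A : Set (Fin n)))
    (fun a => (((toGraph (pull φ ω₀)).neighborSet a).ncard : ZMod 2))
    ((toGraph (pull φ ω₀)).edgeSet.ncard : ZMod 2) (by
      rw [Set.ncard_coe_finset, ← Finset.card_map φ, hAmap]; exact hA)
  rw [← expect_toGraph_pull_mem φ p, ← expect_toGraph_pull_mem φ p] at h1
  simp only [hiff]
  exact h1

end Bound

/-! ### Summation over the values of the revealed information -/

section Good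

variable {V : Type*} [Fintype V] [LinearOrder V] (k : V → Block)

/-- Both attempts to eliminate everything except a `q`-block and `K` of its helpers succeed, and
the raised flags link the two `q`-blocks. -/
def Good (K : ℕ) (ω : Config V) : Prop :=
  Linked k ω ∧ ∀ i, ∃ A' ⊆ block k (.h i), A'.card = K ∧
    Reach (Allowed k i) (bit ω) Finset.univ (block k (.q i) ∪ A')

variable {k}

lemma Linked.of_info_eq {ω ω' : Config V} (h : info k ω = info k ω') (hL : Linked k ω) :
    Linked k ω' := by
  obtain ⟨-, -, -, -, h5⟩ := info_eq_iff.1 h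
  obtain ⟨i₀, hi₀, h1, h2⟩ := hL
  refine ⟨i₀, hi₀, fun v hv hne => ?_, fun j hj => ?_⟩
  · obtain ⟨j, hj, hf1, hf2⟩ := h1 v hv hne
    exact ⟨j, hj, by rw [← h5 j i₀ hj hi₀, hf1], by rw [← h5 j v hj hv, hf2]⟩
  · obtain ⟨v, hv, hf⟩ := h2 j hj
    exact ⟨v, hv, by rw [← h5 j v hj hv, hf]⟩

lemma Good.of_info_eq {K : ℕ} {ω ω' : Config V} (h : info k ω = info k ω') (hG : Good k K ω) :
    Good k K ω' :=
  ⟨hG.1.of_info_eq h, fun i => by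
    obtain ⟨A', hA', hc, hr⟩ := hG.2 i
    exact ⟨A', hA', hc, hr.of_info_eq h⟩⟩

/-- When both attempts succeed, the revealed information determines the information on which a
partially revealed graph is conditioned: the total number of edges has the parity of the number
of edges of a leftover graph. -/
lemma Good.mem_revealEvent {K : ℕ} {ω ω' : Config V} (h : info k ω = info k ω')
    (hG : Good k K ω) {H : SimpleGraph (block k .a : Set V)}
    {s : (block k .a : Set V) → ZMod 2} {t : ZMod 2}
    (hR : toGraph ω ∈ revealEvent (block k .a : Set V) H s t) :
    toGraph ω' ∈ revealEvent (block k .a : Set V) H s t := by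
  obtain ⟨rfl, hs, rfl⟩ := hR
  obtain rfl : (fun a : (block k .a : Set V) =>
      (((toGraph ω).neighborSet a).ncard : ZMod 2)) = s := funext hs
  obtain ⟨hb, -, -, -, -⟩ := info_eq_iff.1 h.symm
  refine (toGraph_mem_revealEvent_iff ω' ω (block k .a)).2 ⟨fun u hu v hv => ?_,
    fun v hv => ?_, ?_⟩
  · exact hb u v (by rw [mem_block.1 hu, mem_block.1 hv]; rfl)
  · exact degIn_congr_of_known hb fun u _ => by rw [mem_block.1 hv]; rfl
  · choose A' hA' _ hr using hG.2
    have hsame := (info_eq_iff_same hA').1 h.symm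
    rw [((hr true).of_info_eq h).edgesIn_eq, (hr true).edgesIn_eq]
    exact hsame.1.2.1.2.2

/-- When an attempt succeeds in a graph that is not even-degenerate, the leftover graph is not
even-degenerate either. -/
lemma not_evenDegenerate_pull {P : Finset V → V → Prop} {ω : Config V} {S : Finset V} {n : ℕ}
    (hr : Reach P (bit ω) Finset.univ S) (φ : Fin n ↪ V) (hφ : Finset.univ.map φ = S)
    (hED : ¬EvenDegenerate (toGraph ω)) : ¬EvenDegenerate (toGraph (pull φ ω)) := by
  intro h
  obtain ⟨S', hS', hr'⟩ := h.exists_reach (a := bit ω) φ fun u v => by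
    have := isAdjMatrix_toGraph (pull φ ω) u v
    rwa [bit_pull] at this
  rw [hφ] at hr'
  exact hED (evenDegenerate_of_reach (isAdjMatrix_toGraph ω)
    ((hr.mono fun _ _ _ => trivial).trans hr') hS')

omit [Fintype V] [LinearOrder V] in
lemma dependsOnlyOn_evenDegenerate_pull [DecidableEq V] {n : ℕ} (φ : Fin n ↪ V) {S : Finset V}
    (hφ : Finset.univ.map φ = S) :
    DependsOnlyOn (pairsIn S) fun ω => ¬EvenDegenerate (toGraph (pull φ ω)) := by
  intro x y h
  have : pull φ x = pull φ y := by
    ext1 e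
    induction e with
    | _ u v =>
      exact h _ (Finset.mk_mem_sym2_iff.2 ⟨by rw [← hφ]; simp, by rw [← hφ]; simp⟩)
  simp only [this]

omit [Fintype V] in
lemma exists_embedding_map_eq (S : Finset V) {n : ℕ} (h : S.card = n) :
    ∃ φ : Fin n ↪ V, Finset.univ.map φ = S :=
  ⟨(S.orderEmbOfFin h).toEmbedding, by
    ext x
    simp⟩

/-- Given the success of both attempts, the graph fails to be even-degenerate with probability
at most the square of the worst failure probability of a leftover graph. -/
theorem expect_good_le (α : ℝ) (p : unitInterval) (hp1 : p < 1) {K m : ℕ}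
    (hm : ∀ i, (block k (.q i)).card = m) (hK : (K : ℝ) ≤ ((m + K : ℕ) : ℝ) ^ (1 - 2 * α))
    (H : SimpleGraph (block k .a : Set V)) (s : (block k .a : Set V) → ZMod 2) (t : ZMod 2) :
    expect (letterWeight p) (fun ω => ind ((toGraph ω ∈ revealEvent (block k .a : Set V) H s t ∧
        Good k K ω) ∧ ¬EvenDegenerate (toGraph ω))) ≤
      worstFailureProb α p (m + K) ^ 2 * expect (letterWeight p) (fun ω =>
        ind (toGraph ω ∈ revealEvent (block k .a : Set V) H s t ∧ Good k K ω)) := by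
  classical
  have hw := isProbVec_letterWeight.2 ⟨p.2.1, p.2.2⟩
  set R : Config V → Prop := fun ω =>
    toGraph ω ∈ revealEvent (block k .a : Set V) H s t ∧ Good k K ω with hRdef
  have hRinfo : ∀ ω ω', info k ω = info k ω' → (R ω ↔ R ω') := fun ω ω' h =>
    ⟨fun hR => ⟨hR.2.mem_revealEvent h hR.1, hR.2.of_info_eq h⟩,
      fun hR => ⟨hR.2.mem_revealEvent h.symm hR.1, hR.2.of_info_eq h.symm⟩⟩
  let Y := Finset.univ.image (info k)
  have hsum : ∀ P : Config V → Prop, expect (letterWeight p) (fun ω => ind (P ω)) =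
      ∑ y ∈ Y, expect (letterWeight p) (fun ω => ind (info k ω = y ∧ P ω)) := by
    intro P
    rw [← expect_sum]
    congr 1
    ext ω
    simp only [ind_and]
    rw [← Finset.sum_mul]
    have h1 : ∑ y ∈ Y, ind (info k ω = y) = 1 := by
      rw [Finset.sum_eq_single (info k ω) (fun y _ hy => ind_of_false hy.symm)
        (fun h => absurd (Finset.mem_image_of_mem _ (Finset.mem_univ _)) h), ind_of_true rfl]
    rw [h1, one_mul]
  rw [hsum, hsum R, Finset.mul_sum]
  refine Finset.sum_le_sum fun y hy => ?_
  obtain ⟨ω₀, -, rfl⟩ := Finset.mem_image.1 hy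
  by_cases hR : R ω₀
  · obtain ⟨-, hL, hG⟩ := id hR
    choose A' hA' hc hr using hG
    have hcard : ∀ i, (block k (.q i) ∪ A' i).card = m + K := fun i => by
      rw [Finset.card_union_of_disjoint
        ((disjoint_block k (by simp)).mono_right (hA' i)), hm, hc]
    choose φ hφ using fun i => exists_embedding_map_eq _ (hcard i)
    refine (expect_mono hw fun ω => ?_).trans ((expect_info_le p.2.1 p.2.2 hA' hL
      (fun i ω => ¬EvenDegenerate (toGraph (pull (φ i) ω)))
      (fun i => dependsOnlyOn_evenDegenerate_pull (φ i) (hφ i))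
      (f := worstFailureProb α p (m + K))
      (fun i => expect_sameReveal_le α p hp1 i (A' i) (φ i) (hφ i) ω₀ (by rw [hc]; exact hK)))
      |>.trans (mul_le_mul_of_nonneg_left (expect_mono hw fun ω => ?_) (sq_nonneg _)))
    · refine ind_mono fun h => ⟨h.1, ?_, ?_⟩ <;>
        exact not_evenDegenerate_pull ((hr _).of_info_eq h.1.symm) _ (hφ _) h.2.2
    · exact ind_mono fun h => ⟨h, (hRinfo _ _ h).2 hR⟩
  · have hno : ∀ ω, ¬(info k ω = info k ω₀ ∧ R ω) := fun ω h => hR ((hRinfo _ _ h.1).1 h.2)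
    have h1 : ∀ ω, ind (info k ω = info k ω₀ ∧ R ω ∧ ¬EvenDegenerate (toGraph ω)) = 0 :=
      fun ω => ind_of_false fun h => hno ω ⟨h.1, h.2.1⟩
    have h2 : ∀ ω, ind (info k ω = info k ω₀ ∧ R ω) = 0 := fun ω => ind_of_false (hno ω)
    rw [funext h1, funext h2, expect_const hw, mul_zero]

end Good

/-! ### The elimination process with random initial parities -/

section RandomParities

/-- The law of a fair coin. -/
noncomputable def fairWeight : ZMod 2 → ℝ := fun _ => 1 / 2

lemma sum_fairWeight (f : ZMod 2 → ℝ) : ∑ b, fairWeight b * f b = (f 0 + f 1) / 2 := by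
  have h : ∑ b, fairWeight b * f b = fairWeight 0 * f 0 + fairWeight 1 * f 1 :=
    Fin.sum_univ_two fun b : Fin 2 => fairWeight b * f b
  rw [h]
  unfold fairWeight
  ring

lemma isProbVec_fairWeight : IsProbVec fairWeight := by
  refine ⟨fun _ => by unfold fairWeight; norm_num, ?_⟩
  have := sum_fairWeight fun _ => 1
  simpa using this

lemma expect_fairWeight_add {ι : Type*} [Fintype ι] [DecidableEq ι] (s : ι → ZMod 2)
    (F : (ι → ZMod 2) → ℝ) :
    expect fairWeight (fun x => F (x + s)) = expect fairWeight F :=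
  expect_comp_equiv (Equiv.addRight s) (fun _ => by simp [fairWeight]) F

/-- Decoupling for a function of two independent families. -/
lemma expect_decouple₂ {ι β ι' β' : Type*} [Fintype ι] [DecidableEq ι] [Fintype β] [Fintype ι']
    [DecidableEq ι'] [Fintype β'] {w : β → ℝ} {w' : β' → ℝ} (hw : IsProbVec w)
    (hw' : IsProbVec w') (S : Set ι) (S' : Set ι')
    (g : (ι → β) → (ι' → β') → (ι → β) → (ι' → β') → ℝ)
    (h1 : ∀ x x' s s' y t, (∀ i ∉ S, x i = x' i) → (∀ i ∉ S', s i = s' i) →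
      g x s y t = g x' s' y t)
    (h2 : ∀ x s y y' t t', (∀ i ∈ S, y i = y' i) → (∀ i ∈ S', t i = t' i) →
      g x s y t = g x s y' t') :
    expect w (fun x => expect w' fun s => g x s x s) =
      expect w fun x => expect w' fun s => expect w fun y => expect w' fun t => g x s y t := by
  have e1 : ∀ x, expect w' (fun s => g x s x s) =
      expect w' fun t => expect w' fun s => g x s x t := fun x =>
    expect_decouple hw' S' (fun s t => g x s x t)
      (fun t s s' h => h1 _ _ _ _ _ _ (fun _ _ => rfl) h)
      (fun s t t' h => h2 _ _ _ _ _ _ (fun _ _ => rfl) h)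
  rw [funext e1, expect_decouple hw S
    (fun x y => expect w' fun t => expect w' fun s => g x s y t), expect_comm]
  · congr 1
    ext x
    rw [← expect_comm w w']
    congr 1
    ext y
    rw [expect_comm]
  · intro y x x' h
    simp only [h1 x x' _ _ y _ h fun _ _ => rfl]
  · intro x y y' h
    simp only [h2 x _ y y' _ _ h fun _ _ => rfl]

variable {V : Type*} [Fintype V] [LinearOrder V]

omit [LinearOrder V] in
lemma expect_potential_fairWeight [DecidableEq V] (π : ℝ) (U : Finset V) :
    expect fairWeight (fun c : V → ZMod 2 => potential π U c) = (1 - π / 2) ^ U.card := by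
  unfold potential
  rw [expect_prod_indep isProbVec_fairWeight U (fun u => {u})
    (fun u (c : V → ZMod 2) => if c u = 0 then 1 - π else 1)]
  · rw [Finset.prod_congr rfl fun u _ => expect_coord isProbVec_fairWeight u
      fun b => if b = 0 then 1 - π else 1]
    rw [sum_fairWeight, Finset.prod_const]
    congr 1
    rw [if_pos rfl, if_neg one_ne_zero]
    ring
  · intro u _ x y h
    simp only [h u rfl]
  · intro u _ v _ huv
    simpa using huv

/-- The process with helpers `U₀` fails with small probability if the initial parities are uniform,
up to a shift, and if the targets, the parity function and the weight `I` involve neither the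
parities of the helpers nor the edges at them. -/
theorem expect_mul_not_win_le {p : ℝ} (h0 : 0 ≤ p) (h1 : p ≤ 1) {K : ℕ} {U₀ : Finset V}
    (I : Config V → (V → ZMod 2) → ℝ) (hI : ∀ x s, 0 ≤ I x s)
    (par : Config V → (V → ZMod 2) → List V → Finset V → (V → ZMod 2) → ZMod 2)
    (T : Config V → (V → ZMod 2) → List V) (D : Config V → (V → ZMod 2) → Finset V)
    (hdep : ∀ x x' s s', (∀ e : Sym2 V, (∀ u ∈ U₀, u ∉ e) → x e = x' e) →
      (∀ v ∉ U₀, s v = s' v) →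
      I x s = I x' s' ∧ par x s = par x' s' ∧ T x s = T x' s' ∧ D x s = D x' s')
    (hT : ∀ x s, (T x s).Nodup ∧ (∀ t ∈ T x s, t ∉ U₀) ∧ K + (T x s).length ≤ U₀.card) :
    expect (letterWeight p) (fun ω => expect fairWeight fun s => I ω s *
        ind (¬Win (·.card = K) (par ω s) U₀ (bit ω) U₀
          (fun u => s u + ∑ v ∈ D ω s, bit ω u v) (T ω s))) ≤
      (3 * U₀.card + 1) * (1 - min p (1 - p) ^ 2) ^ K *
        expect (letterWeight p) (fun ω => expect fairWeight fun s => I ω s) := by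
  have hw := isProbVec_letterWeight.2 ⟨h0, h1⟩
  have hf := isProbVec_fairWeight
  set π := min p (1 - p) with hπ
  have hπ0 : 0 ≤ π := le_min h0 (by linarith)
  have hπ2 : π ≤ 1 / 2 := by
    have := min_le_left p (1 - p)
    have := min_le_right p (1 - p)
    linarith
  set r := 1 - π ^ 2 with hr
  have hr0 : 0 ≤ r := by rw [hr]; nlinarith
  have hr1 : r ≤ 1 := by rw [hr]; nlinarith
  have hwin : ∀ x s s' y y' (c c' : V → ZMod 2), (∀ i ∈ {e : Sym2 V | ∃ u ∈ U₀, u ∈ e},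
      y i = y' i) → (∀ u ∈ U₀, c u = c' u) →
      Win (·.card = K) (par x s) U₀ (bit y) U₀ c (T x s') →
      Win (·.card = K) (par x s) U₀ (bit y') U₀ c' (T x s') := by
    intro x s s' y y' c c' hy hc h
    have hb : ∀ v, ∀ u ∈ U₀, bit y v u = bit y' v u := fun v u hu =>
      bit_congr (hy _ ⟨u, hu, Sym2.mem_mk_right v u⟩)
    exact h.congr subset_rfl hc (fun u _ v hv _ => hb u v hv) fun t _ u hu => hb t u hu
  rw [expect_decouple₂ hw hf {e : Sym2 V | ∃ u ∈ U₀, u ∈ e} (U₀ : Set V)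
    (fun x s y t => I x s * ind (¬Win (·.card = K) (par x s) U₀ (bit y) U₀
      (fun u => t u + ∑ v ∈ D x s, bit y u v) (T x s))), ← expect_const_mul]
  · refine expect_mono hw fun x => ?_
    rw [← expect_const_mul]
    refine expect_mono hf fun s => ?_
    obtain ⟨hT1, hT2, hT3⟩ := hT x s
    -- For a fixed second configuration the shift of the parities is harmless.
    have hshift : ∀ y : Config V, expect fairWeight (fun t : V → ZMod 2 => I x s *
        ind (¬Win (·.card = K) (par x s) U₀ (bit y) U₀
          (fun u => t u + ∑ v ∈ D x s, bit y u v) (T x s))) =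
        I x s * expect fairWeight fun t : V → ZMod 2 =>
          ind (¬Win (·.card = K) (par x s) U₀ (bit y) U₀ t (T x s)) := fun y => by
      rw [expect_const_mul]
      congr 1
      exact expect_fairWeight_add (fun u => ∑ v ∈ D x s, bit y u v) fun t =>
        ind (¬Win (·.card = K) (par x s) U₀ (bit y) U₀ t (T x s))
    rw [funext hshift, expect_const_mul, expect_comm, mul_comm]
    refine mul_le_mul_of_nonneg_right ?_ (hI x s)
    refine (expect_mono hf fun t => expect_not_win_le h0 h1 K (par x s) U₀ (T x s) U₀ t hT1 hT2
      subset_rfl hT3).trans ?_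
    rw [expect_add, expect_const hf, expect_potential_fairWeight]
    have hb : (1 - π / 2) ^ U₀.card ≤ r ^ K := by
      refine (pow_le_pow_left₀ (by linarith) (?_ : 1 - π / 2 ≤ r) _).trans
        (pow_le_pow_of_le_one hr0 hr1 (by omega))
      rw [hr]
      nlinarith
    have hl : ((T x s).length : ℝ) ≤ U₀.card := by exact_mod_cast (by omega)
    have hrK : 0 ≤ r ^ K := pow_nonneg hr0 K
    nlinarith
  · intro x x' s s' y t hx hs
    obtain ⟨e1, e2, e3, e4⟩ := hdep x x' s s' (fun e he => hx e fun ⟨u, hu, hue⟩ => he u hu hue)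
      (fun v hv => hs v hv)
    simp only [e1, e2, e3, e4]
  · intro x s y y' t t' hy ht
    have hc : ∀ u ∈ U₀, t u + ∑ v ∈ D x s, bit y u v = t' u + ∑ v ∈ D x s, bit y' u v := by
      intro u hu
      rw [ht u hu]
      congr 1
      exact Finset.sum_congr rfl fun v _ => bit_congr (hy _ ⟨u, hu, Sym2.mem_mk_left u v⟩)
    congr 2
    refine congrArg Not (propext ⟨hwin x s s y y' _ _ hy hc, hwin x s s y' y _ _
      (fun i hi => (hy i hi).symm) fun u hu => (hc u hu).symm⟩)

end RandomParities

/-! ### Eliminating everything except a `q`-block and some of its helpers -/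

section Attempt

variable {V : Type*} [Fintype V] [LinearOrder V] (k : V → Block)

/-- The targets of an attempt to keep `q i`: the revealed part, the rest `W` of the other helpers,
and the other `q`-block in increasing order. -/
noncomputable def targets (i : Bool) (W : Finset V) : List V :=
  ((block k .a).toList ++ W.toList) ++ (block k (.q !i)).sort

/-- The degree parity of the first target when the helpers `U ⊆ h i`, the targets on the list and
`q i` are left, in terms of the parities `s` of the full degrees of the vertices outside
the `q`-blocks and of the row `col` of the target. -/
def targetPar (i : Bool) (a : V → V → ZMod 2) (s : V → ZMod 2) :
    List V → Finset V → (V → ZMod 2) → ZMod 2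
  | [], _, _ => 0
  | t :: T, U, col =>
    if k t = .q !i then
      ∑ u ∈ U, col u + degIn a (block k (.q i) ∪ (block k (.q !i)).filter (t ≤ ·)) t
    else if k t = .h i ∨ k t = .q i then 0
    else s t + (degIn a ((block k .a ∪ block k (.h !i)) \ (t :: T).toFinset) t +
      ∑ u ∈ block k (.h i) \ U, col u)

variable {k} {i : Bool} {W : Finset V}

lemma mem_targets {t : V} : t ∈ targets k i W ↔ k t = .a ∨ t ∈ W ∨ k t = .q !i := by
  simp [targets]

lemma nodup_targets (hW : W ⊆ block k (.h !i)) : (targets k i W).Nodup := by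
  refine List.nodup_append'.2 ⟨List.nodup_append'.2 ⟨Finset.nodup_toList _, Finset.nodup_toList _,
    ?_⟩, Finset.sort_nodup _ _, ?_⟩
  · intro v hv hv'
    rw [Finset.mem_toList, mem_block] at hv
    have := mem_block.1 (hW (Finset.mem_toList.1 hv'))
    rw [hv] at this
    simp at this
  · intro v hv hv'
    rw [Finset.mem_sort, mem_block] at hv'
    rw [List.mem_append, Finset.mem_toList, Finset.mem_toList, mem_block] at hv
    rcases hv with hv | hv
    · rw [hv] at hv'; simp at hv'
    · have := mem_block.1 (hW hv)
      rw [hv'] at this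
      simp at this

lemma length_targets : (targets k i W).length =
    (block k .a).card + W.card + (block k (.q !i)).card := by
  simp [targets, add_assoc]

/-- The targets left when `t` is the first one. -/
lemma mem_of_suffix_targets (hW : W ⊆ block k (.h !i)) {t : V} {T : List V}
    (hs : t :: T <:+ targets k i W) :
    (k t = .q !i → ∀ u, u ∈ t :: T ↔ k u = .q !i ∧ t ≤ u) ∧
    (k t ≠ .q !i → ∀ u, k u = .q !i → u ∈ t :: T) := by
  set X := (block k .a).toList ++ W.toList with hX
  set Y := (block k (.q !i)).sort with hY
  have hXq : ∀ v ∈ X, k v ≠ .q !i := by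
    intro v hv
    rw [hX, List.mem_append, Finset.mem_toList, Finset.mem_toList, mem_block] at hv
    rcases hv with hv | hv
    · rw [hv]; simp
    · rw [mem_block.1 (hW hv)]; simp
  have hYq : ∀ v, v ∈ Y ↔ k v = .q !i := fun v => by rw [hY, Finset.mem_sort, mem_block]
  have hcases : (∀ u ∈ Y, u ∈ t :: T) ∧ k t ≠ .q !i ∨ t :: T <:+ Y := by
    obtain ⟨pre, hpre⟩ := hs
    have hpre' : pre ++ t :: T = X ++ Y := hpre
    rcases List.append_eq_append_iff.1 hpre' with
      ⟨c, hc1, hc2⟩ | ⟨c, hc1, hc2⟩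
    · cases c with
      | nil => exact Or.inr ⟨[], by simpa using hc2⟩
      | cons x c =>
        refine Or.inl ⟨fun u hu => by rw [hc2]; simp [hu], hXq t ?_⟩
        have : t = x := by simpa using congrArg List.head? hc2
        rw [hc1, this]
        simp
    · exact Or.inr ⟨c, hc2.symm⟩
  rcases hcases with ⟨h1, h2⟩ | h
  · exact ⟨fun h => absurd h h2, fun _ u hu => h1 u ((hYq u).2 hu)⟩
  · have htY : k t = .q !i := (hYq t).1 (h.subset (by simp))
    refine ⟨fun _ u => ?_, fun h => absurd htY h⟩
    obtain ⟨pre, hpre⟩ := h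
    have hsort : (pre ++ t :: T).Pairwise (· < ·) := by
      rw [hpre]
      exact (Finset.sortedLT_sort _).pairwise
    rw [List.pairwise_append, List.pairwise_cons] at hsort
    rw [← hYq, ← hpre]
    constructor
    · intro hu
      refine ⟨by simp only [List.mem_append]; exact Or.inr hu, ?_⟩
      rcases List.mem_cons.1 hu with rfl | hu
      · exact le_rfl
      · exact (hsort.2.1.1 u hu).le
    · rintro ⟨hu, htu⟩
      rcases List.mem_append.1 hu with hu | hu
      · exact absurd (hsort.2.2 u hu t (by simp)) (not_lt.2 htu)
      · exact hu

/-- If the other helpers can be reduced to `W` and the process then wins, the attempt to keep `q i`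
succeeds. -/
lemma exists_reach_of_win {ω : Config V} {s : V → ZMod 2} {K : ℕ}
    {par : List V → Finset V → (V → ZMod 2) → ZMod 2}
    (hs : ∀ v, (∀ j, k v ≠ .q j) → s v = degIn (bit ω) Finset.univ v)
    (hW : W ⊆ block k (.h !i))
    (h0 : Win (· = W) par (block k (.h !i)) (bit ω) (block k (.h !i)) s [])
    (h1 : Win (·.card = K) (targetPar k i (bit ω) s) (block k (.h i)) (bit ω) (block k (.h i))
      (fun u => s u + ∑ v ∈ block k (.h !i) \ W, bit ω u v) (targets k i W)) :
    ∃ A' ⊆ block k (.h i), A'.card = K ∧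
      Reach (Allowed k i) (bit ω) Finset.univ (block k (.q i) ∪ A') := by
  have hkW : ∀ v ∈ W, k v = .h !i := fun v hv => mem_block.1 (hW hv)
  have hsh : ∀ j, ∀ v ∈ block k (.h j), s v = degIn (bit ω) Finset.univ v := fun j v hv =>
    hs v fun l => by rw [mem_block.1 hv]; simp
  -- The other helpers are reduced to `W` while everything else is present.
  have hfirst : Reach (Allowed k i) (bit ω) Finset.univ (W ∪ (block k (.h !i))ᶜ) := by
    obtain ⟨U', -, rfl, hr⟩ := h0.exists_reach (P := Allowed k i) (D := (block k (.h !i))ᶜ)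
      (bit_comm ω) List.nodup_nil (by simp) disjoint_compl_right (by simp)
      (fun u hu => by
        rw [hsh _ u hu]
        congr 1
        simp)
      (fun _ _ t T hT => by simp at hT)
      (fun U' hU' L hL v hv => by
        have hsub : ∀ j, block k (.q j) ⊆ U' ∪ L.toFinset ∪ (block k (.h !i))ᶜ := fun j u hu => by
          rw [mem_block] at hu
          simp [hu]
        have hkv := mem_block.1 (hU' hv)
        exact ⟨hsub i, by simp [hkv], fun _ => hsub _, fun h => by simp [hkv] at h⟩)
      (fun _ _ t T hT => by simp at hT)
    simpa using hr
  have hdisj : Disjoint (block k (.h i)) (block k (.q i)) := disjoint_block k (by simp)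
  have hset : block k (.h i) ∪ (targets k i W).toFinset ∪ block k (.q i) =
      W ∪ (block k (.h !i))ᶜ := by
    ext v
    have h2 : v ∈ W → k v = .h !i := hkW v
    simp only [Finset.mem_union, List.mem_toFinset, mem_targets, mem_block, Finset.mem_compl]
    cases hkv : k v with
    | a => simp
    | h j => revert h2; cases i <;> cases j <;> simp [hkv]
    | q j => cases i <;> cases j <;> simp
  have hTmem : ∀ t ∈ targets k i W, k t ≠ .h i ∧ k t ≠ .q i := by
    intro t ht
    rcases mem_targets.1 ht with h | h | h
    · simp [h]
    · rw [hkW t h]; cases i <;> simp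
    · rw [h]; cases i <;> simp
  obtain ⟨A', hA', hc, hr⟩ := h1.exists_reach (P := Allowed k i) (D := block k (.q i))
    (bit_comm ω) (nodup_targets hW) (fun t ht h => (hTmem t ht).1 (mem_block.1 h)) hdisj
    (fun t ht h => (hTmem t ht).2 (mem_block.1 h)) (by
      intro u hu
      rw [hset, hsh _ u hu]
      have huniv : (Finset.univ : Finset V) =
          (W ∪ (block k (.h !i))ᶜ) ∪ (block k (.h !i) \ W) := by
        ext v
        simp only [Finset.mem_univ, Finset.mem_union, Finset.mem_compl, Finset.mem_sdiff, true_iff]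
        tauto
      have hd : Disjoint (W ∪ (block k (.h !i))ᶜ) (block k (.h !i) \ W) := by
        rw [Finset.disjoint_left]
        intro v hv hv'
        simp only [Finset.mem_union, Finset.mem_compl, Finset.mem_sdiff] at hv hv'
        tauto
      rw [huniv, degIn_union _ hd, add_assoc]
      unfold degIn
      rw [CharTwo.add_self_eq_zero, add_zero]) (by
      intro U' hU' t T hT
      have hrow : ∀ S ⊆ block k (.h i), ∑ u ∈ S, rowOn (bit ω) (block k (.h i)) t u =
          degIn (bit ω) S t := fun S hS => Finset.sum_congr rfl fun u hu => if_pos (hS hu)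
      have ht := hTmem t (hT.subset (by simp))
      obtain ⟨hm1, hm2⟩ := mem_of_suffix_targets hW hT
      simp only [targetPar]
      by_cases hq : k t = .q !i
      · rw [if_pos hq, hrow U' hU', ← degIn_union]
        · congr 1
          ext u
          have := hm1 hq u
          simp only [Finset.mem_union, Finset.mem_filter, mem_block, List.mem_toFinset, this]
          tauto
        · rw [Finset.disjoint_left]
          intro u hu hu'
          have hku := mem_block.1 (hU' hu)
          simp [hku] at hu'
      · rw [if_neg hq, if_neg (not_or.2 ht), hrow _ Finset.sdiff_subset]
        have hst : s t = degIn (bit ω) Finset.univ t := by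
          refine hs t fun j => ?_
          by_cases hj : j = i
          · rw [hj]; exact ht.2
          · obtain rfl : j = !i := by cases i <;> cases j <;> simp_all
            exact hq
        have hTk : ∀ u ∈ t :: T, k u ≠ .h i ∧ k u ≠ .q i := fun u hu => hTmem u (hT.subset hu)
        have huniv : (Finset.univ : Finset V) = (U' ∪ (t :: T).toFinset ∪ block k (.q i)) ∪
            ((block k .a ∪ block k (.h !i)) \ (t :: T).toFinset ∪ (block k (.h i) \ U')) := by
          ext v
          have h3 := hm2 hq v
          simp only [Finset.mem_univ, Finset.mem_union, Finset.mem_sdiff, List.mem_toFinset,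
            mem_block, true_iff]
          cases hkv : k v with
          | a => simp; tauto
          | h j => cases i <;> cases j <;> simp <;> tauto
          | q j => rw [hkv] at h3; revert h3; cases i <;> cases j <;> simp <;> tauto
        have hd1 : Disjoint (U' ∪ (t :: T).toFinset ∪ block k (.q i))
            ((block k .a ∪ block k (.h !i)) \ (t :: T).toFinset ∪ (block k (.h i) \ U')) := by
          rw [Finset.disjoint_left]
          intro v hv hv'
          simp only [Finset.mem_union, Finset.mem_sdiff, List.mem_toFinset, mem_block] at hv hv'
          have h4 : v ∈ U' → k v = .h i := fun h => mem_block.1 (hU' h)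
          have h5 := hTk v
          rcases hv with (hv | hv) | hv
          · rw [h4 hv] at hv'
            revert hv'
            cases i <;> simp [hv]
          · have := h5 hv
            tauto
          · rw [hv] at hv'
            revert hv'
            cases i <;> simp
        have hd2 : Disjoint ((block k .a ∪ block k (.h !i)) \ (t :: T).toFinset)
            (block k (.h i) \ U') := by
          refine Finset.disjoint_of_subset_left Finset.sdiff_subset
            (Finset.disjoint_of_subset_right Finset.sdiff_subset ?_)
          rw [Finset.disjoint_union_left]
          exact ⟨disjoint_block k (by simp), disjoint_block k (by simp)⟩
        rw [hst, ← degIn_union _ hd2]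
        nth_rewrite 1 [huniv]
        rw [degIn_union _ hd1, add_assoc, CharTwo.add_self_eq_zero, add_zero])
    (by
      intro U' hU' L hL v hv
      have hkv := mem_block.1 (hU' hv)
      exact ⟨Finset.subset_union_right, by simp [hkv],
        fun h => by rw [hkv] at h; simp at h, fun h => by rw [hkv] at h; simp at h⟩)
    (by
      intro U' hU' t T hT
      have ht := hTmem t (hT.subset (by simp))
      obtain ⟨hm1, hm2⟩ := mem_of_suffix_targets hW hT
      refine ⟨Finset.subset_union_right, ht.2, fun h => ?_, fun h => ⟨fun u hu hku => ?_,
        fun u hu => ?_⟩⟩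
      · intro u hu
        have := hm2 (by rw [h]; simp) u (mem_block.1 hu)
        simp only [Finset.mem_union, List.mem_toFinset]
        exact Or.inl (Or.inr this)
      · simp only [Finset.mem_union, List.mem_toFinset, mem_block] at hu
        rcases hu with (hu | hu) | hu
        · have := mem_block.1 (hU' hu)
          rw [hku] at this
          simp at this
        · have := ((hm1 h u).1 hu).1
          rw [hku] at this
          simp at this
        · rw [hku] at hu
          simp at hu
      · simp only [Finset.mem_union, List.mem_toFinset, mem_block, hm1 h u]
        have h4 : u ∉ U' := fun h => by
          have := mem_block.1 (hU' h)
          rw [hu] at this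
          simp at this
        simp [h4, hu])
  refine ⟨A', hA', hc, ?_⟩
  rw [hset] at hr
  rw [Finset.union_comm]
  exact hfirst.trans hr

end Attempt

/-! ### Making the degree parities uniform -/

section Mask

variable {V : Type*} [Fintype V] [LinearOrder V] (k : V → Block)

/-- The `q`-block in which a vertex outside the `q`-blocks looks for a fair edge. -/
def anchor : Block → Block
  | .a => .q true
  | .h i => .q i
  | .q i => .q i

/-- Every vertex outside the `q`-blocks has a fair pair with a vertex in its anchor block. -/
def Anchored (ω : Config V) : Prop :=
  ∀ v, (∀ j, k v ≠ .q j) → ∃ u, k u = anchor (k v) ∧ (ω s(v, u)).1 = true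

open scoped Classical in
/-- A vertex of the anchor block of `v` whose pair with `v` is fair, determined by the flags. -/
noncomputable def partner (f : Sym2 V → Bool) (v : V) : V :=
  if h : ∃ u, k u = anchor (k v) ∧ f s(v, u) = true then h.choose else v

open scoped Classical in
/-- The vector that adds `s v` to the degree of each `v` outside the `q`-blocks, supported on the
pairs of these vertices with their partners. -/
noncomputable def mask (f : Sym2 V → Bool) (s : V → ZMod 2) (e : Sym2 V) : ZMod 2 :=
  ∑ v, if (∀ j, k v ≠ .q j) ∧ e = s(v, partner k f v) then s v else 0

/-- The configuration in which `s` becomes the vector of degree parities outside the `q`-blocks. -/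
noncomputable def masked (ω : Config V) (s : V → ZMod 2) : Config V :=
  flip (mask k (fun e => (ω e).1) (s + degIn (bit ω) Finset.univ)) ω

variable {k}

lemma anchor_eq_q (b : Block) : ∃ j, anchor b = .q j := by
  cases b <;> exact ⟨_, rfl⟩

omit [LinearOrder V] in
lemma Anchored.partner_spec {ω : Config V} (h : Anchored k ω) {v : V} (hv : ∀ j, k v ≠ .q j) :
    k (partner k (fun e => (ω e).1) v) = anchor (k v) ∧
      (ω s(v, partner k (fun e => (ω e).1) v)).1 = true := by
  unfold partner
  rw [dif_pos (h v hv)]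
  exact (h v hv).choose_spec

omit [Fintype V] in
lemma bit_flip (x : Sym2 V → ZMod 2) (ω : Config V) (u v : V) :
    bit (flip x ω) u v = bit ω u v + if u = v then 0 else x s(u, v) := by
  unfold bit flip
  split_ifs <;> simp

lemma mask_eq_zero {ω : Config V} (h : Anchored k ω) (s : V → ZMod 2) {u v : V}
    (huv : (∀ j, k u ≠ .q j) → k v ≠ anchor (k u))
    (hvu : (∀ j, k v ≠ .q j) → k u ≠ anchor (k v)) :
    mask k (fun e => (ω e).1) s s(u, v) = 0 := by
  refine Finset.sum_eq_zero fun w _ => if_neg ?_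
  rintro ⟨hw, he⟩
  have hp := (h.partner_spec hw).1
  rcases Sym2.eq_iff.1 he with ⟨rfl, h2⟩ | ⟨h1, rfl⟩
  · exact huv hw (h2 ▸ hp)
  · exact hvu hw (h1 ▸ hp)

lemma sum_mask {ω : Config V} (h : Anchored k ω) (s : V → ZMod 2) {v : V}
    (hv : ∀ j, k v ≠ .q j) :
    ∑ u, (if v = u then 0 else mask k (fun e => (ω e).1) s s(v, u)) = s v := by
  have hpv := (h.partner_spec hv).1
  have hne : v ≠ partner k (fun e => (ω e).1) v := fun he => by
    obtain ⟨j, hj⟩ := anchor_eq_q (k v)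
    rw [← he, hj] at hpv
    exact hv j hpv
  rw [Finset.sum_eq_single (partner k (fun e => (ω e).1) v), if_neg hne]
  · unfold mask
    rw [Finset.sum_eq_single v, if_pos ⟨hv, rfl⟩]
    · intro w _ hwv
      refine if_neg ?_
      rintro ⟨hw, he⟩
      rcases Sym2.eq_iff.1 he with ⟨h1, -⟩ | ⟨h1, -⟩
      · exact hwv h1.symm
      · have h2 := (h.partner_spec hw).1
        obtain ⟨j, hj⟩ := anchor_eq_q (k w)
        rw [← h1, hj] at h2
        exact hv j h2
    · simp
  · intro u _ hu
    split_ifs with huv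
    · rfl
    · refine Finset.sum_eq_zero fun w _ => if_neg ?_
      rintro ⟨hw, he⟩
      rcases Sym2.eq_iff.1 he with ⟨h1, h2⟩ | ⟨h1, h2⟩
      · exact hu (by rw [h2, h1])
      · have h2 := (h.partner_spec hw).1
        obtain ⟨j, hj⟩ := anchor_eq_q (k w)
        rw [← h1, hj] at h2
        exact hv j h2
  · simp

lemma degIn_masked {ω : Config V} (h : Anchored k ω) (s : V → ZMod 2) {v : V}
    (hv : ∀ j, k v ≠ .q j) : degIn (bit (masked k ω s)) Finset.univ v = s v := by
  unfold masked degIn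
  simp only [bit_flip]
  rw [Finset.sum_add_distrib, sum_mask h _ hv]
  change degIn (bit ω) Finset.univ v + (s v + degIn (bit ω) Finset.univ v) = s v
  rw [add_comm, add_assoc, CharTwo.add_self_eq_zero, add_zero]

lemma bit_masked {ω : Config V} (h : Anchored k ω) (s : V → ZMod 2) {u v : V}
    (huv : (∀ j, k u ≠ .q j) → k v ≠ anchor (k u))
    (hvu : (∀ j, k v ≠ .q j) → k u ≠ anchor (k v)) : bit (masked k ω s) u v = bit ω u v := by
  unfold masked
  rw [bit_flip, mask_eq_zero h _ huv hvu]
  simp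

/-- On the anchored configurations the degree parities outside the `q`-blocks may be
replaced by independent fair coins. -/
lemma expect_masked {p : ℝ} (g : Config V → ℝ) :
    expect (letterWeight p) (fun ω : Config V => ind (Anchored k ω) * g ω) =
      expect (letterWeight p) fun ω : Config V => expect fairWeight fun s =>
        ind (Anchored k ω) * g (masked k ω s) := by
  classical
  have e1 : ∀ ω : Config V, expect fairWeight (fun s : V → ZMod 2 =>
      ind (Anchored k ω) * g (masked k ω s)) =
      expect fairWeight fun s : V → ZMod 2 =>
        ind (Anchored k ω) * g (flip (mask k (fun e => (ω e).1) s) ω) := fun ω =>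
    expect_fairWeight_add (degIn (bit ω) Finset.univ) fun s =>
      ind (Anchored k ω) * g (flip (mask k (fun e => (ω e).1) s) ω)
  have e2 : ∀ s : V → ZMod 2, expect (letterWeight p) (fun ω : Config V =>
      ind (Anchored k ω) * g (flip (mask k (fun e => (ω e).1) s) ω)) =
      expect (letterWeight p) (fun ω : Config V => ind (Anchored k ω) * g ω) := by
    intro s
    let X : Config V → Sym2 V → ZMod 2 := fun ω =>
      if Anchored k ω then mask k (fun e => (ω e).1) s else 0
    have hflag : ∀ ω ω' : Config V, (∀ e, (ω e).1 = (ω' e).1) → (Anchored k ω ↔ Anchored k ω') :=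
      fun ω ω' h => by simp only [Anchored, h]
    refine Eq.trans ?_ (expect_flip p X
      (fun ω ω' h => by simp only [X, hflag ω ω' h, h]) (fun ω e he => by
      simp only [X] at he
      split_ifs at he with hA
      · obtain ⟨v, -, hv⟩ := Finset.exists_ne_zero_of_sum_ne_zero he
        split_ifs at hv with hve
        · rw [hve.2]
          exact (hA.partner_spec hve.1).2
        · exact absurd rfl hv
      · exact absurd rfl he) fun ω => ind (Anchored k ω) * g ω)
    congr 1
    ext ω
    have hA' : Anchored k (flip (X ω) ω) ↔ Anchored k ω := hflag _ _ fun _ => rfl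
    by_cases hA : Anchored k ω
    · rw [ind_congr hA']
      simp only [X, if_pos hA]
    · rw [ind_congr hA', ind_of_false hA, zero_mul, zero_mul]
  rw [funext e1, expect_comm, funext e2, expect_const isProbVec_fairWeight]

end Mask

/-! ### The failure probability of an attempt -/

section AttemptFails

variable {V : Type*} [Fintype V] [LinearOrder V] {k : V → Block}

omit [LinearOrder V] in
lemma expect_forall_eq [DecidableEq V] (A : Finset V) (d : V → ZMod 2) :
    expect fairWeight (fun s : V → ZMod 2 => ind (∀ v ∈ A, s v = d v)) = (1 / 2) ^ A.card := by
  have h1 : ∀ s : V → ZMod 2, ind (∀ v ∈ A, s v = d v) = ∏ v ∈ A, ind (s v = d v) := by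
    intro s
    induction A using Finset.induction_on with
    | empty => simp [ind]
    | insert v A hv ih => rw [Finset.prod_insert hv, ← ih, ← ind_and, Finset.forall_mem_insert]
  rw [funext h1, expect_prod_indep isProbVec_fairWeight A (fun v => {v})]
  · rw [Finset.prod_congr rfl fun v _ => expect_coord isProbVec_fairWeight v
      fun b => ind (b = d v)]
    refine Finset.prod_eq_pow_card fun v _ => ?_
    rw [sum_fairWeight]
    rcases zmod_two_cases (d v) with h | h <;> simp [h, ind]
  · intro v _ x y h
    simp only [h v rfl]
  · intro u _ v _ huv
    simpa using huv

lemma targetPar_congr {i : Bool} {a a' : V → V → ZMod 2} {s s' : V → ZMod 2}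
    (hqq : ∀ u v j l, k u = .q j → k v = .q l → a u v = a' u v)
    (hzz : ∀ u v, (∀ j, k u ≠ .q j) → (∀ j, k v ≠ .q j) → k u ≠ .h i → k v ≠ .h i →
      a u v = a' u v)
    (hs : ∀ v, k v ≠ .h i → s v = s' v) : targetPar k i a s = targetPar k i a' s' := by
  ext L U col
  cases L with
  | nil => rfl
  | cons t T =>
    simp only [targetPar]
    split_ifs with h1 h2
    · congr 1
      refine Finset.sum_congr rfl fun u hu => ?_
      simp only [Finset.mem_union, Finset.mem_filter, mem_block] at hu
      rcases hu with hu | hu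
      · exact hqq _ _ _ _ h1 hu
      · exact hqq _ _ _ _ h1 hu.1
    · rfl
    · rw [not_or] at h2
      rw [hs t h2.1]
      congr 2
      refine Finset.sum_congr rfl fun u hu => ?_
      simp only [Finset.mem_sdiff, Finset.mem_union, mem_block] at hu
      refine hzz t u (fun j hj => ?_) (fun j hj => ?_) h2.1 ?_
      · cases i <;> cases j <;> simp_all
      · rw [hj] at hu; simp at hu
      · rcases hu.1 with hu | hu <;> rw [hu] <;> simp

open scoped Classical in
variable (k) in
/-- A set of `K` vertices of the helper block `h !i` to which this block can be reduced, if there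
is one. -/
noncomputable def remainder (i : Bool) (K : ℕ) (ω : Config V) (s : V → ZMod 2) : Finset V :=
  if h : ∃ W, W ⊆ block k (.h !i) ∧ W.card = K ∧
    Win (· = W) (fun _ _ _ => 0) (block k (.h !i)) (bit ω) (block k (.h !i)) s []
  then h.choose else ∅

lemma remainder_subset_and_card_le (i : Bool) (K : ℕ) (ω : Config V) (s : V → ZMod 2) :
    remainder k i K ω s ⊆ block k (.h !i) ∧ (remainder k i K ω s).card ≤ K := by
  unfold remainder
  split_ifs with h
  · exact ⟨h.choose_spec.1, h.choose_spec.2.1.le⟩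
  · simp

lemma win_remainder {i : Bool} {K : ℕ} {ω : Config V} {s : V → ZMod 2}
    (h : Win (·.card = K) (fun _ _ _ => 0) (block k (.h !i)) (bit ω) (block k (.h !i)) s []) :
    Win (· = remainder k i K ω s) (fun _ _ _ => 0) (block k (.h !i)) (bit ω)
      (block k (.h !i)) s [] := by
  obtain ⟨W, hW, hc, hw⟩ := h.exists_eq
  have hex : ∃ W, W ⊆ block k (.h !i) ∧ W.card = K ∧
    Win (· = W) (fun _ _ _ => 0) (block k (.h !i)) (bit ω) (block k (.h !i)) s [] := ⟨W, hW, hc, hw⟩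
  unfold remainder
  rw [dif_pos hex]
  exact hex.choose_spec.2.2

lemma remainder_congr {i : Bool} {K : ℕ} {ω ω' : Config V} {s s' : V → ZMod 2}
    (hb : ∀ u ∈ block k (.h !i), ∀ v ∈ block k (.h !i), bit ω u v = bit ω' u v)
    (hs : ∀ u ∈ block k (.h !i), s u = s' u) : remainder k i K ω s = remainder k i K ω' s' := by
  have h : ∀ W, Win (· = W) (fun _ _ _ => 0) (block k (.h !i)) (bit ω) (block k (.h !i)) s [] ↔
      Win (· = W) (fun _ _ _ => 0) (block k (.h !i)) (bit ω') (block k (.h !i)) s' [] := fun W =>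
    ⟨fun h => h.congr subset_rfl hs (fun u hu v hv _ => hb u hu v hv) (by simp),
      fun h => h.congr subset_rfl (fun u hu => (hs u hu).symm)
        (fun u hu v hv _ => (hb u hu v hv).symm) (by simp)⟩
  have key : ∀ (P P' : Finset V → Prop) (d : Decidable (∃ W, P W)) (d' : Decidable (∃ W, P' W)),
      P = P' → (if h : ∃ W, P W then h.choose else ∅) = if h : ∃ W, P' W then h.choose else ∅ := by
    rintro P _ d d' rfl
    obtain rfl := Subsingleton.elim d d'
    rfl
  unfold remainder
  refine key _ _ _ _ (funext fun W => propext ?_)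
  rw [h W]

/-- The attempt to keep `q i` succeeds in the masked configuration if the process wins. -/
lemma exists_reach_masked {i : Bool} {K : ℕ} {ω : Config V} {s : V → ZMod 2} (hA : Anchored k ω)
    (h0 : Win (·.card = K) (fun _ _ _ => 0) (block k (.h !i)) (bit ω) (block k (.h !i)) s [])
    (h1 : Win (·.card = K) (targetPar k i (bit ω) s) (block k (.h i)) (bit ω) (block k (.h i))
      (fun u => s u + ∑ v ∈ block k (.h !i) \ remainder k i K ω s, bit ω u v)
      (targets k i (remainder k i K ω s))) :
    ∃ A' ⊆ block k (.h i), A'.card = K ∧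
      Reach (Allowed k i) (bit (masked k ω s)) Finset.univ (block k (.q i) ∪ A') := by
  set W := remainder k i K ω s with hWdef
  have hW : W ⊆ block k (.h !i) := (remainder_subset_and_card_le i K ω s).1
  have hzz : ∀ u v, (∀ j, k u ≠ .q j) → (∀ j, k v ≠ .q j) →
      bit ω u v = bit (masked k ω s) u v := by
    intro u v hu hv
    refine (bit_masked hA s (fun _ h => ?_) fun _ h => ?_).symm
    · obtain ⟨j, hj⟩ := anchor_eq_q (k u)
      exact hv j (h.trans hj)
    · obtain ⟨j, hj⟩ := anchor_eq_q (k v)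
      exact hu j (h.trans hj)
  have hqq : ∀ u v j l, k u = .q j → k v = .q l → bit ω u v = bit (masked k ω s) u v :=
    fun u v j l hu hv => (bit_masked hA s (fun h => absurd hu (h j))
      fun h => absurd hv (h l)).symm
  have hqh : ∀ u v, k u = .q !i → k v = .h i → bit ω u v = bit (masked k ω s) u v := by
    intro u v hu hv
    refine (bit_masked hA s (fun h => absurd hu (h _)) fun _ h => ?_).symm
    rw [hu, hv] at h
    simp [anchor] at h
  have hh : ∀ {j v}, v ∈ block k (.h j) → ∀ l, k v ≠ .q l := fun hv l => by
    rw [mem_block.1 hv]; simp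
  refine exists_reach_of_win (par := fun _ _ _ => 0) (s := s) (W := W)
    (fun v hv => (degIn_masked hA s hv).symm) hW ?_ ?_
  · exact (win_remainder h0).congr subset_rfl (fun _ _ => rfl)
      (fun u hu v hv _ => hzz u v (hh hu) (hh hv)) (by simp)
  · rw [← targetPar_congr hqq (fun u v hu hv _ _ => hzz u v hu hv) fun v _ => rfl]
    refine h1.congr subset_rfl (fun u hu => ?_) (fun u hu v hv _ => hzz u v (hh hu) (hh hv))
      fun t ht u hu => ?_
    · congr 1
      exact Finset.sum_congr rfl fun v hv =>
        hzz u v (hh hu) (hh (Finset.mem_sdiff.1 hv).1)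
    · rcases mem_targets.1 ht with h | h | h
      · exact hzz t u (fun j => by rw [h]; simp) (hh hu)
      · exact hzz t u (hh (hW h)) (hh hu)
      · exact hqh t u h (mem_block.1 hu)

/-- Given the edges inside the revealed part and its degree parities, an attempt fails with
exponentially small probability. -/
theorem expect_attempt_fails_le {p : ℝ} (h0 : 0 ≤ p) (h1 : p ≤ 1) {K : ℕ} (i : Bool)
    (hsize : (block k .a).card + 2 * K + (block k (.q !i)).card ≤ (block k (.h i)).card)
    (hsize' : K ≤ (block k (.h !i)).card) (Q : Config V → Prop)
    (hQ : ∀ ω ω', (∀ u v, k u = .a → k v = .a → bit ω u v = bit ω' u v) → (Q ω ↔ Q ω'))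
    (d : V → ZMod 2) :
    expect (letterWeight p) (fun ω => ind (Anchored k ω ∧ Q ω ∧
        (∀ v ∈ block k .a, degIn (bit ω) Finset.univ v = d v) ∧
        ¬∃ A' ⊆ block k (.h i), A'.card = K ∧
          Reach (Allowed k i) (bit ω) Finset.univ (block k (.q i) ∪ A'))) ≤
      (3 * ((block k (.h !i)).card + (block k (.h i)).card) + 2) *
        (1 - min p (1 - p) ^ 2) ^ K *
        ((1 / 2) ^ (block k .a).card * expect (letterWeight p) fun ω => ind (Q ω)) := by
  have hw := isProbVec_letterWeight.2 ⟨h0, h1⟩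
  have hf := isProbVec_fairWeight
  let I : Config V → (V → ZMod 2) → ℝ := fun ω s =>
    ind (Q ω) * ind (∀ v ∈ block k .a, s v = d v)
  have hI : ∀ ω s, 0 ≤ I ω s := fun ω s => mul_nonneg (ind_nonneg _) (ind_nonneg _)
  have hEI : expect (letterWeight p) (fun ω => expect fairWeight fun s => I ω s) =
      (1 / 2) ^ (block k .a).card * expect (letterWeight p) fun ω => ind (Q ω) := by
    simp only [I, expect_const_mul]
    rw [expect_forall_eq, ← expect_const_mul]
    simp only [mul_comm]
  have hIdep : ∀ j, ∀ x x' : Config V, ∀ s s' : V → ZMod 2,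
      (∀ e : Sym2 V, (∀ u ∈ block k (.h j), u ∉ e) → x e = x' e) →
      (∀ v ∉ block k (.h j), s v = s' v) → I x s = I x' s' := by
    intro j x x' s s' hx hs
    have h2 : Q x ↔ Q x' := hQ x x' fun u v hu hv => bit_congr (hx _ fun w hw hwe => by
      rw [mem_block] at hw
      rcases Sym2.mem_iff.1 hwe with rfl | rfl
      · rw [hu] at hw; simp at hw
      · rw [hv] at hw; simp at hw)
    have h3 : (∀ v ∈ block k .a, s v = d v) ↔ ∀ v ∈ block k .a, s' v = d v :=
      forall₂_congr fun v hv => by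
        rw [hs v]
        intro h
        rw [mem_block] at h hv
        rw [h] at hv
        simp at hv
    simp only [I, h2, h3]
  have hsub : ∀ j, ∀ x x' : Config V, (∀ e : Sym2 V, (∀ u ∈ block k (.h j), u ∉ e) → x e = x' e) →
      ∀ u v, k u ≠ .h j → k v ≠ .h j → bit x u v = bit x' u v := by
    intro j x x' hx u v hu hv
    refine bit_congr (hx _ fun w hw hwe => ?_)
    rw [mem_block] at hw
    rcases Sym2.mem_iff.1 hwe with rfl | rfl
    · exact hu hw
    · exact hv hw
  have hb0 := expect_mul_not_win_le h0 h1 (K := K) (U₀ := block k (.h !i)) I hI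
    (fun _ _ _ _ _ => 0) (fun _ _ => []) (fun _ _ => ∅)
    (fun x x' s s' hx hs => ⟨hIdep _ x x' s s' hx hs, rfl, rfl, rfl⟩)
    (fun x s => ⟨List.nodup_nil, by simp, by simpa using hsize'⟩)
  have hrem : ∀ x x' : Config V, ∀ s s' : V → ZMod 2,
      (∀ e : Sym2 V, (∀ u ∈ block k (.h i), u ∉ e) → x e = x' e) →
      (∀ v ∉ block k (.h i), s v = s' v) → remainder k i K x s = remainder k i K x' s' := by
    intro x x' s s' hx hs
    have hne : ∀ u ∈ block k (.h !i), k u ≠ .h i := fun u hu => by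
      rw [mem_block.1 hu]; cases i <;> simp
    refine remainder_congr (fun u hu v hv => hsub i x x' hx u v (hne u hu) (hne v hv))
      fun u hu => hs u fun h => hne u hu (mem_block.1 h)
  have hb1 := expect_mul_not_win_le h0 h1 (K := K) (U₀ := block k (.h i)) I hI
    (fun x s => targetPar k i (bit x) s) (fun x s => targets k i (remainder k i K x s))
    (fun x s => block k (.h !i) \ remainder k i K x s)
    (fun x x' s s' hx hs => by
      refine ⟨hIdep _ x x' s s' hx hs, ?_, by rw [hrem x x' s s' hx hs],
        by rw [hrem x x' s s' hx hs]⟩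
      refine targetPar_congr (fun u v j l hu hv => hsub i x x' hx u v ?_ ?_)
        (fun u v _ _ hu hv => hsub i x x' hx u v hu hv) fun v hv => hs v fun h =>
          hv (mem_block.1 h)
      · rw [hu]; simp
      · rw [hv]; simp)
    (fun x s => by
      obtain ⟨hs1, hs2⟩ := remainder_subset_and_card_le (k := k) i K x s
      refine ⟨nodup_targets hs1, fun t ht h => ?_, by rw [length_targets]; omega⟩
      rw [mem_block] at h
      rcases mem_targets.1 ht with ht | ht | ht
      · rw [h] at ht; simp at ht
      · have := mem_block.1 (hs1 ht)
        rw [h] at this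
        revert this
        cases i <;> simp
      · rw [h] at ht; simp at ht)
  rw [hEI] at hb0 hb1
  simp only [Finset.sum_empty, add_zero] at hb0
  simp only [ind_and (Anchored k _)]
  rw [expect_masked]
  refine (expect_mono hw fun ω => (expect_mono hf fun s => ?_).trans_eq
    (expect_add fairWeight _ _)).trans ((expect_add _ _ _).le.trans
      ((add_le_add hb0 hb1).trans_eq ?_))
  · by_cases hA : Anchored k ω
    · rw [ind_of_true hA, one_mul]
      have hQ' : Q (masked k ω s) ↔ Q ω := hQ _ _ fun u v hu hv => by
        refine bit_masked hA s ?_ ?_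
        · rw [hu, hv]; simp [anchor]
        · rw [hu, hv]; simp [anchor]
      have hd : (∀ v ∈ block k .a, degIn (bit (masked k ω s)) Finset.univ v = d v) ↔
          ∀ v ∈ block k .a, s v = d v := forall₂_congr fun v hv => by
        rw [degIn_masked hA s fun j => by rw [mem_block.1 hv]; simp]
      rw [ind_and, ind_and, ind_congr hQ', ind_congr hd, ← mul_assoc, ← mul_add]
      refine mul_le_mul_of_nonneg_left ((ind_mono fun hno => ?_).trans (ind_or_le _ _)) (hI ω s)
      by_contra hcon
      rw [not_or, not_not, not_not] at hcon
      exact hno (exists_reach_masked hA hcon.1 hcon.2)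
    · rw [ind_of_false hA, zero_mul]
      exact add_nonneg (mul_nonneg (hI _ _) (ind_nonneg _)) (mul_nonneg (hI _ _) (ind_nonneg _))
  · ring

end AttemptFails

/-! ### The flags -/

section Flags

variable {V : Type*} [Fintype V] [LinearOrder V] {k : V → Block}

/-- A vertex has no fair pair into a set of size `m` with probability `(1 - 2π)^m`, where `2π` is
the probability of a flag being raised. -/
lemma expect_no_flag_le {p : ℝ} (h0 : 0 ≤ p) (h1 : p ≤ 1) {v : V} {B : Finset V} (hv : v ∉ B) :
    expect (letterWeight p) (fun ω : Config V => ind (∀ u ∈ B, (ω s(v, u)).1 ≠ true)) ≤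
      (1 - min p (1 - p) ^ 2) ^ B.card := by
  have hw := isProbVec_letterWeight.2 ⟨h0, h1⟩
  have h2 : ∀ ω : Config V, ind (∀ u ∈ B, (ω s(v, u)).1 ≠ true) =
      ∏ u ∈ B, ind ((ω s(v, u)).1 ≠ true) := by
    intro ω
    clear hv
    induction B using Finset.induction_on with
    | empty => simp [ind]
    | insert u B hu ih => rw [Finset.prod_insert hu, ← ih, ← ind_and, Finset.forall_mem_insert]
  rw [funext h2, expect_prod_indep hw B (fun u => {s(v, u)})]
  · rw [Finset.prod_congr rfl fun u _ => expect_coord hw s(v, u) fun b => ind (b.1 ≠ true)]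
    rw [Finset.prod_const]
    have h3 := sum_letterWeight_flag p fun b => ind (b ≠ true)
    rw [h3, ind_of_false (by simp), ind_of_true (by simp)]
    have h4 := min_le_left p (1 - p)
    have h5 := min_le_right p (1 - p)
    have h6 : 0 ≤ min p (1 - p) := le_min h0 (by linarith)
    exact pow_le_pow_left₀ (by linarith) (by nlinarith) _
  · intro u _ x y h
    simp only [h _ rfl]
  · intro u hu w hw' huw
    rw [Set.disjoint_singleton]
    intro he
    rcases Sym2.eq_iff.1 he with ⟨-, h⟩ | ⟨h, h'⟩
    · exact huw h
    · exact hv (h' ▸ hu)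

/-- Two vertices have no common fair neighbour in a set of size `m` with
probability `(1 - 4π²)^m`. -/
lemma expect_no_common_flag_le {p : ℝ} (h0 : 0 ≤ p) (h1 : p ≤ 1) {v w : V} {B : Finset V}
    (hvw : v ≠ w) (hv : v ∉ B) (hw' : w ∉ B) :
    expect (letterWeight p) (fun ω : Config V =>
      ind (∀ j ∈ B, ¬((ω s(j, v)).1 = true ∧ (ω s(j, w)).1 = true))) ≤
      (1 - min p (1 - p) ^ 2) ^ B.card := by
  have hw := isProbVec_letterWeight.2 ⟨h0, h1⟩
  have h2 : ∀ ω : Config V, ind (∀ j ∈ B, ¬((ω s(j, v)).1 = true ∧ (ω s(j, w)).1 = true)) =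
      ∏ j ∈ B, (1 - ind ((ω s(j, v)).1 = true) * ind ((ω s(j, w)).1 = true)) := by
    intro ω
    clear hv hw'
    induction B using Finset.induction_on with
    | empty => simp [ind]
    | insert u B hu ih =>
      rw [Finset.prod_insert hu, ← ih, ← ind_and, ← ind_not, ← ind_and, Finset.forall_mem_insert]
  have hdisj : ∀ j ∈ B, ∀ j' ∈ B, ∀ x y, (x = v ∨ x = w) → (y = v ∨ y = w) →
      s(j, x) = s(j', y) → j = j' ∧ x = y := by
    intro j hj j' hj' x y hx hy he
    rcases Sym2.eq_iff.1 he with h | ⟨h, -⟩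
    · exact h
    · rcases hy with rfl | rfl
      · exact absurd (h ▸ hj) hv
      · exact absurd (h ▸ hj) hw'
  rw [funext h2, expect_prod_indep hw B (fun j => {s(j, v), s(j, w)})]
  · rw [← Finset.prod_const]
    refine Finset.prod_le_prod (fun j _ => expect_nonneg hw fun ω => ?_) fun j hj => ?_
    · rw [← ind_and, sub_nonneg]
      exact ind_le_one _
    have e1 : ∀ ω : Config V, 1 - ind ((ω s(j, v)).1 = true) * ind ((ω s(j, w)).1 = true) =
        1 + -1 * (ind ((ω s(j, v)).1 = true) * ind ((ω s(j, w)).1 = true)) := fun ω => by ring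
    rw [funext e1, expect_add, expect_const hw, expect_const_mul, expect_mul_indep hw {s(j, v)},
      expect_coord hw s(j, v) fun b => ind (b.1 = true),
      expect_coord hw s(j, w) fun b => ind (b.1 = true),
      sum_letterWeight_flag p fun b => ind (b = true), ind_of_true rfl, ind_of_false (by simp)]
    · nlinarith [sq_nonneg (min p (1 - p))]
    · intro x y h
      simp only [h _ rfl]
    · intro x y h
      have hne : s(j, w) ∈ ({s(j, v)} : Set (Sym2 V))ᶜ := fun he =>
        hvw (hdisj j hj j hj w v (Or.inr rfl) (Or.inl rfl) he).2.symm
      simp only [h _ hne]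
  · intro j _ x y h
    simp only [h _ (Set.mem_insert _ _), h _ (Set.mem_insert_of_mem _ rfl)]
  · intro j hj j' hj' hne
    rw [Set.disjoint_left]
    rintro e (rfl | rfl) (he | he)
    · exact hne (hdisj j hj j' hj' _ _ (Or.inl rfl) (Or.inl rfl) he).1
    · exact hne (hdisj j hj j' hj' _ _ (Or.inl rfl) (Or.inr rfl) he).1
    · exact hne (hdisj j hj j' hj' _ _ (Or.inr rfl) (Or.inl rfl) he).1
    · exact hne (hdisj j hj j' hj' _ _ (Or.inr rfl) (Or.inr rfl) he).1

lemma ind_exists_le {κ : Type*} [Fintype κ] (P : κ → Prop) : ind (∃ x, P x) ≤ ∑ x, ind (P x) := by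
  by_cases h : ∃ x, P x
  · obtain ⟨x, hx⟩ := id h
    rw [ind_of_true h, ← ind_of_true hx]
    exact Finset.single_le_sum (f := fun x => ind (P x)) (fun y _ => ind_nonneg _)
      (Finset.mem_univ x)
  · rw [ind_of_false h]
    exact Finset.sum_nonneg fun x _ => ind_nonneg _

/-- With overwhelming probability, the flags anchor the vertices outside the `q`-blocks and link
the two `q`-blocks. -/
lemma expect_not_anchored_or_linked_le {p : ℝ} (h0 : 0 ≤ p) (h1 : p ≤ 1) {m : ℕ} (hm0 : 0 < m)
    (hm : ∀ i, (block k (.q i)).card = m) :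
    expect (letterWeight p) (fun ω : Config V => ind (¬(Anchored k ω ∧ Linked k ω))) ≤
      Fintype.card V * (1 - min p (1 - p) ^ 2) ^ m := by
  have hw := isProbVec_letterWeight.2 ⟨h0, h1⟩
  obtain ⟨i₀, hi₀⟩ : (block k (.q false)).Nonempty := by
    rw [← Finset.card_pos, hm]
    exact hm0
  rw [mem_block] at hi₀
  -- The event that `v` lacks the fair pairs that are required of it.
  let E : V → Config V → Prop := fun v ω =>
    if k v = .q false then
      v ≠ i₀ ∧ ∀ j ∈ block k (.q true), ¬((ω s(j, i₀)).1 = true ∧ (ω s(j, v)).1 = true)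
    else if k v = .q true then ∀ u ∈ block k (.q false), (ω s(v, u)).1 ≠ true
    else ∀ u ∈ block k (anchor (k v)), (ω s(v, u)).1 ≠ true
  have hE : ∀ ω, ¬(Anchored k ω ∧ Linked k ω) → ∃ v, E v ω := by
    intro ω h
    by_contra hno
    push Not at hno
    refine h ⟨fun v hv => ?_, i₀, hi₀, fun v hv hne => ?_, fun j hj => ?_⟩
    · have h2 := hno v
      simp only [E, if_neg (hv false), if_neg (hv true)] at h2
      push Not at h2
      obtain ⟨u, hu, hf⟩ := h2
      exact ⟨u, mem_block.1 hu, hf⟩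
    · have h2 := hno v
      simp only [E, if_pos hv] at h2
      push Not at h2
      obtain ⟨j, hj, hf⟩ := h2 hne
      exact ⟨j, mem_block.1 hj, hf⟩
    · have h2 := hno j
      have hj' : k j ≠ .q false := by rw [hj]; simp
      simp only [E, if_neg hj', if_pos hj] at h2
      push Not at h2
      obtain ⟨u, hu, hf⟩ := h2
      exact ⟨u, mem_block.1 hu, hf⟩
  refine (expect_mono hw fun ω => (ind_mono (hE ω)).trans (ind_exists_le _)).trans ?_
  rw [expect_sum, ← nsmul_eq_mul, ← Finset.card_univ]
  refine Finset.sum_le_card_nsmul _ _ _ fun v _ => ?_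
  by_cases hF : k v = .q false
  · rw [← hm true]
    by_cases hv : v = i₀
    · refine (expect_le_const hw fun ω => (ind_of_false ?_).le).trans (pow_nonneg ?_ _)
      · simp only [E, if_pos hF]
        exact fun h => h.1 hv
      · have h4 := min_le_left p (1 - p)
        have h6 : 0 ≤ min p (1 - p) := le_min h0 (by linarith)
        nlinarith
    · refine (expect_mono hw fun ω => ind_mono fun h => ?_).trans
        (expect_no_common_flag_le h0 h1 (v := i₀) (w := v) (Ne.symm hv) ?_ ?_)
      · simp only [E, if_pos hF] at h
        exact h.2
      · rw [mem_block, hi₀]; simp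
      · rw [mem_block, hF]; simp
  · by_cases hT : k v = .q true
    · rw [← hm false]
      simp only [E, if_neg hF, if_pos hT]
      exact expect_no_flag_le h0 h1 (by rw [mem_block, hT]; simp)
    · obtain ⟨j, hj⟩ := anchor_eq_q (k v)
      simp only [E, if_neg hF, if_neg hT]
      rw [hj, ← hm j]
      refine expect_no_flag_le h0 h1 ?_
      rw [mem_block]
      cases j
      · exact hF
      · exact hT

end Flags

/-! ### The failure probability given the revealed information -/

section NotGood

variable {V : Type*} [Fintype V] [LinearOrder V] {k : V → Block}

omit [Fintype V] [LinearOrder V] in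
lemma Anchored.congr {ω ω' : Config V}
    (h : ∀ u v, k v ≠ .a → (ω s(u, v)).1 = (ω' s(u, v)).1) (hA : Anchored k ω) :
    Anchored k ω' := by
  intro v hv
  obtain ⟨u, hu, hf⟩ := hA v hv
  refine ⟨u, hu, ?_⟩
  obtain ⟨j, hj⟩ := anchor_eq_q (k v)
  rw [← h v u (by rw [hu, hj]; simp), hf]

omit [Fintype V] [LinearOrder V] in
lemma Linked.congr {ω ω' : Config V}
    (h : ∀ u v, k v ≠ .a → (ω s(u, v)).1 = (ω' s(u, v)).1) (hL : Linked k ω) : Linked k ω' := by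
  obtain ⟨i₀, hi₀, h1, h2⟩ := hL
  have h' : ∀ u v, k v = .q false → (ω s(u, v)).1 = (ω' s(u, v)).1 := fun u v hv =>
    h u v (by rw [hv]; simp)
  refine ⟨i₀, hi₀, fun v hv hne => ?_, fun j hj => ?_⟩
  · obtain ⟨j, hj, hf1, hf2⟩ := h1 v hv hne
    exact ⟨j, hj, by rw [← h' _ _ hi₀, hf1], by rw [← h' _ _ hv, hf2]⟩
  · obtain ⟨v, hv, hf⟩ := h2 j hj
    exact ⟨v, hv, by rw [← h' _ _ hv, hf]⟩

lemma edgesIn_flip_single (ω : Config V) {u v : V} (huv : u ≠ v) :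
    edgesIn (flip (Pi.single s(u, v) 1) ω) Finset.univ = edgesIn ω Finset.univ + 1 := by
  have h1 : ∀ e, edgeBit (flip (Pi.single s(u, v) 1) ω) e =
      edgeBit ω e + if e = s(u, v) then 1 else 0 := by
    intro e
    unfold edgeBit flip
    by_cases he : e = s(u, v)
    · subst he
      simp [huv]
    · rw [Pi.single_eq_of_ne he]
      simp [he]
  unfold edgesIn
  rw [Finset.sum_congr rfl fun e _ => h1 e, Finset.sum_add_distrib, Finset.sum_ite_eq']
  simp

/-- A fair pair between the `q`-blocks makes the parity of the number of edges a fair coin. -/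
lemma expect_edges_eq {p : ℝ} {B : Config V → Prop}
    (hB : ∀ ω x, (∀ e, x e ≠ 0 → e ∈ crossPairs k) → (B (flip x ω) ↔ B ω))
    (hfair : ∀ ω, B ω → ∃ u v, k u = .q true ∧ k v = .q false ∧ (ω s(u, v)).1 = true)
    (t : ZMod 2) :
    expect (letterWeight p) (fun ω : Config V => ind (B ω)) =
      2 * expect (letterWeight p) (fun ω : Config V =>
        ind (B ω ∧ edgesIn ω Finset.univ = t)) := by
  classical
  let X : Config V → Sym2 V → ZMod 2 := fun ω =>
    if h : ∃ e : Sym2 V, e ∈ crossPairs k ∧ (ω e).1 = true then Pi.single h.choose 1 else 0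
  have hX : ∀ ω e, X ω e ≠ 0 → e ∈ crossPairs k ∧ (ω e).1 = true := by
    intro ω e he
    simp only [X] at he
    split_ifs at he with h
    · by_cases hee : e = h.choose
      · rw [hee]; exact h.choose_spec
      · rw [Pi.single_eq_of_ne hee] at he
        exact absurd rfl he
    · exact absurd rfl he
  have hflip : expect (letterWeight p) (fun ω : Config V =>
      ind (B ω ∧ edgesIn ω Finset.univ = t)) =
      expect (letterWeight p) (fun ω : Config V =>
        ind (B ω ∧ edgesIn ω Finset.univ = t + 1)) := by
    rw [← expect_flip p X (fun ω ω' h => by simp only [X, h]) (fun ω e he => (hX ω e he).2)]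
    congr 1
    ext ω
    refine ind_congr ?_
    rw [hB ω (X ω) fun e he => (hX ω e he).1]
    refine and_congr_right fun hω => ?_
    have hex : ∃ e : Sym2 V, e ∈ crossPairs k ∧ (ω e).1 = true := by
      obtain ⟨u, v, hu, hv, hf⟩ := hfair ω hω
      exact ⟨_, ⟨u, v, hu, hv, rfl⟩, hf⟩
    obtain ⟨u, v, hu, hv, he⟩ := hex.choose_spec.1
    have huv : u ≠ v := by rintro rfl; rw [hu] at hv; simp at hv
    have hXω : X ω = Pi.single s(u, v) 1 := by
      simp only [X, dif_pos hex]
      rw [he]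
    rw [hXω, edgesIn_flip_single ω huv]
    generalize edgesIn ω Finset.univ = y
    revert y t
    decide
  have hsum : ∀ ω : Config V, ind (B ω) = ind (B ω ∧ edgesIn ω Finset.univ = t) +
      ind (B ω ∧ edgesIn ω Finset.univ = t + 1) := by
    intro ω
    rw [ind_and, ind_and, ← mul_add]
    have : ind (edgesIn ω Finset.univ = t) + ind (edgesIn ω Finset.univ = t + 1) = 1 := by
      rcases zmod_two_cases (edgesIn ω Finset.univ) with h | h <;>
        rcases zmod_two_cases t with h' | h' <;> rw [h, h'] <;>
        simp [ind, CharTwo.add_self_eq_zero]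
    rw [this, mul_one]
  rw [funext hsum, expect_add, ← hflip]
  ring

/-- Given the revealed information, both attempts succeed and the `q`-blocks are linked, with
overwhelming probability. -/
theorem expect_not_good_le {p : ℝ} (h0 : 0 ≤ p) (h1 : p ≤ 1) {K m : ℕ} (hm0 : 0 < m)
    (hm : ∀ i, (block k (.q i)).card = m)
    (hsize : ∀ i, (block k .a).card + 2 * K + m ≤ (block k (.h i)).card)
    (hδ : Fintype.card V * (1 - min p (1 - p) ^ 2) ^ m ≤ 1 / 2)
    (H : SimpleGraph (block k .a : Set V)) (s : (block k .a : Set V) → ZMod 2) (t : ZMod 2) :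
    expect (letterWeight p) (fun ω => ind (toGraph ω ∈ revealEvent (block k .a : Set V) H s t ∧
        ¬Good k K ω)) ≤
      (4 * 2 ^ (block k .a).card * (Fintype.card V * (1 - min p (1 - p) ^ 2) ^ m) +
        8 * (3 * Fintype.card V + 2) * (1 - min p (1 - p) ^ 2) ^ K) *
      expect (letterWeight p) (fun ω =>
        ind (toGraph ω ∈ revealEvent (block k .a : Set V) H s t)) := by
  classical
  have hw := isProbVec_letterWeight.2 ⟨h0, h1⟩
  have hf := isProbVec_fairWeight
  set a := (block k .a).card
  set r := 1 - min p (1 - p) ^ 2 with hr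
  have hr0 : 0 ≤ r := by
    have h4 := min_le_left p (1 - p)
    have h6 : 0 ≤ min p (1 - p) := le_min h0 (by linarith)
    rw [hr]
    nlinarith
  let Q : Config V → Prop := fun ω => (toGraph ω).induce (block k .a : Set V) = H
  let d : V → ZMod 2 := fun v => if h : v ∈ block k .a then s ⟨v, h⟩ else 0
  let D : Config V → Prop := fun ω => ∀ v ∈ block k .a, degIn (bit ω) Finset.univ v = d v
  let N : Config V → Prop := fun ω => Anchored k ω ∧ Linked k ω
  have hQ : ∀ ω ω', (∀ u v, k u = .a → k v = .a → bit ω u v = bit ω' u v) → (Q ω ↔ Q ω') := by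
    intro ω ω' h
    have : (toGraph ω).induce (block k .a : Set V) = (toGraph ω').induce (block k .a : Set V) := by
      ext u v
      change bit ω u v = 1 ↔ bit ω' u v = 1
      rw [h u v (mem_block.1 u.2) (mem_block.1 v.2)]
    simp only [Q, this]
  have hR : ∀ ω, toGraph ω ∈ revealEvent (block k .a : Set V) H s t ↔
      Q ω ∧ D ω ∧ edgesIn ω Finset.univ = t := by
    intro ω
    have hdeg : ∀ v, (((toGraph ω).neighborSet v).ncard : ZMod 2) =
        degIn (bit ω) Finset.univ v := by
      intro v
      rw [(isAdjMatrix_toGraph ω).degIn_eq]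
      simp
    refine and_congr Iff.rfl (and_congr ?_ (by rw [ncard_edgeSet_toGraph]))
    constructor
    · intro h v hv
      rw [← hdeg, h ⟨v, hv⟩]
      simp only [d, dif_pos hv]
    · intro h v
      have hv : (v : V) ∈ block k .a := v.2
      rw [hdeg, h v hv]
      simp only [d, dif_pos hv]
  have hcross : ∀ (ω : Config V) x, (∀ e, x e ≠ 0 → e ∈ crossPairs k) → ∀ u v,
      (∀ j, k u ≠ .q j) → bit (flip x ω) u v = bit ω u v := by
    intro ω x hx u v hu
    rw [bit_flip]
    by_cases hxe : x s(u, v) = 0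
    · simp [hxe]
    · obtain ⟨u', v', hu', hv', he⟩ := hx _ hxe
      rcases Sym2.eq_iff.1 he with ⟨rfl, rfl⟩ | ⟨rfl, rfl⟩
      · exact absurd hu' (hu _)
      · exact absurd hv' (hu _)
  have ha : ∀ v : V, k v = .a → ∀ j, k v ≠ .q j := fun v hv j => by rw [hv]; simp
  -- The parity of the number of edges is fair.
  have hstep1 := expect_edges_eq (k := k) (p := p) (B := fun ω => N ω ∧ Q ω ∧ D ω)
    (fun ω x hx => by
      refine and_congr ⟨fun h => ⟨h.1.congr fun _ _ _ => rfl, h.2.congr fun _ _ _ => rfl⟩,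
        fun h => ⟨h.1.congr fun _ _ _ => rfl, h.2.congr fun _ _ _ => rfl⟩⟩ (and_congr ?_ ?_)
      · exact hQ _ _ fun u v hu _ => hcross ω x hx u v (ha u hu)
      · refine forall₂_congr fun v hv => ?_
        have : degIn (bit (flip x ω)) Finset.univ v = degIn (bit ω) Finset.univ v :=
          Finset.sum_congr rfl fun u _ => hcross ω x hx v u (ha v (mem_block.1 hv))
        rw [this])
    (fun ω h => by
      obtain ⟨j, hj⟩ : (block k (.q true)).Nonempty := by
        rw [← Finset.card_pos, hm]
        exact hm0
      obtain ⟨-, -, -, h2⟩ := h.1.2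
      obtain ⟨v, hv, hfl⟩ := h2 j (mem_block.1 hj)
      exact ⟨j, v, mem_block.1 hj, hv, hfl⟩) t
  -- The degree parities on the revealed part are fair.
  have hstep2 : expect (letterWeight p) (fun ω => ind (N ω ∧ Q ω ∧ D ω)) =
      (1 / 2) ^ a * expect (letterWeight p) (fun ω => ind (N ω ∧ Q ω)) := by
    have e1 : ∀ ω, ind (N ω ∧ Q ω ∧ D ω) =
        ind (Anchored k ω) * ind (Linked k ω ∧ Q ω ∧ D ω) := fun ω => by
      rw [← ind_and]
      exact ind_congr (by simp only [N]; tauto)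
    rw [funext e1, expect_masked, ← expect_const_mul]
    congr 1
    ext ω
    by_cases hA : Anchored k ω
    · have e2 : ∀ σ, ind (Anchored k ω) *
          ind (Linked k (masked k ω σ) ∧ Q (masked k ω σ) ∧ D (masked k ω σ)) =
          ind (N ω ∧ Q ω) * ind (∀ v ∈ block k .a, σ v = d v) := by
        intro σ
        rw [← ind_and, ← ind_and]
        refine ind_congr ?_
        have hL : Linked k (masked k ω σ) ↔ Linked k ω :=
          ⟨fun h => h.congr fun _ _ _ => rfl, fun h => h.congr fun _ _ _ => rfl⟩
        have hQ' : Q (masked k ω σ) ↔ Q ω := hQ _ _ fun u v hu hv => by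
          refine bit_masked hA σ ?_ ?_
          · rw [hu, hv]; simp [anchor]
          · rw [hu, hv]; simp [anchor]
        have hD' : D (masked k ω σ) ↔ ∀ v ∈ block k .a, σ v = d v :=
          forall₂_congr fun v hv => by rw [degIn_masked hA σ (ha v (mem_block.1 hv))]
        rw [hL, hQ', hD']
        simp only [N]
        tauto
      rw [funext e2, expect_const_mul, expect_forall_eq, mul_comm]
    · have e3 : ind (N ω ∧ Q ω) = 0 := ind_of_false fun h => hA h.1.1
      simp only [ind_of_false hA, zero_mul, e3, mul_zero]
      exact expect_const hf 0
  -- The flags are independent of the edges inside the revealed part.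
  have hQdep : DependsOnlyOn (pairsIn (block k .a)) fun ω : Config V => ind (Q ω) := by
    intro x y h
    refine ind_congr (hQ x y fun u v hu hv => bit_congr (h _ ?_))
    exact Finset.mk_mem_sym2_iff.2 ⟨mem_block.2 hu, mem_block.2 hv⟩
  have hNdep : ∀ x y : Config V, (∀ e ∈ (pairsIn (block k .a))ᶜ, x e = y e) → (N x ↔ N y) := by
    intro x y h
    have h' : ∀ u v, k v ≠ .a → x s(u, v) = y s(u, v) := fun u v hv => h _ fun he =>
      hv (mem_block.1 (Finset.mk_mem_sym2_iff.1 he).2)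
    exact ⟨fun hN => ⟨hN.1.congr fun u v hv => by rw [h' u v hv],
        hN.2.congr fun u v hv => by rw [h' u v hv]⟩,
      fun hN => ⟨hN.1.congr fun u v hv => by rw [h' u v hv],
        hN.2.congr fun u v hv => by rw [h' u v hv]⟩⟩
  have hindep : ∀ M : Config V → Prop, (∀ x y : Config V,
      (∀ e ∈ (pairsIn (block k .a))ᶜ, x e = y e) → (M x ↔ M y)) →
      expect (letterWeight p) (fun ω => ind (M ω ∧ Q ω)) =
      expect (letterWeight p) (fun ω => ind (M ω)) *
        expect (letterWeight p) (fun ω => ind (Q ω)) := by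
    intro M hM
    have e1 : ∀ ω, ind (M ω ∧ Q ω) = ind (Q ω) * ind (M ω) := fun ω => by rw [ind_and, mul_comm]
    rw [funext e1, expect_mul_indep hw _ hQdep fun x y h => ind_congr (hM x y h), mul_comm]
  have hδ' := expect_not_anchored_or_linked_le h0 h1 hm0 hm
  have hN1 : expect (letterWeight p) (fun ω => ind (N ω)) =
      1 - expect (letterWeight p) (fun ω => ind (¬N ω)) := by
    have e1 : ∀ ω : Config V, ind (N ω) = 1 + -1 * ind (¬N ω) := fun ω => by rw [ind_not]; ring
    rw [funext e1, expect_add, expect_const hw, expect_const_mul]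
    ring
  set q := expect (letterWeight p) (fun ω => ind (Q ω)) with hq
  set δ := expect (letterWeight p) (fun ω => ind (¬N ω)) with hδdef
  set ρ := expect (letterWeight p) (fun ω =>
    ind (toGraph ω ∈ revealEvent (block k .a : Set V) H s t)) with hρ
  have hq0 : 0 ≤ q := expect_nonneg hw fun ω => ind_nonneg _
  have hρ0 : 0 ≤ ρ := expect_nonneg hw fun ω => ind_nonneg _
  have hlow : (1 / 2) ^ a * q ≤ 4 * ρ := by
    have e1 : expect (letterWeight p) (fun ω => ind ((N ω ∧ Q ω ∧ D ω) ∧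
        edgesIn ω Finset.univ = t)) ≤ ρ := expect_mono hw fun ω => ind_mono fun h =>
      (hR ω).2 ⟨h.1.2.1, h.1.2.2, h.2⟩
    rw [hstep2, hindep N hNdep, hN1] at hstep1
    have e2 : (1 / 2) ^ a * ((1 / 2) * q) ≤ (1 / 2) ^ a * ((1 - δ) * q) := by
      refine mul_le_mul_of_nonneg_left (mul_le_mul_of_nonneg_right ?_ hq0) (by positivity)
      linarith [hδ'.trans hδ]
    linarith
  have hatt : ∀ i, expect (letterWeight p) (fun ω => ind (Anchored k ω ∧ Q ω ∧ D ω ∧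
      ¬∃ A' ⊆ block k (.h i), A'.card = K ∧
        Reach (Allowed k i) (bit ω) Finset.univ (block k (.q i) ∪ A'))) ≤
      (3 * Fintype.card V + 2) * r ^ K * ((1 / 2) ^ a * q) := by
    intro i
    refine (expect_attempt_fails_le h0 h1 i (by rw [hm]; exact hsize i)
      (by have := hsize !i; omega) Q hQ d).trans ?_
    refine mul_le_mul_of_nonneg_right (mul_le_mul_of_nonneg_right ?_ (pow_nonneg hr0 K))
      (mul_nonneg (by positivity) hq0)
    have hle : (block k (.h !i)).card + (block k (.h i)).card ≤ Fintype.card V := by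
      rw [← Finset.card_union_of_disjoint (disjoint_block k (by simp))]
      exact Finset.card_le_univ _
    have : (((block k (.h !i)).card : ℝ) + (block k (.h i)).card) ≤ Fintype.card V := by
      exact_mod_cast hle
    linarith
  have hsplit : ∀ ω, ind (toGraph ω ∈ revealEvent (block k .a : Set V) H s t ∧ ¬Good k K ω) ≤
      ind (¬N ω ∧ Q ω) +
      (ind (Anchored k ω ∧ Q ω ∧ D ω ∧ ¬∃ A' ⊆ block k (.h true), A'.card = K ∧
        Reach (Allowed k true) (bit ω) Finset.univ (block k (.q true) ∪ A')) +
      ind (Anchored k ω ∧ Q ω ∧ D ω ∧ ¬∃ A' ⊆ block k (.h false), A'.card = K ∧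
        Reach (Allowed k false) (bit ω) Finset.univ (block k (.q false) ∪ A'))) := by
    intro ω
    refine (ind_mono fun h => ?_).trans ((ind_or_le _ _).trans
      (add_le_add le_rfl (ind_or_le _ _)))
    obtain ⟨hq, hd, -⟩ := (hR ω).1 h.1
    by_contra hcon
    rw [not_or, not_or] at hcon
    obtain ⟨c1, c2, c3⟩ := hcon
    have hN : N ω := by
      by_contra hN
      exact c1 ⟨hN, hq⟩
    refine h.2 ⟨hN.2, fun i => ?_⟩
    by_contra hi
    cases i
    · exact c3 ⟨hN.1, hq, hd, hi⟩
    · exact c2 ⟨hN.1, hq, hd, hi⟩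
  have hfin := expect_mono hw hsplit
  rw [expect_add, expect_add, hindep (fun ω => ¬N ω) fun x y h => not_congr (hNdep x y h)] at hfin
  have ht := hatt true
  have hf' := hatt false
  have hfirst : δ * q ≤ Fintype.card V * r ^ m * (2 ^ a * (4 * ρ)) := by
    refine mul_le_mul hδ' ?_ hq0 (by positivity)
    have e1 : q = 2 ^ a * ((1 / 2) ^ a * q) := by
      rw [← mul_assoc, ← mul_pow]
      norm_num
    rw [e1]
    exact mul_le_mul_of_nonneg_left hlow (by positivity)
  have hsecond : (3 * Fintype.card V + 2) * r ^ K * ((1 / 2) ^ a * q) ≤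
      (3 * Fintype.card V + 2) * r ^ K * (4 * ρ) :=
    mul_le_mul_of_nonneg_left hlow (by positivity)
  refine hfin.trans ?_
  nlinarith

end NotGood

/-! ### The recursive bound for a fixed number of vertices -/

section Recursion

open MeasureTheory

lemma worstFailureProb_nonneg_and_le_one (α : ℝ) (p : unitInterval) (hp1 : p < 1) (n : ℕ) :
    0 ≤ worstFailureProb α p n ∧ worstFailureProb α p n ≤ 1 := by
  obtain ⟨μ, ⟨A, H, s, t, -, h0, rfl⟩, hx⟩ := (isGreatest_worstFailureProb α p hp1 n).1
  have := ProbabilityTheory.cond_isProbabilityMeasure h0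
  rw [hx]
  exact ⟨measureReal_nonneg, measureReal_le_one⟩

/-- A set of vertices extends to a labelling with prescribed sizes of the blocks. -/
lemma exists_blocks {V : Type*} [Fintype V] (A : Set V) {K m : ℕ}
    (h : 4 * m + 3 * A.ncard + 4 * K ≤ Fintype.card V) :
    ∃ k : V → Block, (block k .a : Set V) = A ∧ (∀ i, (block k (.q i)).card = m) ∧
      ∀ i, (block k .a).card + 2 * K + m ≤ (block k (.h i)).card := by
  classical
  have hAc : A.toFinset.card = A.ncard := (Set.ncard_eq_toFinset_card' A).symm
  have hc0 : A.toFinsetᶜ.card = Fintype.card V - A.ncard := by rw [Finset.card_compl, hAc]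
  obtain ⟨S₀, hS₀, hc1⟩ := Finset.exists_subset_card_eq (s := A.toFinsetᶜ) (n := m) (by omega)
  obtain ⟨S₁, hS₁, hc2⟩ := Finset.exists_subset_card_eq (s := A.toFinsetᶜ \ S₀) (n := m)
    (by rw [Finset.card_sdiff_of_subset hS₀]; omega)
  have hc3 : ((A.toFinsetᶜ \ S₀) \ S₁).card = Fintype.card V - A.ncard - m - m := by
    rw [Finset.card_sdiff_of_subset hS₁, Finset.card_sdiff_of_subset hS₀]; omega
  obtain ⟨H₀, hH₀, hc4⟩ := Finset.exists_subset_card_eq (s := (A.toFinsetᶜ \ S₀) \ S₁)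
    (n := A.ncard + 2 * K + m) (by omega)
  have hc5 : (((A.toFinsetᶜ \ S₀) \ S₁) \ H₀).card =
      Fintype.card V - A.ncard - m - m - (A.ncard + 2 * K + m) := by
    rw [Finset.card_sdiff_of_subset hH₀]; omega
  let k : V → Block := fun v => if v ∈ A then .a else if v ∈ S₀ then .q false
    else if v ∈ S₁ then .q true else if v ∈ H₀ then .h false else .h true
  have h0 : ∀ v ∈ S₀, v ∉ A := fun v hv => by simpa using hS₀ hv
  have h1 : ∀ v ∈ S₁, v ∉ A ∧ v ∉ S₀ := fun v hv => by simpa using hS₁ hv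
  have h2 : ∀ v ∈ H₀, (v ∉ A ∧ v ∉ S₀) ∧ v ∉ S₁ := fun v hv => by simpa using hH₀ hv
  have ea : block k .a = A.toFinset := by
    ext v
    rw [mem_block, Set.mem_toFinset]
    simp only [k]
    grind
  have e0 : block k (.q false) = S₀ := by
    ext v
    have := h0 v
    rw [mem_block]
    simp only [k]
    grind
  have e1 : block k (.q true) = S₁ := by
    ext v
    have := h1 v
    rw [mem_block]
    simp only [k]
    grind
  have e2 : block k (.h false) = H₀ := by
    ext v
    have := h2 v
    rw [mem_block]
    simp only [k]
    grind
  have e3 : block k (.h true) = ((A.toFinsetᶜ \ S₀) \ S₁) \ H₀ := by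
    ext v
    rw [mem_block]
    simp only [k, Finset.mem_sdiff, Finset.mem_compl, Set.mem_toFinset]
    grind
  refine ⟨k, by rw [ea, Set.coe_toFinset], fun i => ?_, fun i => ?_⟩
  · cases i
    · rw [e0, hc1]
    · rw [e1, hc2]
  · rw [ea, hAc]
    cases i
    · rw [e2, hc4]
    · rw [e3, hc5]
      omega

/-- The bound for a given partially revealed graph, in terms of the sizes of the blocks. -/
theorem le_one_sub_cond (α : ℝ) (p : unitInterval) (hp1 : p < 1) {n K m : ℕ} (hm0 : 0 < m)
    (hK : (K : ℝ) ≤ ((m + K : ℕ) : ℝ) ^ (1 - 2 * α)) (A : Set (Fin n))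
    (hsize : 4 * m + 3 * A.ncard + 4 * K ≤ n)
    (hδ : n * (1 - min (p : ℝ) (1 - p) ^ 2) ^ m ≤ 1 / 2) (H : SimpleGraph A) (s : A → ZMod 2)
    (t : ZMod 2) (hE : SimpleGraph.binomialRandom (Fin n) p (revealEvent A H s t) ≠ 0) :
    (1 - (4 * 2 ^ A.ncard * (n * (1 - min (p : ℝ) (1 - p) ^ 2) ^ m) +
        8 * (3 * n + 2) * (1 - min (p : ℝ) (1 - p) ^ 2) ^ K)) *
      (1 - worstFailureProb α p (m + K) ^ 2) ≤
    1 - (ProbabilityTheory.cond (SimpleGraph.binomialRandom (Fin n) p)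
      (revealEvent A H s t)).real {G | ¬EvenDegenerate G} := by
  classical
  obtain ⟨k, rfl, hm, hh⟩ := exists_blocks A (K := K) (m := m) (by rwa [Fintype.card_fin])
  have hw := isProbVec_letterWeight.2 ⟨p.2.1, p.2.2⟩
  obtain ⟨hf0, hf1⟩ := worstFailureProb_nonneg_and_le_one α p hp1 (m + K)
  set f := worstFailureProb α p (m + K)
  set E := revealEvent (block k .a : Set (Fin n)) H s t with hEdef
  set μ := SimpleGraph.binomialRandom (Fin n) p
  have hlaw : ∀ S : Set (SimpleGraph (Fin n)),
      expect (letterWeight p) (fun ω => ind (toGraph ω ∈ S)) = μ.real S := fun S => by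
    rw [← expect_toGraph_pull_mem (Function.Embedding.refl (Fin n)) p S]
    congr 1
  have hbad := expect_good_le (k := k) α p hp1 hm hK H s t
  have hng := expect_not_good_le (k := k) p.2.1 p.2.2 hm0 hm hh (by rwa [Fintype.card_fin]) H s t
  rw [Fintype.card_fin] at hng
  rw [Set.ncard_coe_finset]
  set ε := 4 * 2 ^ (block k .a).card * (n * (1 - min (p : ℝ) (1 - p) ^ 2) ^ m) +
        8 * (3 * n + 2) * (1 - min (p : ℝ) (1 - p) ^ 2) ^ K
  rw [← hEdef] at hbad hng
  -- Split according to whether both attempts succeed.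
  set ρg := expect (letterWeight p) fun ω => ind (toGraph ω ∈ E ∧ Good k K ω)
  set ρn := expect (letterWeight p) fun ω => ind (toGraph ω ∈ E ∧ ¬Good k K ω)
  have hsum : μ.real E = ρg + ρn := by
    rw [← hlaw, ← expect_add]
    congr 1
    ext ω
    rw [ind_and, ind_and, ind_not]
    ring
  have hED : μ.real (E ∩ {G | ¬EvenDegenerate G}) ≤ f ^ 2 * ρg + ρn := by
    rw [← hlaw]
    refine le_trans ?_ (add_le_add_left hbad ρn)
    rw [← expect_add]
    refine expect_mono hw fun ω => (ind_mono fun h => ?_).trans (ind_or_le _ _)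
    by_cases hG : Good k K ω
    · exact Or.inl ⟨⟨h.1, hG⟩, h.2⟩
    · exact Or.inr ⟨h.1, hG⟩
  rw [hlaw] at hng
  have hpos : 0 < μ.real E := by
    rw [measureReal_def]
    exact ENNReal.toReal_pos hE (measure_ne_top _ _)
  have hEm : MeasurableSet E := (Set.toFinite E).measurableSet
  have hcond : (ProbabilityTheory.cond μ E).real {G | ¬EvenDegenerate G} =
      (μ.real E)⁻¹ * μ.real (E ∩ {G | ¬EvenDegenerate G}) := by
    rw [measureReal_def, ProbabilityTheory.cond_apply hEm, ENNReal.toReal_mul, ENNReal.toReal_inv]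
    rfl
  rw [hcond, le_sub_comm, inv_mul_le_iff₀ hpos]
  have hf2 : f ^ 2 ≤ 1 := pow_le_one₀ hf0 hf1
  have h1 : ρn * (1 - f ^ 2) ≤ ε * μ.real E * (1 - f ^ 2) :=
    mul_le_mul_of_nonneg_right hng (by linarith)
  have h2 : ρg = μ.real E - ρn := by linarith
  rw [h2] at hED
  nlinarith

end Recursion

/-! ### Asymptotics -/

section Asymptotics

open Filter Topology

lemma isLittleO_natCast_rpow {s : ℝ} (hs : s < 1) :
    (fun n : ℕ => (n : ℝ) ^ s) =o[atTop] fun n : ℕ => (n : ℝ) := by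
  refine (Asymptotics.isLittleO_iff_tendsto' ?_).2 ?_
  · filter_upwards [eventually_gt_atTop 0] with n hn h
    have : (0 : ℝ) < n := by exact_mod_cast hn
    exact absurd h this.ne'
  · refine ((tendsto_rpow_neg_atTop (sub_pos.2 hs)).comp tendsto_natCast_atTop_atTop).congr' ?_
    filter_upwards [eventually_gt_atTop 0] with n hn
    have : (0 : ℝ) < n := by exact_mod_cast hn
    rw [Function.comp_apply, neg_sub, Real.rpow_sub this, Real.rpow_one]

/-- The failure probabilities of the flags and of the attempts are exponentially small in `L`. -/
lemma failure_bound_le {l r L : ℝ} {n a K m : ℕ} (hr : r = Real.exp (-l)) (hl : 0 < l)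
    (hL : 3 ≤ L) (hLl : 20 ≤ L * l) (hn : 22 * L ^ 2 ≤ n) (hlog : Real.log n ≤ l / 4 * L)
    (hn' : L ^ 2 * (2 + l) ≤ l * n / 16) (ha : (a : ℝ) ≤ L ^ 2) (hK : L ≤ K)
    (hm : (n : ℝ) / 16 ≤ m) :
    4 * 2 ^ a * (n * r ^ m) + 8 * (3 * n + 2) * r ^ K ≤ Real.exp (-(l / 2 * L)) := by
  have hr0 : 0 < r := hr ▸ Real.exp_pos _
  have hL2 : (9 : ℝ) ≤ L ^ 2 := by nlinarith
  have hLL : L ≤ L ^ 2 := by nlinarith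
  have hnpos : (0 : ℝ) < n := by linarith
  have hrexp : ∀ j : ℕ, r ^ j = Real.exp (-(l * j)) := fun j => by
    rw [hr, ← Real.exp_nat_mul]
    congr 1
    ring
  have hnexp : (n : ℝ) = Real.exp (Real.log n) := (Real.exp_log hnpos).symm
  have hexp : ∀ x : ℝ, x + 1 ≤ Real.exp x := Real.add_one_le_exp
  have h8 : (8 : ℝ) ≤ Real.exp 7 := by linarith [hexp 7]
  have h2a : (2 : ℝ) ^ a ≤ Real.exp (L ^ 2) := by
    refine (pow_le_pow_left₀ (by norm_num) (by linarith [hexp 1] : (2 : ℝ) ≤ Real.exp 1) a).trans ?_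
    rw [← Real.exp_nat_mul, mul_one]
    exact Real.exp_le_exp.2 ha
  have h80 : (80 : ℝ) ≤ Real.exp 5 := by
    have h1 := Real.exp_one_gt_d9
    have h2 : Real.exp 5 = Real.exp 1 ^ 5 := by
      rw [← Real.exp_nat_mul]
      norm_num
    rw [h2]
    calc (80 : ℝ) ≤ 2.7 ^ 5 := by norm_num
      _ ≤ Real.exp 1 ^ 5 := pow_le_pow_left₀ (by norm_num) (by linarith) 5
  have hfirst : 8 * (2 ^ a * (n * r ^ m)) ≤ Real.exp (-(l / 2 * L)) := by
    calc 8 * (2 ^ a * (n * r ^ m))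
        ≤ Real.exp 7 * (Real.exp (L ^ 2) * (Real.exp (Real.log n) * Real.exp (-(l * m)))) := by
          rw [← hnexp, ← hrexp]
          gcongr
      _ = Real.exp (7 + (L ^ 2 + (Real.log n + -(l * m)))) := by simp only [Real.exp_add]
      _ ≤ Real.exp (-(l / 2 * L)) := by
          refine Real.exp_le_exp.2 ?_
          have h3 : l * (n / 16) ≤ l * m := mul_le_mul_of_nonneg_left hm hl.le
          have h4 : l * L ≤ l * L ^ 2 := mul_le_mul_of_nonneg_left hLL hl.le
          linarith
  have hsecond : 80 * n * r ^ K ≤ Real.exp (-(l / 2 * L)) := by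
    calc 80 * n * r ^ K
        ≤ Real.exp 5 * Real.exp (Real.log n) * Real.exp (-(l * K)) := by
          rw [← hnexp, ← hrexp]
          gcongr
      _ = Real.exp (5 + Real.log n + -(l * K)) := by simp only [Real.exp_add]
      _ ≤ Real.exp (-(l / 2 * L)) := by
          refine Real.exp_le_exp.2 ?_
          have h1 : l * L ≤ l * K := mul_le_mul_of_nonneg_left hK hl.le
          linarith
  have h5 : 16 * (3 * n + 2) * r ^ K ≤ 80 * n * r ^ K :=
    mul_le_mul_of_nonneg_right (by linarith) (pow_nonneg hr0.le K)
  linarith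

/-- The numerical inequalities needed for large `n`, with `K` and `m` the numbers of helpers kept
and of vertices in each `q`-block, when `a` vertices are revealed. -/
lemma eventually_bounds {α r : ℝ} (hα0 : 0 < α) (hα1 : α < 1 / 2) (hr0 : 0 < r) (hr1 : r < 1) :
    ∀ᶠ n : ℕ in atTop, ∀ a : ℕ, (a : ℝ) ≤ (n : ℝ) ^ (1 - 2 * α) →
      ∃ K m : ℕ, 0 < m ∧ (K : ℝ) ≤ ((m + K : ℕ) : ℝ) ^ (1 - 2 * α) ∧ 4 * m + 3 * a + 4 * K ≤ n ∧
        |((m + K : ℕ) : ℝ) - n / 4| ≤ (n : ℝ) ^ (1 - 2 * α) + 1 ∧ n * r ^ m ≤ 1 / 2 ∧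
        4 * 2 ^ a * (n * r ^ m) + 8 * (3 * n + 2) * r ^ K ≤
          Real.exp (-(-Real.log r / 2 * (n : ℝ) ^ (1 / 2 - α))) := by
  obtain ⟨l, hl⟩ : ∃ l, l = -Real.log r := ⟨_, rfl⟩
  have hr : r = Real.exp (-l) := by rw [hl, neg_neg, Real.exp_log hr0]
  have hl0 : 0 < l := by
    rw [hl, neg_pos]
    exact Real.log_neg hr0 hr1
  rw [← hl]
  obtain ⟨γ, hγ⟩ : ∃ γ, γ = 1 / 2 - α := ⟨_, rfl⟩
  rw [← hγ]
  have hγ0 : 0 < γ := by linarith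
  have hγ2 : 1 - 2 * α = γ * 2 := by rw [hγ]; ring
  -- With `L = n ^ γ`, the size of the revealed part is at most `L ^ 2`, and `log n = o(L)`.
  have hcast := tendsto_natCast_atTop_atTop (R := ℝ)
  have hL : Tendsto (fun n : ℕ => (n : ℝ) ^ γ) atTop atTop :=
    (tendsto_rpow_atTop hγ0).comp hcast
  have hlog : ∀ᶠ n : ℕ in atTop, Real.log n ≤ l / 4 * (n : ℝ) ^ γ := by
    filter_upwards [hcast.eventually ((isLittleO_log_rpow_atTop hγ0).bound
      (show 0 < l / 4 by positivity))] with n hn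
    rw [Real.norm_eq_abs, Real.norm_eq_abs, abs_of_nonneg (Real.rpow_nonneg n.cast_nonneg γ)] at hn
    exact (le_abs_self _).trans hn
  have hlin : ∀ ε : ℝ, 0 < ε → ∀ᶠ n : ℕ in atTop, (n : ℝ) ^ (1 - 2 * α) ≤ ε * n := by
    intro ε hε
    filter_upwards [(isLittleO_natCast_rpow (show 1 - 2 * α < 1 by linarith)).bound hε] with n hn
    rwa [Real.norm_eq_abs, Real.norm_eq_abs, Nat.abs_cast,
      abs_of_nonneg (Real.rpow_nonneg n.cast_nonneg _)] at hn
  filter_upwards [hlog, hlin (1 / 22) (by norm_num),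
    hlin (l / (16 * (2 + l))) (by positivity), hL.eventually_ge_atTop 3,
    hL.eventually_ge_atTop (20 / l), hL.eventually_ge_atTop (2 * 16 ^ (γ * 2))]
    with n hlog hlin1 hlin2 hL3 hLl hLγ a ha
  have hLsq : (n : ℝ) ^ (1 - 2 * α) = ((n : ℝ) ^ γ) ^ 2 := by
    rw [hγ2, Real.rpow_mul n.cast_nonneg, Real.rpow_two]
  have hn0 : (0 : ℝ) ≤ n := n.cast_nonneg
  have hdiv : ((n : ℝ) / 16) ^ (1 - 2 * α) = ((n : ℝ) ^ γ) ^ 2 / 16 ^ (γ * 2) := by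
    rw [Real.div_rpow hn0 (by norm_num), hLsq, hγ2]
  rw [hLsq] at ha hlin1 hlin2 ⊢
  generalize (n : ℝ) ^ γ = L at *
  have hn : 22 * L ^ 2 ≤ n := by linarith
  have hL2 : (9 : ℝ) ≤ L ^ 2 := by nlinarith
  have hLL : 3 * L ≤ L ^ 2 := by nlinarith
  have hn' : L ^ 2 * (2 + l) ≤ l * n / 16 := by
    rw [div_mul_eq_mul_div, le_div_iff₀ (by positivity)] at hlin2
    linarith
  obtain ⟨K, hK1, hK2⟩ : ∃ K : ℕ, L ≤ K ∧ (K : ℝ) < L + 1 :=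
    ⟨⌈L⌉₊, Nat.le_ceil L, Nat.ceil_lt_add_one (by linarith)⟩
  have hsz : 3 * a + 4 * K ≤ n := by
    have : (3 * a + 4 * K : ℝ) ≤ n := by linarith
    exact_mod_cast this
  obtain ⟨m, hm1, hm2⟩ : ∃ m, 4 * m + 3 * a + 4 * K ≤ n ∧ n ≤ 4 * m + 3 * a + 4 * K + 3 :=
    ⟨(n - (3 * a + 4 * K)) / 4, by omega, by omega⟩
  have hm1' : 4 * (m : ℝ) + 3 * a + 4 * K ≤ n := by exact_mod_cast hm1
  have hm2' : (n : ℝ) ≤ 4 * m + 3 * a + 4 * K + 3 := by exact_mod_cast hm2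
  have ha0 : (0 : ℝ) ≤ a := a.cast_nonneg
  have hK0 : (0 : ℝ) ≤ K := K.cast_nonneg
  have hmn : (n : ℝ) / 16 ≤ m := by linarith
  have hbound := failure_bound_le (a := a) hr hl0 hL3 ((div_le_iff₀ hl0).1 hLl) hn hlog hn' ha
    hK1 hmn
  refine ⟨K, m, ?_, ?_, hm1, ?_, ?_, hbound⟩
  · have : (0 : ℝ) < m := by linarith
    exact_mod_cast this
  · have h1 : ((n : ℝ) / 16) ^ (1 - 2 * α) ≤ ((m + K : ℕ) : ℝ) ^ (1 - 2 * α) := by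
      refine Real.rpow_le_rpow (by positivity) ?_ (by linarith)
      push_cast
      linarith
    refine le_trans ?_ h1
    have h16 : 0 < (16 : ℝ) ^ (γ * 2) := by positivity
    rw [hdiv, le_div_iff₀ h16]
    nlinarith
  · rw [abs_le]
    push_cast
    constructor <;> linarith
  · have hsmall : Real.exp (-(l / 2 * L)) ≤ 1 := by
      refine Real.exp_le_one_iff.2 (neg_nonpos.2 (mul_nonneg ?_ ?_)) <;> linarith
    have hnr : 0 ≤ n * r ^ m := mul_nonneg hn0 (pow_nonneg hr0.le m)
    have h2a : n * r ^ m ≤ 2 ^ a * (n * r ^ m) :=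
      le_mul_of_one_le_left hnr (one_le_pow₀ (by norm_num))
    have hrK : 0 ≤ 8 * (3 * n + 2) * r ^ K := by positivity
    linarith

end Asymptotics

end EvenDegeneracy

theorem theorem2p3 (α : ℝ) (hα0 : 0 < α) (hα1 : α < 1 / 2)
    (p : unitInterval) (hp0 : 0 < p) (hp1 : p < 1) :
    ∃ (N₀ : ℕ) (c : ℝ) (g : ℕ → ℝ), 0 < N₀ ∧ 0 < c ∧
      Asymptotics.IsLittleO Filter.atTop g (fun n : ℕ => (n : ℝ)) ∧
      ∀ n : ℕ, N₀ ≤ n →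
        ∃ M : ℝ,
          IsGreatest {x : ℝ | ∃ n' : ℕ,
            (n' : ℝ) ∈ Set.Icc ((n : ℝ) / 4 - g n) ((n : ℝ) / 4 + g n) ∧
            x = EvenDegeneracy.worstFailureProb α p n' ^ 2} M ∧
          (1 - Real.exp (-(c * (n : ℝ) ^ (1 / 2 - α)))) * (1 - M) ≤
            1 - EvenDegeneracy.worstFailureProb α p n := by
  have hp0' : (0 : ℝ) < p := hp0
  have hp1' : (p : ℝ) < 1 := hp1
  set r : ℝ := 1 - min (p : ℝ) (1 - p) ^ 2 with hr
  have hπ0 : 0 < min (p : ℝ) (1 - p) := lt_min hp0' (by linarith)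
  have hπ1 : min (p : ℝ) (1 - p) < 1 := (min_le_left _ _).trans_lt hp1'
  have hr0 : 0 < r := by rw [hr]; nlinarith
  have hr1 : r < 1 := by rw [hr]; nlinarith
  obtain ⟨N, hN⟩ := Filter.eventually_atTop.1 (EvenDegeneracy.eventually_bounds hα0 hα1 hr0 hr1)
  refine ⟨N + 1, -Real.log r / 2, fun n => (n : ℝ) ^ (1 - 2 * α) + 1, by omega, ?_, ?_, ?_⟩
  · have := Real.log_neg hr0 hr1
    linarith
  · exact (EvenDegeneracy.isLittleO_natCast_rpow (by linarith)).add
      ((Asymptotics.isLittleO_const_id_atTop (1 : ℝ)).comp_tendsto tendsto_natCast_atTop_atTop)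
  intro n hn
  obtain ⟨μ, ⟨A, H, s, t, hA, hE, rfl⟩, hx⟩ :=
    (EvenDegeneracy.isGreatest_worstFailureProb α p hp1 n).1
  rw [Fintype.card_fin] at hA
  obtain ⟨K, m, hm0, hK, hsize, hdist, hδ, hε⟩ := hN n (by omega) A.ncard hA
  set S := {x : ℝ | ∃ n' : ℕ, (n' : ℝ) ∈ Set.Icc ((n : ℝ) / 4 - ((n : ℝ) ^ (1 - 2 * α) + 1))
    ((n : ℝ) / 4 + ((n : ℝ) ^ (1 - 2 * α) + 1)) ∧
    x = EvenDegeneracy.worstFailureProb α p n' ^ 2} with hS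
  have hmem : EvenDegeneracy.worstFailureProb α p (m + K) ^ 2 ∈ S := by
    refine ⟨m + K, ?_, rfl⟩
    rw [abs_le] at hdist
    exact ⟨by linarith, by linarith⟩
  have hfin : S.Finite := by
    refine ((Set.finite_Iic ⌊(n : ℝ) / 4 + ((n : ℝ) ^ (1 - 2 * α) + 1)⌋₊).image
      fun n' => EvenDegeneracy.worstFailureProb α p n' ^ 2).subset ?_
    rintro x ⟨n', hn', rfl⟩
    exact ⟨n', Nat.le_floor hn'.2, rfl⟩
  obtain ⟨M, hM⟩ := hfin.isCompact.exists_isGreatest ⟨_, hmem⟩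
  refine ⟨M, hM, ?_⟩
  have hmain := EvenDegeneracy.le_one_sub_cond α p hp1 hm0 hK A hsize hδ H s t hE
  rw [← hx, ← hr] at hmain
  refine le_trans ?_ hmain
  obtain ⟨hf0, hf1⟩ := EvenDegeneracy.worstFailureProb_nonneg_and_le_one α p hp1 (m + K)
  have hf2 : EvenDegeneracy.worstFailureProb α p (m + K) ^ 2 ≤ 1 := pow_le_one₀ hf0 hf1
  have hM' := hM.2 hmem
  have hexp : Real.exp (-(-Real.log r / 2 * (n : ℝ) ^ (1 / 2 - α))) ≤ 1 := by
    refine Real.exp_le_one_iff.2 (neg_nonpos.2 (mul_nonneg ?_ (by positivity)))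
    have := Real.log_neg hr0 hr1
    linarith
  refine (mul_le_mul_of_nonneg_left (sub_le_sub_left hM' 1) (by linarith)).trans
    (mul_le_mul_of_nonneg_right (by linarith) (by linarith))
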